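/- Let $\Phi$ be holomorphic in the strip $-1<\operatorname{Re}s<2$ except for a possible simple pole at $s=0$, and let $k$ be the residue of $\Phi$ at $s=0$ (so $k=0$ if there is no pole). Suppose that for some $\delta>0$ $$\Phi(\sigma+it)\ll |t|^{-1-\delta}\qquad (t\to\pm\infty),\quad -1<\sigma<2,$$ with the implied constant uniform for $\sigma$ in every closed subinterval of $(-1,2)$. For $0<\sigma<2$ and $x>0$ define $$\phi(x)=\frac1{2\pi i}\int_{\sigma-i\infty}^{\sigma+i\infty}\Phi(s)\,x^{-s}\,ds .$$ Assume that all non-trivial zeros of the Riemann zeta function $\zeta$ (those with $0<\operatorname{Re}\rho<1$) are simple. Let $\mu$ be the Möbius function. Then there is a sequence of real numbers $T_1,T_2,\dots$ with $T_N\to\infty$ such that $$\sum_{n=1}^{\infty}\mu(n)\phi(n)=-2k+\lim_{N\to\infty}\sum_{\substack{\rho\\ |\operatorname{Im}\rho|<T_N}}\frac{1}{\zeta'(\rho)}\int_0^\infty\phi(x)\,x^{\rho-1}\,dx-4\sum_{n=1}^{\infty}\frac{\mu(n)}{n}\int_0^\infty\bigl(\phi(t)-k\bigr)\frac{\sin^2\!\bigl(\pi/(nt)\bigr)}{t}\,dt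 ,$$ where $\rho$ runs over the non-trivial zeros of $\zeta$. Here all the integrals and the two series over $n$ converge absolutely, and the limit over $N$ exists. -/

import Mathlib

/-- The non-trivial zeros of the Riemann zeta function: its zeros in the open strip `0 < Re s < 1`
(all other zeros are the negative even integers). -/
def nontrivialZetaZeros : Set ℂ :=
  {ρ : ℂ | riemannZeta ρ = 0 ∧ 0 < ρ.re ∧ ρ.re < 1}

theorem finite_nontrivialZetaZeros_im_lt (T : ℝ) :
    {ρ : ℂ | ρ ∈ nontrivialZetaZeros ∧ |ρ.im| < T}.Finite := by
  have hK : IsCompact (Set.Icc (0 : ℝ) 1 ×ℂ Set.Icc (-T) T) :=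
    isCompact_Icc.reProdIm isCompact_Icc
  refine hK.inter_riemannZetaZeros_finite.subset ?_
  rintro ρ ⟨⟨h0, h1, h2⟩, h3⟩
  have h4 := abs_lt.mp h3
  exact ⟨Complex.mem_reProdIm.mpr ⟨⟨h1.le, h2.le⟩, ⟨h4.1.le, h4.2.le⟩⟩, h0⟩

/-- The finite set of non-trivial zeros `ρ` of the zeta function with `|Im ρ| < T`. -/
noncomputable def nontrivialZetaZerosBelow (T : ℝ) : Finset ℂ :=
  (finite_nontrivialZetaZeros_im_lt T).toFinset

/-- `Φ` has at `c` at most a simple pole, with residue `k`: in a punctured neighbourhood of `c` it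
equals `k / (s - c)` plus a function that is analytic at `c` (so `k = 0` when there is no pole). -/
def HasAtMostSimplePoleWithResidue (Φ : ℂ → ℂ) (c k : ℂ) : Prop :=
  ∃ g : ℂ → ℂ, AnalyticAt ℂ g c ∧ ∀ᶠ s in nhdsWithin c {c}ᶜ, Φ s = k / (s - c) + g s

/-- `Φ(σ + it) ≪ |t|^(-1-δ)` as `t → ±∞`, for `-1 < σ < 2`, the implied constant being uniform for
`σ` in each closed subinterval `[a, b]` of `(-1, 2)`. -/
def DecaysInStrip (Φ : ℂ → ℂ) (δ : ℝ) : Prop :=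
  ∀ a b : ℝ, -1 < a → a ≤ b → b < 2 →
    ∃ C T₀ : ℝ, 0 < T₀ ∧ ∀ σ t : ℝ, a ≤ σ → σ ≤ b → T₀ ≤ |t| →
      ‖Φ ((σ : ℂ) + (t : ℂ) * Complex.I)‖ ≤ C * |t| ^ (-1 - δ)

/-!
The formula is the residue theorem for `Φ / ζ` on the rectangle `[-1/2, 21/20] × [-T, T]`.

The right-hand side is integrated termwise with `1 / ζ(s) = ∑ μ(n) n ^ (-s)`, which gives
`∑ μ(n) φ(n)` (`hasSum_moebius_mul_mellinInv`). The pole at `0` contributes `k / ζ(0) = -2 k`, and a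
zero `ρ` contributes `Φ(ρ) / ζ'(ρ)`, where `Φ(ρ)` is the Mellin transform of `φ` at `ρ` by inversion
(`mellin_mellinInv`); the pole of `ζ` at `1` leaves no residue
(`rectIntegral_mul_inv_riemannZeta`). On the left-hand side the functional equation reads
`1 / ζ(s) = 2 (2 π) ^ (-s) Γ(s) cos(π s / 2) / ζ(1 - s)`. Here `Γ(s) cos(π s / 2)` is, up to a sign,
the Mellin transform of `1 - cos x = 2 sin² (x / 2)` in `-1 < Re s < 0`
(`mellin_one_sub_cos`), and expanding `1 / ζ(1 - s)` turns the left-hand integral into the series of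
the integrals of `(φ(t) - k) sin² (π / (n t)) / t`, because `φ - k` is the inverse Mellin transform
of `Φ` along a line to the left of `0` (`mellinInv_sub_eq_of_neg`,
`hasSum_moebius_div_mul_integral_mellinInv`).

What remains is to make the horizontal sides disappear. As `Φ` decays like `|t| ^ (-1 - δ)`, it
suffices that `1 / ζ = O(T)` on them for a sequence of heights `T`
(`exists_height_norm_inv_riemannZeta_le`). As the Gamma factors on a horizontal line are at most of
the order of the one on `Re s = 21/20`, where `1 / ζ` is bounded, this is a lower bound for `ξ`
relative to its value there. Up to a bounded error, the logarithm of the ratio of these values is,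
by Hadamard's factorization (`sq_eq_prod_mul_exp_of_even`), a sum over the zeros `ρ` of logarithms
of ratios of distances, each at most `logDistRatio a (T - Im ρ)`, where `a = 21/20 - Re ρ`. The
integral over `T` of this function is `π a`, and `a` is `11/20` on average by the symmetry
`ρ ↦ 1 - ρ`. Jensen's formula bounds the number of zeros (`exists_card_centredXiZeros_le`), so the
mean value of the sum over `X / 20 ≤ |T| ≤ X` is at most `0.92 log X + O(1)`, and some height `T`
does as well as the mean (`exists_height_sum_logDistRatio_le`). The coefficient of `log X` must not
exceed `1`, because `1 / ζ = O(T)` is what the decay of `Φ` can absorb for every `δ > 0`.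
-/

/-! ### Growth of the Riemann `ξ` function -/

section
open Complex Filter Topology MeasureTheory Set

/-- `y ^ a ≤ a ^ a * e ^ y` for positive `a`, `y`. -/
lemma rpow_le_rpow_self_mul_exp {a y : ℝ} (ha : 0 < a) (hy : 0 < y) :
    y ^ a ≤ a ^ a * Real.exp y := by
  rw [Real.rpow_def_of_pos hy, Real.rpow_def_of_pos ha, ← Real.exp_add, Real.exp_le_exp]
  have h := Real.log_le_sub_one_of_pos (div_pos hy ha)
  rw [Real.log_div hy.ne' ha.ne'] at h
  have h2 : (Real.log y - Real.log a) * a ≤ (y / a - 1) * a := by gcongr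
  have h3 : (y / a - 1) * a = y - a := by field_simp
  nlinarith

/-- The Mellin transform of a function that decays exponentially grows at most like
`σ ^ σ * e ^ (O(σ))`, uniformly on vertical lines. -/
lemma exists_norm_mellin_le_of_isBigO_exp {F : ℝ → ℂ} {σ₀ p : ℝ} (hσ₀ : 0 < σ₀) (hp : 0 < p)
    (hF : MellinConvergent F σ₀) (hO : F =O[atTop] fun x ↦ Real.exp (-p * x)) :
    ∃ C : ℝ, 0 < C ∧ ∀ s : ℂ, σ₀ ≤ s.re →
      ‖mellin F s‖ ≤ Real.exp ((s.re + 1) * Real.log (s.re + 1) + C * (s.re + 1)) := by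
  obtain ⟨C₁, hC₁, hO⟩ := hO.exists_pos
  rw [Asymptotics.IsBigOWith, eventually_atTop] at hO
  obtain ⟨X₀, hX₀⟩ := hO
  set X := max X₀ 1 with hX
  have hX1 : 1 ≤ X := le_max_right _ _
  set A : ℝ := ∫ x in Ioi (0 : ℝ), x ^ (σ₀ - 1) * ‖F x‖ with hA
  have hA0 : 0 ≤ A := setIntegral_nonneg measurableSet_Ioi fun x hx ↦
    mul_nonneg (Real.rpow_nonneg (le_of_lt hx) _) (norm_nonneg _)
  have hnorm : ∀ s : ℂ, ∀ x ∈ Ioi (0 : ℝ),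
      ‖(x : ℂ) ^ (s - 1) • F x‖ = x ^ (s.re - 1) * ‖F x‖ := by
    intro s x hx
    rw [norm_smul, norm_cpow_eq_rpow_re_of_pos hx]
    simp
  have hAint : IntegrableOn (fun x : ℝ ↦ x ^ (σ₀ - 1) * ‖F x‖) (Ioi 0) := by
    refine (integrableOn_congr_fun (fun x hx ↦ ?_) measurableSet_Ioi).mp hF.norm
    simpa using hnorm σ₀ x hx
  have hBint : IntegrableOn (fun x : ℝ ↦ (Ioi (1 : ℝ)).indicator (fun x ↦ x ^ (-2 : ℝ)) x)
      (Ioi 0) := by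
    refine IntegrableOn.integrable ?_
    have := (integrableOn_Ioi_rpow_of_lt (a := -2) (by norm_num) (one_pos)).integrable_indicator
      measurableSet_Ioi
    exact this.integrableOn
  set B : ℝ := ∫ x in Ioi (0 : ℝ), (Ioi (1 : ℝ)).indicator (fun x ↦ x ^ (-2 : ℝ)) x with hB
  have hB0 : 0 ≤ B := integral_nonneg fun x ↦ indicator_nonneg
    (fun x hx ↦ Real.rpow_nonneg (by linarith [mem_Ioi.mp hx]) _) x
  have hlogX : 0 ≤ Real.log X := Real.log_nonneg hX1
  refine ⟨Real.log X + |Real.log p| + (A + C₁ * B) + 1, by positivity, fun s hs ↦ ?_⟩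
  set σ := s.re with hσ
  have h1 : ‖mellin F s‖ ≤ X ^ (σ - σ₀) * A + C₁ * ((σ + 1) / p) ^ (σ + 1) * B := by
    rw [hA, hB, ← integral_const_mul, ← integral_const_mul, ← integral_add]
    · refine norm_integral_le_of_norm_le ((hAint.const_mul _).add (hBint.const_mul _)) ?_
      refine (ae_restrict_iff' measurableSet_Ioi).mpr (Eventually.of_forall fun x hx ↦ ?_)
      rw [hnorm s x hx]
      have hx0 : 0 < x := hx
      by_cases hxX : x ≤ X
      · have e1 : x ^ (σ - 1) = x ^ (σ - σ₀) * x ^ (σ₀ - 1) := by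
          rw [← Real.rpow_add hx0]; ring_nf
        have e2 : x ^ (σ - σ₀) ≤ X ^ (σ - σ₀) :=
          Real.rpow_le_rpow hx0.le hxX (by linarith)
        have e3 : 0 ≤ C₁ * ((σ + 1) / p) ^ (σ + 1) *
            (Ioi (1 : ℝ)).indicator (fun x ↦ x ^ (-2 : ℝ)) x := by
          have : 0 ≤ (Ioi (1 : ℝ)).indicator (fun x ↦ x ^ (-2 : ℝ)) x := indicator_nonneg
            (fun x hx ↦ Real.rpow_nonneg (by linarith [mem_Ioi.mp hx]) _) x
          have : 0 < σ + 1 := by linarith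
          positivity
        rw [← hσ, e1, mul_assoc]
        have := mul_le_mul_of_nonneg_right e2
          (mul_nonneg (Real.rpow_nonneg hx0.le (σ₀ - 1)) (norm_nonneg (F x)))
        linarith
      · push Not at hxX
        have hx1 : 1 < x := by linarith
        rw [indicator_of_mem (mem_Ioi.mpr hx1)]
        have e1 := hX₀ x (by linarith [le_max_left X₀ 1])
        rw [Real.norm_of_nonneg (Real.exp_nonneg _)] at e1
        have e0 : 0 ≤ X ^ (σ - σ₀) * (x ^ (σ₀ - 1) * ‖F x‖) := by positivity
        have e2 : x ^ (σ - 1) = x ^ (σ + 1) * x ^ (-2 : ℝ) := by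
          rw [← Real.rpow_add hx0]; ring_nf
        have e3 : x ^ (σ + 1) * Real.exp (-p * x) ≤ ((σ + 1) / p) ^ (σ + 1) := by
          have := rpow_le_rpow_self_mul_exp (a := σ + 1) (by linarith) (mul_pos hp hx0)
          rw [Real.mul_rpow hp.le hx0.le] at this
          rw [Real.div_rpow (by linarith) hp.le, le_div_iff₀ (by positivity)]
          have e4 : Real.exp (p * x) * Real.exp (-p * x) = 1 := by
            rw [← Real.exp_add]; simp
          calc x ^ (σ + 1) * Real.exp (-p * x) * p ^ (σ + 1)
              = (p ^ (σ + 1) * x ^ (σ + 1)) * Real.exp (-p * x) := by ring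
            _ ≤ ((σ + 1) ^ (σ + 1) * Real.exp (p * x)) * Real.exp (-p * x) := by gcongr
            _ = (σ + 1) ^ (σ + 1) := by rw [mul_assoc, e4, mul_one]
        rw [← hσ]
        calc x ^ (σ - 1) * ‖F x‖ ≤ x ^ (σ - 1) * (C₁ * Real.exp (-p * x)) := by gcongr
          _ = C₁ * (x ^ (σ + 1) * Real.exp (-p * x)) * x ^ (-2 : ℝ) := by rw [e2]; ring
          _ ≤ C₁ * ((σ + 1) / p) ^ (σ + 1) * x ^ (-2 : ℝ) := by gcongr
          _ ≤ _ := by linarith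
    · exact hAint.const_mul _
    · exact hBint.const_mul _
  have hσ1 : 1 ≤ σ + 1 := by linarith
  have hlog : 0 ≤ Real.log (σ + 1) := Real.log_nonneg hσ1
  set E := (σ + 1) * Real.log (σ + 1) + (Real.log X + |Real.log p|) * (σ + 1) with hE
  have h2 : X ^ (σ - σ₀) ≤ Real.exp E := by
    rw [Real.rpow_def_of_pos (by linarith), Real.exp_le_exp, hE]
    nlinarith [mul_nonneg hlogX hσ₀.le, mul_nonneg (by linarith : 0 ≤ σ + 1) hlog,
      mul_nonneg (by linarith : 0 ≤ σ + 1) (abs_nonneg (Real.log p))]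
  have h3 : ((σ + 1) / p) ^ (σ + 1) ≤ Real.exp E := by
    rw [Real.rpow_def_of_pos (by positivity), Real.exp_le_exp, hE,
      Real.log_div (by positivity) hp.ne']
    nlinarith [neg_abs_le (Real.log p), mul_nonneg (by linarith : 0 ≤ σ + 1) hlogX]
  have hK : A + C₁ * B ≤ Real.exp ((A + C₁ * B + 1) * (σ + 1)) := by
    have e1 := Real.add_one_le_exp ((A + C₁ * B + 1) * (σ + 1))
    have e2 : 0 ≤ A + C₁ * B := by positivity
    nlinarith
  calc ‖mellin F s‖ ≤ X ^ (σ - σ₀) * A + C₁ * ((σ + 1) / p) ^ (σ + 1) * B := h1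
    _ ≤ Real.exp E * A + C₁ * Real.exp E * B := by gcongr
    _ = Real.exp E * (A + C₁ * B) := by ring
    _ ≤ Real.exp E * Real.exp ((A + C₁ * B + 1) * (σ + 1)) := by gcongr
    _ = _ := by rw [← Real.exp_add, hE]; ring_nf

/-- The entire function `Λ(s) + 1 / s + 1 / (1 - s)` grows at most like `exp (σ / 2 * log σ + O(σ))`
in the half-plane `1 / 2 ≤ Re s`. -/
lemma exists_norm_completedRiemannZeta₀_le :
    ∃ C : ℝ, 0 < C ∧ ∀ s : ℂ, 1 / 2 ≤ s.re → ‖completedRiemannZeta₀ s‖ ≤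
      Real.exp ((s.re / 2 + 1) * Real.log (s.re / 2 + 1) + C * (s.re / 2 + 1)) := by
  set P := HurwitzZeta.hurwitzEvenFEPair 0
  obtain ⟨p, hp, hO⟩ := HurwitzZeta.isBigO_atTop_evenKernel_sub 0
  have hF : MellinConvergent P.f_modif ((1 / 4 : ℝ) : ℂ) := by
    let Q := P.isStrongFEPair_toStrongFEPair
    exact mellinConvergent_of_isBigO_rpow (b := 0) P.hf_modif_int (Q.hf_top (-1)) (by norm_num)
      (Q.hf_zero (-0)) (by norm_num)
  have hO' : P.f_modif =O[atTop] fun x ↦ Real.exp (-p * x) := by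
    rw [← Asymptotics.isBigO_norm_left]
    refine (Asymptotics.isBigO_norm_left.mpr hO).congr' ?_ .rfl
    filter_upwards [eventually_gt_atTop 1] with x hx
    rw [WeakFEPair.f_modif, Pi.add_apply, indicator_of_mem (mem_Ioi.mpr hx),
      indicator_of_notMem (notMem_Ioo_of_ge hx.le), add_zero, ← norm_real]
    simp [P, HurwitzZeta.hurwitzEvenFEPair]
  obtain ⟨C, hC, h⟩ := exists_norm_mellin_le_of_isBigO_exp (by norm_num) hp hF hO'
  refine ⟨C, hC, fun s hs ↦ ?_⟩
  have h1 := h (s / 2) (by simp; linarith)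
  have h2 : completedRiemannZeta₀ s = mellin P.f_modif (s / 2) / 2 := rfl
  have h3 : (s / 2).re = s.re / 2 := by simp
  rw [h3] at h1
  rw [h2, norm_div, Complex.norm_ofNat]
  linarith [norm_nonneg (mellin P.f_modif (s / 2))]

/-- Riemann's `ξ` function `s (s - 1) Λ(s)`, centred at the symmetry point of its functional
equation: `centredXi z = ξ (1 / 2 + z)`. It is an even entire function. -/
noncomputable def centredXi (z : ℂ) : ℂ :=
  (z ^ 2 - 1 / 4) * completedRiemannZeta₀ (1 / 2 + z) + 1

lemma differentiable_centredXi : Differentiable ℂ centredXi := by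
  have h : Differentiable ℂ fun z : ℂ ↦ completedRiemannZeta₀ (1 / 2 + z) :=
    differentiable_completedZeta₀.comp (by fun_prop)
  unfold centredXi
  fun_prop

lemma centredXi_neg (z : ℂ) : centredXi (-z) = centredXi z := by
  unfold centredXi
  rw [← completedRiemannZeta₀_one_sub (1 / 2 + z)]
  ring_nf

lemma centredXi_eq_mul_riemannZeta {s : ℂ} (h0 : s ≠ 0) (h1 : s ≠ 1) (hG : Gammaℝ s ≠ 0) :
    centredXi (s - 1 / 2) = s * (s - 1) * Gammaℝ s * riemannZeta s := by
  rw [riemannZeta_def_of_ne_zero h0, mul_assoc, mul_div_cancel₀ _ hG, completedRiemannZeta_eq,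
    centredXi]
  have h1' : 1 - s ≠ 0 := sub_ne_zero.mpr h1.symm
  rw [show (1 : ℂ) / 2 + (s - 1 / 2) = s by ring]
  field_simp
  ring

/-- The order of growth of `ξ`, with the exact leading constant in each direction. -/
lemma exists_norm_centredXi_le : ∃ C : ℝ, 0 < C ∧ ∀ z : ℂ,
    ‖centredXi z‖ ≤ Real.exp (|z.re| / 2 * Real.log (‖z‖ + 2) + C * (‖z‖ + 1)) := by
  obtain ⟨C, hC, h⟩ := exists_norm_completedRiemannZeta₀_le
  have key : ∃ C' : ℝ, 0 < C' ∧ ∀ z : ℂ, 0 ≤ z.re →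
      ‖centredXi z‖ ≤ Real.exp (|z.re| / 2 * Real.log (‖z‖ + 2) + C' * (‖z‖ + 1)) := by
    refine ⟨2 * C + 5, by positivity, fun z hz ↦ ?_⟩
    have h1 := h (1 / 2 + z) (by simpa using hz)
    have hre : (1 / 2 + z).re / 2 + 1 = z.re / 2 + 5 / 4 := by simp; ring
    rw [hre] at h1
    have hzn : z.re ≤ ‖z‖ := re_le_norm z
    set r := ‖z‖ with hr
    have hr0 : 0 ≤ r := norm_nonneg z
    have hlog1 : Real.log (z.re / 2 + 5 / 4) ≤ Real.log (r + 2) :=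
      Real.log_le_log (by linarith) (by linarith)
    have hlog2 : 0 ≤ Real.log (z.re / 2 + 5 / 4) := Real.log_nonneg (by linarith)
    have hlog3 : Real.log (r + 2) ≤ r + 1 := by
      linarith [Real.log_le_sub_one_of_pos (show 0 < r + 2 by linarith)]
    set E := z.re / 2 * Real.log (r + 2) + (C + 5 / 4) * (r + 5 / 4) with hE
    have h2 : ‖completedRiemannZeta₀ (1 / 2 + z)‖ ≤ Real.exp E := by
      refine h1.trans (Real.exp_le_exp.mpr ?_)
      have e1 : (z.re / 2 + 5 / 4) * Real.log (z.re / 2 + 5 / 4) ≤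
          (z.re / 2 + 5 / 4) * Real.log (r + 2) := by gcongr
      have e2 : C * (z.re / 2 + 5 / 4) ≤ C * (r + 5 / 4) := by gcongr; linarith
      nlinarith
    have h3 : ‖z ^ 2 - 1 / 4‖ ≤ r ^ 2 + 1 / 4 := by
      refine (norm_sub_le _ _).trans ?_
      simp [hr]
    have hE0 : 1 ≤ Real.exp E := by
      refine Real.one_le_exp ?_
      have : 0 ≤ Real.log (r + 2) := Real.log_nonneg (by linarith)
      positivity
    have h4 : r ^ 2 + 5 / 4 ≤ Real.exp (2 * (r + 1 / 4)) := by
      have := Real.quadratic_le_exp_of_nonneg (show 0 ≤ 2 * (r + 1 / 4) by positivity)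
      nlinarith
    calc ‖centredXi z‖ ≤ ‖z ^ 2 - 1 / 4‖ * ‖completedRiemannZeta₀ (1 / 2 + z)‖ + 1 := by
          unfold centredXi
          refine (norm_add_le _ _).trans ?_
          rw [norm_mul]; simp
      _ ≤ (r ^ 2 + 1 / 4) * Real.exp E + Real.exp E := by gcongr
      _ = (r ^ 2 + 5 / 4) * Real.exp E := by ring
      _ ≤ Real.exp (2 * (r + 1 / 4)) * Real.exp E := by gcongr
      _ ≤ _ := by
          rw [← Real.exp_add, Real.exp_le_exp, abs_of_nonneg hz, hE]
          nlinarith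
  obtain ⟨C', hC', h'⟩ := key
  refine ⟨C', hC', fun z ↦ ?_⟩
  rcases le_total 0 z.re with hz | hz
  · exact h' z hz
  · have := h' (-z) (by simpa using hz)
    simpa [centredXi_neg] using this
end

/-! ### Hadamard factorization in a disc -/

section
open Complex Filter Topology MeasureTheory Set Metric

/-- An entire function is divisible by the linear factors at any finite set of its zeros. -/
lemma Differentiable.exists_eq_prod_sub_mul {f : ℂ → ℂ} (hf : Differentiable ℂ f) (S : Finset ℂ)
    (hS : ∀ ρ ∈ S, f ρ = 0) :
    ∃ g : ℂ → ℂ, Differentiable ℂ g ∧ ∀ z, f z = (∏ ρ ∈ S, (z - ρ)) * g z := by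
  induction S using Finset.induction_on with
  | empty => exact ⟨f, hf, by simp⟩
  | insert a S ha ih =>
    obtain ⟨g, hg, h⟩ := ih fun ρ hρ ↦ hS ρ (Finset.mem_insert_of_mem hρ)
    have hga : g a = 0 := by
      have h1 := h a
      rw [hS a (Finset.mem_insert_self _ _)] at h1
      refine (mul_eq_zero.mp h1.symm).resolve_left (Finset.prod_ne_zero_iff.mpr fun ρ hρ ↦ ?_)
      exact sub_ne_zero.mpr fun e ↦ ha (e ▸ hρ)
    refine ⟨dslope g a, ?_, fun z ↦ ?_⟩
    · rw [← differentiableOn_univ, differentiableOn_dslope univ_mem]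
      exact hg.differentiableOn
    · have h2 := sub_smul_dslope g a z
      rw [hga, sub_zero, smul_eq_mul] at h2
      rw [Finset.prod_insert ha, h z, ← h2]
      ring

/-- If all zeros in `S` are simple, the cofactor of the linear factors does not vanish on `S`. -/
lemma ne_zero_of_eq_prod_sub_mul {f g : ℂ → ℂ} {S : Finset ℂ} (hg : Differentiable ℂ g)
    (h : ∀ z, f z = (∏ ρ ∈ S, (z - ρ)) * g z) {a : ℂ} (ha : a ∈ S) (hd : deriv f a ≠ 0) :
    g a ≠ 0 := by
  intro hga
  apply hd
  have h1 : f = fun z ↦ (z - a) * ((∏ ρ ∈ S.erase a, (z - ρ)) * g z) := by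
    ext z
    rw [h z, ← Finset.mul_prod_erase S _ ha, mul_assoc]
  have hk : Differentiable ℂ fun z ↦ (∏ ρ ∈ S.erase a, (z - ρ)) * g z := by fun_prop
  have h2 := ((hasDerivAt_id a).sub_const a).mul (hk a).hasDerivAt
  rw [h1]
  refine h2.deriv.trans ?_
  simp [hga]

/-- A nowhere vanishing holomorphic function on a disc has a holomorphic logarithm there. -/
lemma exists_eq_mul_exp_of_ne_zero_on_ball {g : ℂ → ℂ} {R : ℝ} (hg : Differentiable ℂ g)
    (h0 : ∀ z ∈ ball (0 : ℂ) R, g z ≠ 0) (hR : 0 < R) :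
    ∃ h : ℂ → ℂ, DifferentiableOn ℂ h (ball 0 R) ∧ h 0 = 0 ∧
      ∀ z ∈ ball (0 : ℂ) R, g z = g 0 * exp (h z) := by
  have hd : Differentiable ℂ (deriv g) := by
    rw [← differentiableOn_univ]
    exact hg.differentiableOn.deriv isOpen_univ
  have hq : DifferentiableOn ℂ (fun z ↦ deriv g z / g z) (ball 0 R) :=
    hd.differentiableOn.div hg.differentiableOn h0
  obtain ⟨h, hh0, hh⟩ := (hq.isExactOn_ball).with_val_at 0 0
  have hz0 : (0 : ℂ) ∈ ball (0 : ℂ) R := mem_ball_self hR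
  refine ⟨h, fun z hz ↦ (hh z hz).differentiableAt.differentiableWithinAt, hh0, fun z hz ↦ ?_⟩
  have hk : ∀ w ∈ ball (0 : ℂ) R, HasDerivAt (fun z ↦ g z * exp (-h z)) 0 w := by
    intro w hw
    have h1 := (hg w).hasDerivAt.mul ((hh w hw).neg.cexp)
    have h2 : deriv g w * exp ((-h) w) + g w * (exp ((-h) w) * -(deriv g w / g w)) = 0 := by
      have := h0 w hw
      field_simp
      ring
    rw [h2] at h1
    exact h1
  have hconst := (convex_ball (0 : ℂ) R).is_const_of_fderivWithin_eq_zero (𝕜 := ℂ)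
    (f := fun z ↦ g z * exp (-h z))
    (fun w hw ↦ (hk w hw).differentiableAt.differentiableWithinAt)
    (fun w hw ↦ by
      rw [fderivWithin_of_isOpen isOpen_ball hw]
      ext
      simpa using (hk w hw).deriv) hz hz0
  simp only [hh0, neg_zero, exp_zero, mul_one] at hconst
  rw [← hconst, mul_assoc, ← exp_add]
  simp

/-- Quantitative form of Hadamard's factorization of an even entire function with simple zeros:
up to an explicit error, the function is a constant times the product over its zeros in a disc.
Squaring replaces the logarithm `h` of the cofactor by the even function `h z + h (-z)`, whose
linear term vanishes; this is what makes the error quadratic in `z`. -/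
theorem sq_eq_prod_mul_exp_of_even {f : ℂ → ℂ} (hf : Differentiable ℂ f)
    (heven : ∀ z, f (-z) = f z) (h0 : f 0 ≠ 0) (hs : ∀ ρ, f ρ = 0 → deriv f ρ ≠ 0) {R M : ℝ}
    (hR : 0 < R) (hM : 0 < M) (hbound : ∀ z, ‖z‖ = 2 * R → ‖f z‖ ≤ Real.exp M * ‖f 0‖)
    {S : Finset ℂ} (hS : ∀ ρ, ρ ∈ S ↔ f ρ = 0 ∧ ‖ρ‖ < R) {z : ℂ} (hz : ‖z‖ < R / 2) :
    ∃ H : ℂ, f z ^ 2 = f 0 ^ 2 * (∏ ρ ∈ S, (1 - z / ρ)) ^ 2 * exp H ∧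
      ‖H‖ ≤ 16 * M * (‖z‖ / R) ^ 2 := by
  obtain ⟨g, hg, hfg⟩ := hf.exists_eq_prod_sub_mul S fun ρ hρ ↦ ((hS ρ).mp hρ).1
  have hρ0 : ∀ ρ ∈ S, ρ ≠ 0 := fun ρ hρ e ↦ h0 (e ▸ ((hS ρ).mp hρ).1)
  have hg0 : ∀ z ∈ ball (0 : ℂ) R, g z ≠ 0 := by
    intro w hw hgw
    have hfw : f w = 0 := by rw [hfg, hgw, mul_zero]
    exact ne_zero_of_eq_prod_sub_mul hg hfg ((hS w).mpr ⟨hfw, by simpa using hw⟩) (hs w hfw) hgw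
  obtain ⟨h, hhd, hh0, hh⟩ := exists_eq_mul_exp_of_ne_zero_on_ball hg hg0 hR
  have hP : ∀ w, f w * g 0 = f 0 * (∏ ρ ∈ S, (1 - w / ρ)) * g w := by
    intro w
    rw [hfg w, hfg 0]
    have : ∏ ρ ∈ S, (w - ρ) = (∏ ρ ∈ S, (0 - ρ)) * ∏ ρ ∈ S, (1 - w / ρ) := by
      rw [← Finset.prod_mul_distrib]
      refine Finset.prod_congr rfl fun ρ hρ ↦ ?_
      have := hρ0 ρ hρ
      field_simp
      ring
    rw [this]
    ring
  have hgz : g 0 ≠ 0 := hg0 0 (mem_ball_self hR)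
  -- for `|v| = 2 R` each factor `1 - v / ρ` has modulus at least `1`, so that the bound for `f`
  -- passes to `g`
  have hmax : ∀ w ∈ ball (0 : ℂ) R, ‖g w‖ ≤ Real.exp M * ‖g 0‖ := by
    intro w hw
    refine norm_le_of_forall_mem_frontier_norm_le (U := ball (0 : ℂ) (2 * R)) isBounded_ball
      hg.diffContOnCl (fun v hv ↦ ?_) (subset_closure (ball_subset_ball (by linarith) hw))
    rw [frontier_ball _ (by positivity), mem_sphere_zero_iff_norm] at hv
    have h1 := congrArg norm (hP v)
    rw [norm_mul, norm_mul, norm_mul, norm_prod] at h1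
    have h2 : 1 ≤ ∏ ρ ∈ S, ‖1 - v / ρ‖ := by
      refine Finset.one_le_prod fun ρ hρ ↦ ?_
      have hρ1 := ((hS ρ).mp hρ).2
      have hρ2 : 0 < ‖ρ‖ := norm_pos_iff.mpr (hρ0 ρ hρ)
      have h3 : 2 ≤ ‖v / ρ‖ := by
        rw [norm_div, le_div_iff₀ hρ2, hv]; linarith
      have h4 := norm_sub_norm_le (v / ρ) 1
      rw [norm_sub_rev, norm_one] at h4
      linarith
    have hf0 : 0 < ‖f 0‖ := norm_pos_iff.mpr h0
    have h5 : ‖f 0‖ * ‖g v‖ ≤ ‖f 0‖ * (Real.exp M * ‖g 0‖) := by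
      calc ‖f 0‖ * ‖g v‖ = ‖f 0‖ * 1 * ‖g v‖ := by ring
        _ ≤ ‖f 0‖ * (∏ ρ ∈ S, ‖1 - v / ρ‖) * ‖g v‖ := by gcongr
        _ = ‖f v‖ * ‖g 0‖ := h1.symm
        _ ≤ (Real.exp M * ‖f 0‖) * ‖g 0‖ := by gcongr; exact hbound v hv
        _ = _ := by ring
    exact le_of_mul_le_mul_left h5 hf0
  -- Borel–Carathéodory turns the bound for `Re h` into one for `|h|`
  have hre : MapsTo h (ball 0 R) {w | w.re ≤ M} := by
    intro w hw
    have h1 := hmax w hw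
    rw [hh w hw, norm_mul, norm_exp, mul_comm] at h1
    exact Real.exp_le_exp.mp (le_of_mul_le_mul_right h1 (norm_pos_iff.mpr hgz))
  have hsub : ball (0 : ℂ) (R / 2) ⊆ ball 0 R := ball_subset_ball (by linarith)
  have hhb : ∀ w ∈ ball (0 : ℂ) (R / 2), ‖h w‖ ≤ 2 * M := by
    intro w hw
    have hwR : ‖w‖ < R / 2 := by simpa using hw
    refine (borelCaratheodory_zero hM hhd hre hR (hsub hw) hh0).trans ?_
    rw [div_le_iff₀ (by linarith)]
    nlinarith
  have hneg : ∀ {r : ℝ}, ∀ w ∈ ball (0 : ℂ) r, -w ∈ ball (0 : ℂ) r := by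
    intro r w hw
    simpa using hw
  set H : ℂ → ℂ := fun w ↦ h w + h (-w) with hH
  have hHd : DifferentiableOn ℂ H (ball 0 (R / 2)) := by
    refine (hhd.mono hsub).add ((hhd.mono hsub).comp (by fun_prop) fun w hw ↦ hneg w hw)
  have hH0 : H 0 = 0 := by simp [hH, hh0]
  have hHb : MapsTo H (ball 0 (R / 2)) (closedBall (H 0) (4 * M)) := by
    intro w hw
    rw [hH0, mem_closedBall_zero_iff]
    refine (norm_add_le _ _).trans ?_
    linarith [hhb w hw, hhb (-w) (hneg w hw)]
  -- `H` vanishes to second order at `0`, so the Schwarz lemma gives a quadratic bound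
  have hHder : HasDerivAt H 0 0 := by
    have h1 : HasDerivAt h (deriv h 0) 0 :=
      (hhd.differentiableAt (isOpen_ball.mem_nhds (mem_ball_self hR))).hasDerivAt
    have h2 : HasDerivAt (fun w ↦ h (-w)) (-deriv h 0) 0 := by
      have h1' : HasDerivAt h (deriv h 0) (-0) := by simpa using h1
      have h3 := h1'.scomp (0 : ℂ) (hasDerivAt_neg (0 : ℂ))
      rw [neg_smul, one_smul] at h3
      exact h3
    have h4 := h1.add h2
    rw [add_neg_cancel] at h4
    exact h4
  have hHo : (H · - H 0) =o[𝓝 0] fun w ↦ ‖w - 0‖ ^ 1 := by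
    have := hasDerivAt_iff_isLittleO.mp hHder
    simp only [smul_zero, sub_zero] at this
    simpa using this.norm_right
  have hzb : z ∈ ball (0 : ℂ) (R / 2) := by simpa using hz
  refine ⟨H z, ?_, ?_⟩
  · have hprod : ∏ ρ ∈ S, (1 - -z / ρ) = ∏ ρ ∈ S, (1 - z / ρ) := by
      refine Finset.prod_nbij' (fun ρ ↦ -ρ) (fun ρ ↦ -ρ) ?_ ?_ (by simp) (by simp) ?_
      · intro ρ hρ
        rw [hS] at hρ ⊢
        simpa [heven] using hρ
      · intro ρ hρ
        rw [hS] at hρ ⊢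
        simpa [heven] using hρ
      · intro ρ hρ
        rw [neg_div, div_neg]
    have e1 := hP z
    have e2 := hP (-z)
    rw [heven, hprod, hh (-z) (hsub (hneg z hzb))] at e2
    rw [hh z (hsub hzb)] at e1
    have e3 : (f z * g 0) * (f z * g 0) = (f 0 * (∏ ρ ∈ S, (1 - z / ρ)) * (g 0 * exp (h z))) *
      (f 0 * (∏ ρ ∈ S, (1 - z / ρ)) * (g 0 * exp (h (-z)))) := by rw [← e1, ← e2]
    have e4 : g 0 ^ 2 ≠ 0 := pow_ne_zero 2 hgz
    apply mul_right_cancel₀ e4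
    rw [hH]
    simp only [exp_add]
    linear_combination e3
  · have := dist_le_mul_div_pow_of_mapsTo_ball_of_isLittleO hHd hHb hHo hzb
    rw [hH0, dist_zero_right, dist_zero_right] at this
    refine this.trans (le_of_eq ?_)
    rw [show ‖z‖ / (R / 2) = 2 * (‖z‖ / R) by field_simp]
    ring
end

/-! ### Counting zeros by Jensen's formula -/

section
open Complex Filter Topology MeasureTheory Set Metric

lemma circleAverage_mul_re_sq_add (R a b : ℝ) :
    Real.circleAverage (fun z : ℂ ↦ a * z.re ^ 2 + b) 0 R = a * R ^ 2 / 2 + b := by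
  rw [Real.circleAverage_def]
  have h1 : ∀ θ : ℝ, a * (circleMap 0 R θ).re ^ 2 + b = a * R ^ 2 * Real.cos θ ^ 2 + b := by
    intro θ
    rw [circleMap_zero_re]
    ring
  simp only [h1]
  rw [intervalIntegral.integral_add, intervalIntegral.integral_const_mul, integral_cos_sq]
  · simp
    field_simp
  · exact Continuous.intervalIntegrable (by fun_prop) _ _
  · simp

/-- Jensen's formula as a bound for the number of zeros in the disc of radius `R / e` of a function
that satisfies a direction-dependent bound on the circle of radius `R`. The sharp coefficient of
`R * L` is half the mean of `|cos θ|`, that is `1 / π`; `99 / 280` is a rational upper bound. -/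
theorem card_zeros_le_of_norm_le_exp_re {f : ℂ → ℂ} (hf : Differentiable ℂ f) (h0 : f 0 ≠ 0)
    {R L K : ℝ} (hR : 0 < R) (hL : 0 ≤ L) (hK : 0 ≤ K)
    (hbound : ∀ z, ‖z‖ = R → ‖f z‖ ≤ Real.exp (|z.re| / 2 * L + K))
    {S : Finset ℂ} (hS : ∀ ρ ∈ S, f ρ = 0 ∧ ‖ρ‖ * Real.exp 1 ≤ R) :
    (S.card : ℝ) ≤ 99 / 280 * R * L + K - Real.log ‖f 0‖ := by
  have hfa : AnalyticOnNhd ℂ f (closedBall 0 |R|) := fun z _ ↦ hf.analyticAt z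
  have hfa' : AnalyticOnNhd ℂ f univ := fun z _ ↦ hf.analyticAt z
  have hJ := hfa.circleAverage_log_norm hR.ne' h0
  set D := MeromorphicOn.divisor f (closedBall 0 |R|) with hD
  have hDfin := D.finiteSupport (isCompact_closedBall 0 |R|)
  have hDnn : ∀ u, 0 ≤ D u := fun u ↦ (MeromorphicOn.AnalyticOnNhd.divisor_nonneg hfa) u
  have hρle : ∀ ρ ∈ S, ‖ρ‖ ≤ R := by
    intro ρ hρ
    have := (hS ρ hρ).2
    have h2 : (1 : ℝ) ≤ Real.exp 1 := Real.one_le_exp zero_le_one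
    nlinarith [norm_nonneg ρ]
  have hDS : ∀ ρ ∈ S, 1 ≤ D ρ := by
    intro ρ hρ
    have hmem : ρ ∈ closedBall (0 : ℂ) |R| := by
      rw [mem_closedBall_zero_iff, abs_of_pos hR]; exact hρle ρ hρ
    have h1 : analyticOrderAt f ρ ≠ 0 := by
      rw [Ne, (hf.analyticAt ρ).analyticOrderAt_eq_zero, not_not]
      exact (hS ρ hρ).1
    have h2 : analyticOrderAt f ρ ≠ ⊤ := by
      intro h
      rw [analyticOrderAt_eq_top] at h
      have := hfa'.eqOn_zero_of_preconnected_of_eventuallyEq_zero isPreconnected_univ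
        (mem_univ ρ) h
      exact h0 (this (mem_univ 0))
    rw [hD, MeromorphicOn.AnalyticOnNhd.divisor_apply hfa hmem]
    obtain ⟨n, hn⟩ := ENat.ne_top_iff_exists.mp h2
    rw [← hn] at h1 ⊢
    have : n ≠ 0 := by simpa using h1
    have h3 : (1 : ℤ) ≤ n := by omega
    simpa using h3
  have hlow : (S.card : ℝ) ≤ ∑ᶠ u, (D u : ℝ) * Real.log (R * ‖0 - u‖⁻¹) := by
    rw [finsum_eq_sum_of_support_subset (s := hDfin.toFinset)]
    · have hsub : S ⊆ hDfin.toFinset := by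
        intro ρ hρ
        rw [Set.Finite.mem_toFinset, Function.mem_support]
        have := hDS ρ hρ
        omega
      calc (S.card : ℝ) = ∑ ρ ∈ S, (1 : ℝ) := by simp
        _ ≤ ∑ ρ ∈ S, (D ρ : ℝ) * Real.log (R * ‖0 - ρ‖⁻¹) := by
            refine Finset.sum_le_sum fun ρ hρ ↦ ?_
            have h1 : (1 : ℝ) ≤ D ρ := by exact_mod_cast hDS ρ hρ
            have hρ0 : 0 < ‖ρ‖ := norm_pos_iff.mpr fun e ↦ h0 (e ▸ (hS ρ hρ).1)
            have h2 : 1 ≤ Real.log (R * ‖0 - ρ‖⁻¹) := by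
              rw [Real.le_log_iff_exp_le (by simp; positivity), zero_sub, norm_neg,
                ← div_eq_mul_inv, le_div_iff₀ hρ0, mul_comm]
              exact (hS ρ hρ).2
            nlinarith
        _ ≤ _ := by
            refine Finset.sum_le_sum_of_subset_of_nonneg hsub fun u hu _ ↦ ?_
            have hu' : u ∈ closedBall (0 : ℂ) |R| := by
              apply D.supportWithinDomain
              simpa using hu
            rw [mem_closedBall_zero_iff, abs_of_pos hR] at hu'
            refine mul_nonneg (by exact_mod_cast hDnn u) ?_
            rcases eq_or_ne u 0 with rfl | hu0
            · simp
            · refine Real.log_nonneg ?_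
              rw [zero_sub, norm_neg, ← div_eq_mul_inv, le_div_iff₀ (norm_pos_iff.mpr hu0)]
              simpa using hu'
    · intro u hu
      simp only [Function.mem_support] at hu
      simp only [Set.Finite.coe_toFinset, Function.mem_support]
      intro h
      simp [h] at hu
  have hup : Real.circleAverage (Real.log ‖f ·‖) 0 R ≤ 99 / 280 * R * L + K := by
    -- `|x| ≤ 7 / 10 * x ^ 2 / R + 5 / 14 * R` replaces the mean of `|Re z|` by that of `(Re z) ^ 2`
    have h1 : Real.circleAverage
        (fun z : ℂ ↦ (7 / 20 * L / R) * z.re ^ 2 + (5 / 28 * R * L + K)) 0 R =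
          99 / 280 * R * L + K := by
      rw [circleAverage_mul_re_sq_add]
      field_simp
      ring
    rw [← h1]
    refine Real.circleAverage_mono ?_ ?_ ?_
    · exact MeromorphicOn.circleIntegrable_log_norm fun z hz ↦ (hf.analyticAt z).meromorphicAt
    · exact Continuous.continuousOn (by fun_prop) |>.circleIntegrable hR.le
    · intro z hz
      rw [mem_sphere_zero_iff_norm, abs_of_pos hR] at hz
      have h2 : |z.re| / 2 * L + K ≤ (7 / 20 * L / R) * z.re ^ 2 + (5 / 28 * R * L + K) := by
        have h3 : |z.re| / 2 ≤ 7 / 20 / R * z.re ^ 2 + 5 / 28 * R := by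
          rw [← sq_abs z.re, div_mul_eq_mul_div, div_add' _ _ _ hR.ne', le_div_iff₀ hR]
          nlinarith [sq_nonneg (|z.re| * 7 - 5 * R)]
        calc |z.re| / 2 * L + K ≤ (7 / 20 / R * z.re ^ 2 + 5 / 28 * R) * L + K := by gcongr
          _ = _ := by ring
      rcases eq_or_ne (f z) 0 with hz0 | hz0
      · rw [hz0, norm_zero, Real.log_zero]
        positivity
      · refine le_trans ?_ h2
        rw [Real.log_le_iff_le_exp (norm_pos_iff.mpr hz0)]
        exact hbound z hz
  linarith

/-- Every zero of `ξ` is a non-trivial zero of `ζ`. -/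
lemma mem_nontrivialZetaZeros_of_centredXi_eq_zero {z : ℂ} (hz : centredXi z = 0) :
    1 / 2 + z ∈ nontrivialZetaZeros := by
  have key : ∀ w : ℂ, centredXi w = 0 → 0 ≤ w.re → w.re < 1 / 2 ∧ riemannZeta (1 / 2 + w) = 0 := by
    intro w hw hre
    have hre' : (1 / 2 + w).re = 1 / 2 + w.re := by simp
    have h0 : 1 / 2 + w ≠ 0 := fun h ↦ by
      rw [h] at hre'; simp at hre'; linarith
    have h1 : 1 / 2 + w ≠ 1 := fun h ↦ by
      have : w = 1 / 2 := by linear_combination h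
      rw [this] at hw
      norm_num [centredXi] at hw
    have hG : Gammaℝ (1 / 2 + w) ≠ 0 := Gammaℝ_ne_zero_of_re_pos (by rw [hre']; linarith)
    have h2 := centredXi_eq_mul_riemannZeta h0 h1 hG
    rw [show 1 / 2 + w - 1 / 2 = w by ring, hw] at h2
    have h3 : riemannZeta (1 / 2 + w) = 0 := by
      have : (1 / 2 + w) * (1 / 2 + w - 1) * Gammaℝ (1 / 2 + w) ≠ 0 :=
        mul_ne_zero (mul_ne_zero h0 (sub_ne_zero.mpr h1)) hG
      exact (mul_eq_zero.mp h2.symm).resolve_left this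
    refine ⟨?_, h3⟩
    by_contra hcon
    exact riemannZeta_ne_zero_of_one_le_re (by rw [hre']; linarith) h3
  have hre : |z.re| < 1 / 2 := by
    rcases le_total 0 z.re with h | h
    · rw [abs_of_nonneg h]; exact (key z hz h).1
    · rw [abs_of_nonpos h]
      simpa using (key (-z) (by rw [centredXi_neg, hz]) (by simpa using h)).1
  have hre2 := abs_lt.mp hre
  have hre' : (1 / 2 + z).re = 1 / 2 + z.re := by simp
  refine ⟨?_, by rw [hre']; linarith, by rw [hre']; linarith⟩
  have h0 : 1 / 2 + z ≠ 0 := fun h ↦ by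
    rw [h] at hre'; simp at hre'; linarith
  have h1 : 1 / 2 + z ≠ 1 := fun h ↦ by
    rw [h] at hre'; simp at hre'; linarith
  have hG : Gammaℝ (1 / 2 + z) ≠ 0 := Gammaℝ_ne_zero_of_re_pos (by rw [hre']; linarith)
  have h2 := centredXi_eq_mul_riemannZeta h0 h1 hG
  rw [show 1 / 2 + z - 1 / 2 = z by ring, hz] at h2
  have : (1 / 2 + z) * (1 / 2 + z - 1) * Gammaℝ (1 / 2 + z) ≠ 0 :=
    mul_ne_zero (mul_ne_zero h0 (sub_ne_zero.mpr h1)) hG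
  exact (mul_eq_zero.mp h2.symm).resolve_left this

lemma abs_re_lt_of_centredXi_eq_zero {z : ℂ} (hz : centredXi z = 0) : |z.re| < 1 / 2 := by
  obtain ⟨-, h1, h2⟩ := mem_nontrivialZetaZeros_of_centredXi_eq_zero hz
  simp only [add_re, one_div, inv_re, re_ofNat, normSq_ofNat] at h1 h2
  rw [abs_lt]
  constructor <;> linarith

lemma deriv_centredXi_ne_zero (hsimple : ∀ ρ ∈ nontrivialZetaZeros, deriv riemannZeta ρ ≠ 0)
    {z : ℂ} (hz : centredXi z = 0) : deriv centredXi z ≠ 0 := by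
  intro hd
  have hmem := mem_nontrivialZetaZeros_of_centredXi_eq_zero hz
  apply hsimple _ hmem
  set ρ := 1 / 2 + z with hρ
  have hρ0 : ρ ≠ 0 := fun h ↦ by have := hmem.2.1; rw [h] at this; simp at this
  have hρ1 : ρ ≠ 1 := fun h ↦ by have := hmem.2.2; rw [h] at this; simp at this
  have hξ : HasDerivAt (fun s ↦ centredXi (s - 1 / 2)) 0 ρ := by
    have h1 : HasDerivAt centredXi 0 (ρ - 1 / 2) := by
      have := (differentiable_centredXi z).hasDerivAt
      rw [hd] at this
      rwa [show ρ - 1 / 2 = z by rw [hρ]; ring]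
    exact h1.comp_sub_const ρ (1 / 2)
  have hv : DifferentiableAt ℂ (fun s ↦ (s * (s - 1))⁻¹ * (Gammaℝ s)⁻¹) ρ := by
    refine DifferentiableAt.mul ?_ (differentiable_Gammaℝ_inv ρ)
    exact DifferentiableAt.inv (by fun_prop) (mul_ne_zero hρ0 (sub_ne_zero.mpr hρ1))
  have h2 := hξ.mul hv.hasDerivAt
  rw [show centredXi (ρ - 1 / 2) = 0 by rw [hρ]; simpa using hz] at h2
  simp only [zero_mul, add_zero] at h2
  have h3 : riemannZeta =ᶠ[𝓝 ρ]
      ((fun s ↦ centredXi (s - 1 / 2)) * fun s ↦ (s * (s - 1))⁻¹ * (Gammaℝ s)⁻¹) := by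
    have hop : IsOpen {s : ℂ | 0 < s.re} := isOpen_lt continuous_const continuous_re
    filter_upwards [hop.mem_nhds hmem.2.1, eventually_ne_nhds hρ1] with s hs hs1
    have hs0 : s ≠ 0 := fun h ↦ by rw [h] at hs; simp at hs
    have hG : Gammaℝ s ≠ 0 := Gammaℝ_ne_zero_of_re_pos hs
    rw [Pi.mul_apply, centredXi_eq_mul_riemannZeta hs0 hs1 hG]
    have : s - 1 ≠ 0 := sub_ne_zero.mpr hs1
    field_simp
  exact (h2.congr_of_eventuallyEq h3).deriv

/-- An even function cannot have a simple zero at the origin, so the simplicity of the zeros gives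
`ζ (1 / 2) ≠ 0`. -/
lemma centredXi_zero_ne_zero (hsimple : ∀ ρ ∈ nontrivialZetaZeros, deriv riemannZeta ρ ≠ 0) :
    centredXi 0 ≠ 0 := by
  intro h
  apply deriv_centredXi_ne_zero hsimple h
  have h1 : deriv (fun z ↦ centredXi (-z)) 0 = -deriv centredXi (-0) := deriv_comp_neg _ _
  simp only [centredXi_neg, neg_zero] at h1
  exact self_eq_neg.mp h1

lemma finite_centredXi_zeros (R : ℝ) : {ρ : ℂ | centredXi ρ = 0 ∧ ‖ρ‖ < R}.Finite := by
  refine ((finite_nontrivialZetaZeros_im_lt R).image fun s ↦ s - 1 / 2).subset ?_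
  rintro ρ ⟨h1, h2⟩
  refine ⟨1 / 2 + ρ, ⟨mem_nontrivialZetaZeros_of_centredXi_eq_zero h1, ?_⟩, by ring⟩
  simpa using (abs_im_le_norm ρ).trans_lt h2

/-- The finite set of zeros of `centredXi` in the open disc of radius `R` about the origin. -/
noncomputable def centredXiZeros (R : ℝ) : Finset ℂ := (finite_centredXi_zeros R).toFinset

lemma mem_centredXiZeros {R : ℝ} {ρ : ℂ} :
    ρ ∈ centredXiZeros R ↔ centredXi ρ = 0 ∧ ‖ρ‖ < R := by
  simp [centredXiZeros]

/-- The number of zeros of `ξ` in the disc of radius `r` about `1 / 2` is at most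
`0.9612 * r * log r + O(r)`, the constant being an upper bound for `99 / 280 * e`. The true
constant is `1 / π`, but what matters is only that `0.9612 * (11 / 20) * π * (1.05 / 1.9) < 1`:
this is the exponent of the height in the final lower bound for `ζ`. -/
theorem exists_card_centredXiZeros_le
    (hsimple : ∀ ρ ∈ nontrivialZetaZeros, deriv riemannZeta ρ ≠ 0) :
    ∃ C : ℝ, 0 < C ∧ ∀ r : ℝ, 1 ≤ r →
      ((centredXiZeros r).card : ℝ) ≤ 0.9612 * r * Real.log r + C * r := by
  obtain ⟨C, hC, hb⟩ := exists_norm_centredXi_le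
  set e := Real.exp 1 with he
  have he1 : e < 2.7182818286 := Real.exp_one_lt_d9
  have he0 : 1 < e := by have := Real.exp_one_gt_d9; linarith
  refine ⟨0.9612 * Real.log (e + 2) + C * (e + 1) + |Real.log ‖centredXi 0‖|, ?_, fun r hr ↦ ?_⟩
  · have : 0 < Real.log (e + 2) := Real.log_pos (by linarith)
    positivity
  · have hr0 : 0 < r := by linarith
    have h := card_zeros_le_of_norm_le_exp_re differentiable_centredXi
      (centredXi_zero_ne_zero hsimple) (R := e * r) (L := Real.log (e * r + 2))
      (K := C * (e * r + 1)) (S := centredXiZeros r) (by positivity)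
      (Real.log_nonneg (by nlinarith)) (by positivity)
      (fun z hz ↦ by simpa [hz] using hb z)
      (fun ρ hρ ↦ by
        rw [mem_centredXiZeros] at hρ
        refine ⟨hρ.1, ?_⟩
        rw [mul_comm]
        gcongr
        exact hρ.2.le)
    have hlog : Real.log (e * r + 2) ≤ Real.log r + Real.log (e + 2) := by
      rw [← Real.log_mul hr0.ne' (by positivity)]
      exact Real.log_le_log (by positivity) (by nlinarith)
    have hlr : 0 ≤ Real.log r := Real.log_nonneg hr
    have hle : 0 ≤ Real.log (e + 2) := Real.log_nonneg (by linarith)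
    have h1 : 99 / 280 * (e * r) * Real.log (e * r + 2) ≤
        0.9612 * r * (Real.log r + Real.log (e + 2)) := by
      have : 99 / 280 * (e * r) ≤ 0.9612 * r := by nlinarith
      have h0 : 0 ≤ Real.log (e * r + 2) := Real.log_nonneg (by nlinarith)
      gcongr
    have h2 : C * (e * r + 1) ≤ C * (e + 1) * r := by nlinarith
    have h3 : -Real.log ‖centredXi 0‖ ≤ |Real.log ‖centredXi 0‖| * r := by
      have := neg_abs_le (Real.log ‖centredXi 0‖)
      have := abs_nonneg (Real.log ‖centredXi 0‖)
      nlinarith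
    linarith
end

/-! ### The logarithmic distance of a point from the zeros -/

section
open Complex Filter Topology MeasureTheory Set Metric

/-- The sum of `1 / |ρ| ^ 2` over the zeros of `ξ` converges. -/
lemma exists_sum_centredXiZeros_inv_sq_le
    (hsimple : ∀ ρ ∈ nontrivialZetaZeros, deriv riemannZeta ρ ≠ 0) :
    ∃ A : ℝ, 0 < A ∧ ∀ R : ℝ, ∑ ρ ∈ centredXiZeros R, (‖ρ‖ ^ 2)⁻¹ ≤ A := by
  obtain ⟨C, hC, hn⟩ := exists_card_centredXiZeros_le hsimple
  set B := 2 + C with hB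
  have hB0 : 0 < B := by positivity
  have hn' : ∀ J : ℕ, ((centredXiZeros (4 ^ J)).card : ℝ) ≤ B * 8 ^ J := by
    intro J
    have h1 : (1 : ℝ) ≤ 2 ^ J := one_le_pow₀ (by norm_num)
    have h2 := hn (4 ^ J) (one_le_pow₀ (by norm_num))
    have h3 : Real.log (4 ^ J) ≤ 2 * 2 ^ J := by
      rw [show (4 : ℝ) ^ J = (2 ^ J) ^ 2 by rw [← pow_mul, mul_comm, pow_mul]; norm_num,
        Real.log_pow]
      have := Real.log_le_sub_one_of_pos (show (0 : ℝ) < 2 ^ J by positivity)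
      push_cast
      linarith
    have h4 : (8 : ℝ) ^ J = 4 ^ J * 2 ^ J := by rw [← mul_pow]; norm_num
    have h5 : (0 : ℝ) < 4 ^ J := by positivity
    rw [h4, hB]
    calc ((centredXiZeros (4 ^ J)).card : ℝ) ≤ 0.9612 * 4 ^ J * Real.log (4 ^ J) + C * 4 ^ J := h2
      _ ≤ 0.9612 * 4 ^ J * (2 * 2 ^ J) + C * 4 ^ J * 2 ^ J := by
          have : C * 4 ^ J * 1 ≤ C * 4 ^ J * 2 ^ J := by gcongr
          have : 0.9612 * 4 ^ J * Real.log (4 ^ J) ≤ 0.9612 * 4 ^ J * (2 * 2 ^ J) := by gcongr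
          linarith
      _ ≤ _ := by nlinarith [mul_pos h5 (show (0 : ℝ) < 2 ^ J by positivity)]
  set A₀ := ∑ ρ ∈ centredXiZeros 1, (‖ρ‖ ^ 2)⁻¹ with hA₀
  have hA₀0 : 0 ≤ A₀ := Finset.sum_nonneg fun ρ _ ↦ by positivity
  have hsub : ∀ {r R : ℝ}, r ≤ R → centredXiZeros r ⊆ centredXiZeros R := by
    intro r R hrR ρ hρ
    rw [mem_centredXiZeros] at hρ ⊢
    exact ⟨hρ.1, hρ.2.trans_le hrR⟩
  have hJ : ∀ J : ℕ, ∑ ρ ∈ centredXiZeros (4 ^ J), (‖ρ‖ ^ 2)⁻¹ ≤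
      A₀ + 16 * B - 16 * B * (1 / 2) ^ J := by
    intro J
    induction J with
    | zero => simp [hA₀]
    | succ J ih =>
      have hs : centredXiZeros (4 ^ J) ⊆ centredXiZeros (4 ^ (J + 1)) :=
        hsub (pow_le_pow_right₀ (by norm_num) (Nat.le_succ J))
      rw [← Finset.sum_sdiff hs]
      have h1 : ∑ ρ ∈ centredXiZeros (4 ^ (J + 1)) \ centredXiZeros (4 ^ J), (‖ρ‖ ^ 2)⁻¹ ≤
          8 * B * (1 / 2) ^ J := by
        have h2 : ∀ ρ ∈ centredXiZeros (4 ^ (J + 1)) \ centredXiZeros (4 ^ J),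
            (‖ρ‖ ^ 2)⁻¹ ≤ ((16 : ℝ) ^ J)⁻¹ := by
          intro ρ hρ
          rw [Finset.mem_sdiff, mem_centredXiZeros, mem_centredXiZeros] at hρ
          have h3 : (4 : ℝ) ^ J ≤ ‖ρ‖ := by
            by_contra hcon
            exact hρ.2 ⟨hρ.1.1, not_le.mp hcon⟩
          have h4 : (16 : ℝ) ^ J = (4 ^ J) ^ 2 := by rw [← pow_mul, mul_comm, pow_mul]; norm_num
          rw [h4]
          gcongr
        refine (Finset.sum_le_card_nsmul _ _ _ h2).trans ?_
        rw [nsmul_eq_mul]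
        have h5 : (((centredXiZeros (4 ^ (J + 1))) \ (centredXiZeros (4 ^ J))).card : ℝ) ≤
            B * 8 ^ (J + 1) :=
          le_trans (by exact_mod_cast Finset.card_le_card Finset.sdiff_subset) (hn' (J + 1))
        calc _ ≤ B * 8 ^ (J + 1) * ((16 : ℝ) ^ J)⁻¹ := by gcongr
          _ = 8 * B * (1 / 2) ^ J := by
            rw [pow_succ, show (16 : ℝ) ^ J = 8 ^ J * 2 ^ J by rw [← mul_pow]; norm_num, one_div,
              inv_pow]
            field_simp
      have h6 : (1 / 2 : ℝ) ^ (J + 1) = (1 / 2) ^ J / 2 := by rw [pow_succ]; ring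
      rw [h6]
      linarith
  refine ⟨A₀ + 16 * B, by positivity, fun R ↦ ?_⟩
  obtain ⟨J, hJR⟩ := pow_unbounded_of_one_lt R (show (1 : ℝ) < 4 by norm_num)
  refine (Finset.sum_le_sum_of_subset_of_nonneg (hsub hJR.le) fun ρ _ _ ↦ by positivity).trans ?_
  have := hJ J
  have h2 : 0 ≤ 16 * B * (1 / 2) ^ J := by positivity
  linarith

lemma half_log_one_add_sq_le (y : ℝ) (hy : 0 ≤ y) :
    Real.log (1 + y ^ 2) / 2 ≤ y * Real.arctan y := by
  have hd : ∀ x : ℝ, HasDerivAt (fun y ↦ y * Real.arctan y - Real.log (1 + y ^ 2) / 2)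
      (Real.arctan x) x := by
    intro x
    have hx : 1 + x ^ 2 ≠ 0 := by positivity
    have h1 := (hasDerivAt_id x).mul (Real.hasDerivAt_arctan x)
    have h2 := ((((hasDerivAt_id x).pow 2).const_add 1).log hx).div_const 2
    have h3 := h1.sub h2
    refine h3.congr_deriv ?_
    simp
    field_simp
    ring
  have hmono : MonotoneOn (fun y ↦ y * Real.arctan y - Real.log (1 + y ^ 2) / 2) (Ici 0) := by
    refine monotoneOn_of_deriv_nonneg (convex_Ici 0) ?_ ?_ ?_
    · exact fun x _ ↦ (hd x).continuousAt.continuousWithinAt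
    · exact fun x _ ↦ (hd x).differentiableAt.differentiableWithinAt
    · intro x hx
      rw [(hd x).deriv]
      rw [interior_Ici] at hx
      exact Real.arctan_nonneg.mpr (le_of_lt hx)
  have := hmono (mem_Ici.mpr le_rfl) (mem_Ici.mpr hy) hy
  simp at this
  linarith

/-- The logarithm of the ratio `|a + i t| / |t|`: how much further a point is from a zero at
horizontal distance `a` and vertical distance `t` than the nearest point at the same height is. -/
noncomputable def logDistRatio (a t : ℝ) : ℝ := Real.log (a ^ 2 + t ^ 2) / 2 - Real.log t

lemma logDistRatio_nonneg (a t : ℝ) (ht : t ≠ 0) : 0 ≤ logDistRatio a t := by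
  unfold logDistRatio
  have h : Real.log (t ^ 2) ≤ Real.log (a ^ 2 + t ^ 2) :=
    Real.log_le_log (by positivity) (by nlinarith [sq_nonneg a])
  rw [Real.log_pow] at h
  push_cast at h
  linarith

lemma logDistRatio_le (a t : ℝ) (ht : t ≠ 0) : logDistRatio a t ≤ a ^ 2 / (2 * t ^ 2) := by
  unfold logDistRatio
  have h : Real.log t = Real.log (t ^ 2) / 2 := by rw [Real.log_pow]; push_cast; ring
  have h2 : 0 < t ^ 2 := by positivity
  rw [h, ← sub_div, ← Real.log_div (by positivity) (by positivity)]
  have h3 := Real.log_le_sub_one_of_pos (show 0 < (a ^ 2 + t ^ 2) / t ^ 2 by positivity)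
  have h4 : (a ^ 2 + t ^ 2) / t ^ 2 - 1 = a ^ 2 / t ^ 2 := by field_simp; ring
  have h5 : a ^ 2 / (2 * t ^ 2) = a ^ 2 / t ^ 2 / 2 := by field_simp
  rw [h5]
  linarith

lemma intervalIntegrable_logDistRatio {a : ℝ} (ha : 0 < a) (u v : ℝ) :
    IntervalIntegrable (logDistRatio a) volume u v := by
  unfold logDistRatio
  refine IntervalIntegrable.sub ?_ intervalIntegral.intervalIntegrable_log'
  refine Continuous.intervalIntegrable ?_ _ _
  refine Continuous.div_const (Continuous.log (by fun_prop) fun x ↦ ?_) 2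
  positivity

/-- The total mass of `logDistRatio a` over the real line is `π * a`. -/
lemma integral_logDistRatio_le {a : ℝ} (ha : 0 < a) {u v : ℝ} (huv : u ≤ v) :
    ∫ t in u..v, logDistRatio a t ≤ Real.pi * a := by
  set G : ℝ → ℝ := fun t ↦ t * (Real.log (a ^ 2 + t ^ 2) / 2) - t * Real.log t +
    a * Real.arctan (t / a) with hG
  have hGc : Continuous G := by
    refine ((continuous_id.mul ?_).sub Real.continuous_mul_log).add (by fun_prop)
    refine Continuous.div_const (Continuous.log (by fun_prop) fun x ↦ ?_) 2
    positivity
  have hGd : ∀ t : ℝ, t ≠ 0 → HasDerivAt G (logDistRatio a t) t := by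
    intro t ht
    have hat : a ^ 2 + t ^ 2 ≠ 0 := by positivity
    have h1 := (hasDerivAt_id t).mul
      (((((hasDerivAt_id t).pow 2).const_add (a ^ 2)).log hat).div_const 2)
    have h2 := Real.hasDerivAt_mul_log ht
    have h3 := (((hasDerivAt_id t).div_const a).arctan).const_mul a
    refine ((h1.sub h2).add h3).congr_deriv ?_
    have hat' : 1 + (t / a) ^ 2 ≠ 0 := by positivity
    simp only [logDistRatio, Pi.pow_apply, id]
    field_simp
    ring
  have hFTC : ∫ t in u..v, logDistRatio a t = G v - G u := by
    refine integral_eq_of_hasDerivAt_off_countable_of_le G _ huv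
      (countable_singleton 0) hGc.continuousOn (fun t ht ↦ hGd t (by simpa using ht.2))
      (intervalIntegrable_logDistRatio ha u v)
  have hpos : ∀ t, 0 ≤ t → G t ≤ a * (Real.pi / 2) ∧ 0 ≤ G t := by
    intro t ht
    rcases ht.eq_or_lt with rfl | ht
    · simp [hG]; positivity
    · have h1 := half_log_one_add_sq_le (a / t) (by positivity)
      have h2 : Real.arctan (t / a) = Real.pi / 2 - Real.arctan (a / t) := by
        rw [← inv_div, Real.arctan_inv_of_pos (by positivity)]
      have h3 : Real.log (1 + (a / t) ^ 2) = 2 * logDistRatio a t := by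
        rw [show 1 + (a / t) ^ 2 = (a ^ 2 + t ^ 2) / t ^ 2 by field_simp; ring,
          Real.log_div (by positivity) (by positivity), Real.log_pow, logDistRatio]
        push_cast
        ring
      have h4 : G t = t * logDistRatio a t + a * Real.arctan (t / a) := by
        simp only [hG, logDistRatio]; ring
      rw [h3] at h1
      have h5 : t * logDistRatio a t ≤ a * Real.arctan (a / t) := by
        have : t * (2 * logDistRatio a t / 2) ≤ t * (a / t * Real.arctan (a / t)) := by gcongr
        calc _ = t * (2 * logDistRatio a t / 2) := by ring
          _ ≤ _ := this
          _ = _ := by field_simp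
      constructor
      · rw [h4, h2]; linarith
      · rw [h4]
        have := logDistRatio_nonneg a t ht.ne'
        have : 0 ≤ Real.arctan (t / a) := Real.arctan_nonneg.mpr (by positivity)
        positivity
  have hodd : ∀ t, G (-t) = -G t := by
    intro t
    simp only [hG, neg_sq, Real.log_neg_eq_log, neg_div, Real.arctan_neg]
    ring
  have hup : ∀ t, |G t| ≤ a * (Real.pi / 2) := by
    intro t
    rcases le_total 0 t with ht | ht
    · rw [abs_of_nonneg (hpos t ht).2]; exact (hpos t ht).1
    · have := hpos (-t) (by linarith)
      rw [← abs_neg, ← hodd, abs_of_nonneg this.2]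
      exact this.1
  rw [hFTC]
  have h1 := abs_le.mp (hup u)
  have h2 := abs_le.mp (hup v)
  linarith
end

/-! ### Heights far from the zeros on average -/

section
open Complex Filter Topology MeasureTheory Set Metric

lemma intervalIntegrable_logDistRatio_sub {a : ℝ} (ha : 0 < a) (c u v : ℝ) :
    IntervalIntegrable (fun t ↦ logDistRatio a (t - c)) volume u v := by
  simpa using (intervalIntegrable_logDistRatio ha (u - c) (v - c)).comp_sub_right c

lemma sum_re_centredXiZeros (R : ℝ) : ∑ ρ ∈ centredXiZeros R, ρ.re = 0 := by
  have h : ∑ ρ ∈ centredXiZeros R, ρ.re = ∑ ρ ∈ centredXiZeros R, -ρ.re := by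
    refine Finset.sum_nbij' (fun ρ ↦ -ρ) (fun ρ ↦ -ρ) ?_ ?_ (by simp) (by simp) (by simp)
    · intro ρ hρ
      rw [mem_centredXiZeros] at hρ ⊢
      simpa [centredXi_neg] using hρ
    · intro ρ hρ
      rw [mem_centredXiZeros] at hρ ⊢
      simpa [centredXi_neg] using hρ
  rw [Finset.sum_neg_distrib] at h
  linarith

/-- The mean over `|t| ≤ X` of the contribution of the zeros at distance less than `1.05 * X`.
By the symmetry `ρ ↦ -ρ` the average horizontal distance from a zero to the line
`Re z = 11 / 20` is `11 / 20`. -/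
lemma exists_integral_sum_logDistRatio_le
    (hsimple : ∀ ρ ∈ nontrivialZetaZeros, deriv riemannZeta ρ ≠ 0) :
    ∃ C : ℝ, 0 < C ∧ ∀ X : ℝ, 1 ≤ X →
      ∫ t in (-X)..X, ∑ ρ ∈ centredXiZeros (1.05 * X), logDistRatio (11 / 20 - ρ.re) (t - ρ.im) ≤
        1.745 * X * Real.log X + C * X := by
  obtain ⟨C, hC, hn⟩ := exists_card_centredXiZeros_le hsimple
  refine ⟨1.745 * Real.log 1.05 + 2 * C, ?_, fun X hX ↦ ?_⟩
  · have : 0 < Real.log 1.05 := Real.log_pos (by norm_num)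
    positivity
  have ha : ∀ ρ ∈ centredXiZeros (1.05 * X), 0 < 11 / 20 - ρ.re := by
    intro ρ hρ
    have := abs_lt.mp (abs_re_lt_of_centredXi_eq_zero (mem_centredXiZeros.mp hρ).1)
    linarith
  rw [intervalIntegral.integral_finsetSum]
  · have h1 : ∀ ρ ∈ centredXiZeros (1.05 * X),
        ∫ t in (-X)..X, logDistRatio (11 / 20 - ρ.re) (t - ρ.im) ≤
          Real.pi * (11 / 20 - ρ.re) := by
      intro ρ hρ
      rw [intervalIntegral.integral_comp_sub_right (fun t ↦ logDistRatio (11 / 20 - ρ.re) t)]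
      exact integral_logDistRatio_le (ha ρ hρ) (by linarith)
    refine (Finset.sum_le_sum h1).trans ?_
    rw [← Finset.mul_sum, Finset.sum_sub_distrib, sum_re_centredXiZeros, Finset.sum_const,
      nsmul_eq_mul, sub_zero]
    have h2 := hn (1.05 * X) (by linarith)
    rw [Real.log_mul (by norm_num) (by positivity)] at h2
    have hl : 0 ≤ Real.log X := Real.log_nonneg hX
    have hl' : 0 ≤ Real.log 1.05 := Real.log_nonneg (by norm_num)
    have hpi := Real.pi_lt_d4
    have hpi0 := Real.pi_pos
    calc Real.pi * ((centredXiZeros (1.05 * X)).card * (11 / 20))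
        ≤ Real.pi * ((0.9612 * (1.05 * X) * (Real.log 1.05 + Real.log X) + C * (1.05 * X)) *
          (11 / 20)) := by gcongr
      _ = (Real.pi * (0.9612 * 1.05 * (11 / 20))) * (X * (Real.log 1.05 + Real.log X)) +
          (Real.pi * (1.05 * (11 / 20))) * (C * X) := by ring
      _ ≤ 1.745 * (X * (Real.log 1.05 + Real.log X)) + 2 * (C * X) := by
          gcongr <;> linarith
      _ = _ := by ring
  · intro ρ hρ
    exact intervalIntegrable_logDistRatio_sub (ha ρ hρ) ρ.im _ _

/-- Some height `T` with `X / 20 ≤ |T| ≤ X` is, in the logarithmic mean sense, far from all zeros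
of `ξ`. -/
theorem exists_height_sum_logDistRatio_le
    (hsimple : ∀ ρ ∈ nontrivialZetaZeros, deriv riemannZeta ρ ≠ 0) :
    ∃ C X₀ : ℝ, 0 < C ∧ 1 ≤ X₀ ∧ ∀ X R : ℝ, X₀ ≤ X → 1.05 * X ≤ R → ∃ T : ℝ,
      X / 20 ≤ |T| ∧ |T| ≤ X ∧ (∀ ρ ∈ centredXiZeros R, T - ρ.im ≠ 0) ∧
      ∑ ρ ∈ centredXiZeros R, logDistRatio (11 / 20 - ρ.re) (T - ρ.im) ≤
        0.92 * Real.log X + C := by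
  obtain ⟨C, hC, hmean⟩ := exists_integral_sum_logDistRatio_le hsimple
  obtain ⟨A, hA, hsum⟩ := exists_sum_centredXiZeros_inv_sq_le hsimple
  refine ⟨C + 2500 * A, 100, by positivity, by norm_num, fun X R hX hXR ↦ ?_⟩
  have hX0 : 0 < X := by linarith
  set N := centredXiZeros (1.05 * X) with hN
  set F : ℝ → ℝ := fun t ↦ ∑ ρ ∈ N, logDistRatio (11 / 20 - ρ.re) (t - ρ.im) with hF
  have hNR : N ⊆ centredXiZeros R := by
    intro ρ hρ
    rw [hN, mem_centredXiZeros] at hρ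
    rw [mem_centredXiZeros]
    exact ⟨hρ.1, hρ.2.trans_le hXR⟩
  have ha : ∀ ρ ∈ centredXiZeros R, 0 < 11 / 20 - ρ.re ∧ 11 / 20 - ρ.re ≤ 1.05 := by
    intro ρ hρ
    have := abs_lt.mp (abs_re_lt_of_centredXi_eq_zero (mem_centredXiZeros.mp hρ).1)
    constructor <;> linarith
  have hFint : IntegrableOn F (Icc (-X) X) := by
    rw [← intervalIntegrable_iff_integrableOn_Icc_of_le (by linarith)]
    have := IntervalIntegrable.sum (μ := volume) (a := -X) (b := X) N
      (f := fun ρ t ↦ logDistRatio (11 / 20 - ρ.re) (t - ρ.im))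
      fun ρ hρ ↦ intervalIntegrable_logDistRatio_sub (ha ρ (hNR hρ)).1 ρ.im _ _
    have e : F = ∑ ρ ∈ N, fun t ↦ logDistRatio (11 / 20 - ρ.re) (t - ρ.im) := by
      ext t
      simp [hF]
    rwa [e]
  -- averaging over `E` only, so that the height found is large, costs the factor `2 / 1.9`
  set E : Set ℝ := Icc (-X) X \ Ioo (-(X / 20)) (X / 20) with hE
  have hEsub : E ⊆ Icc (-X) X := sdiff_subset
  have hIoosub : Ioo (-(X / 20)) (X / 20) ⊆ Icc (-X) X := by
    intro t ht
    exact ⟨by linarith [ht.1], by linarith [ht.2]⟩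
  have hvol : volume.real E = 1.9 * X := by
    rw [hE, measureReal_sdiff hIoosub measurableSet_Ioo (by simp),
      Real.volume_real_Icc_of_le (by linarith), Real.volume_real_Ioo_of_le (by linarith)]
    ring
  have hEmeas : MeasurableSet E := measurableSet_Icc.diff measurableSet_Ioo
  have hEtop : volume E ≠ ⊤ := measure_ne_top_of_subset hEsub (by simp)
  have hE0 : volume E ≠ 0 := by
    intro h
    rw [Measure.real, h] at hvol
    rw [ENNReal.toReal_zero] at hvol
    linarith
  have : IsFiniteMeasure (volume.restrict E) := ⟨by simpa using hEtop.lt_top⟩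
  set bad : Set ℝ := (fun ρ : ℂ ↦ ρ.im) '' (centredXiZeros R : Set ℂ) with hbad
  have hbad0 : volume (bad ∩ E) = 0 :=
    measure_mono_null inter_subset_left (((centredXiZeros R).finite_toSet.image _).measure_zero _)
  obtain ⟨T, hTE, hT⟩ : ∃ T ∈ E \ bad, F T ≤ ⨍ t in E, F t := by
    have h := exists_notMem_null_le_average (μ := volume.restrict E) (N := bad ∪ Eᶜ)
      (by simpa using hE0) (hFint.mono_set hEsub) (by
        refine measure_union_null ?_ ?_
        · rw [Measure.restrict_apply' hEmeas]; exact hbad0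
        · rw [Measure.restrict_apply' hEmeas]; simp)
    obtain ⟨T, hT1, hT2⟩ := h
    refine ⟨T, ?_, hT2⟩
    simp only [mem_union, mem_compl_iff, not_or, not_not] at hT1
    exact ⟨hT1.2, hT1.1⟩
  have hTbad : ∀ ρ ∈ centredXiZeros R, T - ρ.im ≠ 0 := by
    intro ρ hρ h
    exact hTE.2 ⟨ρ, hρ, (sub_eq_zero.mp h).symm⟩
  have hT1 : |T| ≤ X := abs_le.mpr hTE.1.1
  have hT2 : X / 20 ≤ |T| := by
    by_contra hcon
    exact hTE.1.2 (abs_lt.mp (not_le.mp hcon))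
  refine ⟨T, hT2, hT1, hTbad, ?_⟩
  have hnear : F T ≤ 0.92 * Real.log X + C := by
    have hl : 0 ≤ Real.log X := Real.log_nonneg (by linarith)
    have h1 : ∫ t in E, F t ≤ 1.745 * X * Real.log X + C * X := by
      refine le_trans ?_ (hmean X (by linarith))
      rw [intervalIntegral.integral_of_le (by linarith), ← integral_Icc_eq_integral_Ioc]
      refine setIntegral_mono_set hFint ?_ (LE.le.eventuallyLE hEsub)
      refine (ae_restrict_iff' measurableSet_Icc).mpr ?_
      have hnull : volume ((fun ρ : ℂ ↦ ρ.im) '' (N : Set ℂ)) = 0 :=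
        (N.finite_toSet.image _).measure_zero _
      filter_upwards [compl_mem_ae_iff.mpr hnull] with t ht _
      refine Finset.sum_nonneg fun ρ hρ ↦ logDistRatio_nonneg _ _ fun h ↦ ht ?_
      exact ⟨ρ, hρ, (sub_eq_zero.mp h).symm⟩
    rw [setAverage_eq, hvol, smul_eq_mul] at hT
    have h2 : (1.9 * X)⁻¹ * ∫ t in E, F t ≤ (1.9 * X)⁻¹ * (1.745 * X * Real.log X + C * X) := by
      gcongr
    have h3 : (1.9 * X)⁻¹ * (1.745 * X * Real.log X + C * X) =
        1.745 / 1.9 * Real.log X + C / 1.9 := by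
      field_simp
    have h4 : C / 1.9 ≤ C := div_le_self hC.le (by norm_num)
    nlinarith
  -- each zero at distance more than `1.05 X` contributes `O(1 / |ρ| ^ 2)`
  have hfar : ∑ ρ ∈ centredXiZeros R \ N, logDistRatio (11 / 20 - ρ.re) (T - ρ.im) ≤ 2500 * A := by
    refine le_trans ?_ (mul_le_mul_of_nonneg_left (hsum R) (by norm_num))
    rw [Finset.mul_sum]
    refine le_trans (Finset.sum_le_sum (g := fun ρ ↦ 2500 * (‖ρ‖ ^ 2)⁻¹) fun ρ hρ ↦ ?_)
      (Finset.sum_le_sum_of_subset_of_nonneg Finset.sdiff_subset fun ρ _ _ ↦ by positivity)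
    rw [Finset.mem_sdiff] at hρ
    have hρ1 : 1.05 * X ≤ ‖ρ‖ := by
      by_contra hcon
      exact hρ.2 (mem_centredXiZeros.mpr ⟨(mem_centredXiZeros.mp hρ.1).1, not_le.mp hcon⟩)
    have hre := abs_re_lt_of_centredXi_eq_zero (mem_centredXiZeros.mp hρ.1).1
    have him : ‖ρ‖ ≤ |ρ.re| + |ρ.im| := norm_le_abs_re_add_abs_im ρ
    have hd : ‖ρ‖ / 50 ≤ |T - ρ.im| := by
      have := abs_sub_abs_le_abs_sub ρ.im T
      rw [abs_sub_comm] at this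
      linarith
    have hpos : 0 < ‖ρ‖ := by linarith
    refine (logDistRatio_le _ _ (hTbad ρ hρ.1)).trans ?_
    have ha' := ha ρ hρ.1
    rw [← sq_abs (T - ρ.im)]
    calc (11 / 20 - ρ.re) ^ 2 / (2 * |T - ρ.im| ^ 2)
        ≤ 1.05 ^ 2 / (2 * (‖ρ‖ / 50) ^ 2) := by
          gcongr
          · exact ha'.1.le
          · exact ha'.2
      _ ≤ 2500 * (‖ρ‖ ^ 2)⁻¹ := by
          rw [div_le_iff₀ (by positivity)]
          field_simp
          norm_num
  rw [← Finset.sum_sdiff hNR]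
  have : F T = ∑ ρ ∈ N, logDistRatio (11 / 20 - ρ.re) (T - ρ.im) := rfl
  linarith
end

/-! ### Lower bounds for `ξ` on horizontal lines -/

section
open Complex Filter Topology MeasureTheory Set Metric

lemma log_norm_sub_le_logDistRatio {x T : ℝ} {ρ : ℂ} (hT : T - ρ.im ≠ 0) (y : ℝ) :
    Real.log ‖(y + T * I : ℂ) - ρ‖ - Real.log ‖(x + T * I : ℂ) - ρ‖ ≤
      logDistRatio (y - ρ.re) (T - ρ.im) := by
  have h1 : Real.log ‖(y + T * I : ℂ) - ρ‖ = Real.log ((y - ρ.re) ^ 2 + (T - ρ.im) ^ 2) / 2 := by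
    rw [Complex.norm_eq_sqrt_sq_add_sq, Real.log_sqrt (by positivity)]
    simp
  have h2 : Real.log (T - ρ.im) ≤ Real.log ‖(x + T * I : ℂ) - ρ‖ := by
    rw [← Real.log_abs]
    refine Real.log_le_log (abs_pos.mpr hT) ?_
    have := abs_im_le_norm ((x + T * I : ℂ) - ρ)
    simpa using this
  rw [h1, logDistRatio]
  linarith

/-- On suitable horizontal lines `ξ` is not much smaller than at the point `s = 1 / 2 + z` of that
line with real part `21 / 20`, that is `Re z = 11 / 20`. -/
theorem exists_height_norm_centredXi_le
    (hsimple : ∀ ρ ∈ nontrivialZetaZeros, deriv riemannZeta ρ ≠ 0) :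
    ∃ C X₀ : ℝ, 0 < C ∧ 1 ≤ X₀ ∧ ∀ X : ℝ, X₀ ≤ X → ∃ T : ℝ, X / 20 ≤ |T| ∧ |T| ≤ X ∧
      ∀ x : ℝ, |x| ≤ 1 → centredXi (x + T * I) ≠ 0 ∧
        ‖centredXi ((11 / 20 : ℝ) + T * I)‖ ≤ C * X * ‖centredXi (x + T * I)‖ := by
  obtain ⟨C₁, X₀, hC₁, hX₀, hheight⟩ := exists_height_sum_logDistRatio_le hsimple
  obtain ⟨C₂, hC₂, hgrowth⟩ := exists_norm_centredXi_le
  have hξ0 := centredXi_zero_ne_zero hsimple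
  set B := 4 + 3 * C₂ + |Real.log ‖centredXi 0‖| with hB
  have hB0 : 0 < B := by positivity
  refine ⟨Real.exp (C₁ + 64 * B), max X₀ 4, by positivity, le_max_of_le_left hX₀, fun X hX ↦ ?_⟩
  have hX4 : 4 ≤ X := (le_max_right _ _).trans hX
  have hX1 : 1 ≤ X := by linarith
  have hXpow : ∀ n : ℕ, 1 ≤ X ^ n := fun n ↦ one_le_pow₀ hX1
  have hXR : 16 * X ≤ X ^ 4 := by
    have : (16 : ℝ) ≤ X ^ 3 := by nlinarith [pow_le_pow_left₀ (by norm_num) hX4 3]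
    nlinarith
  obtain ⟨T, hT1, hT2, hTbad, hsum⟩ := hheight X (X ^ 4) ((le_max_left _ _).trans hX) (by linarith)
  refine ⟨T, hT1, hT2, ?_⟩
  set S := centredXiZeros (X ^ 4) with hS
  -- with `R = X ^ 4` and `log |ξ| = O(R ^ (3 / 2))` the error `O(R ^ (3 / 2) * (X / R) ^ 2)` of the
  -- factorization is bounded
  have hbound : ∀ z, ‖z‖ = 2 * X ^ 4 →
      ‖centredXi z‖ ≤ Real.exp (B * X ^ 6) * ‖centredXi 0‖ := by
    intro z hz
    refine (hgrowth z).trans ?_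
    rw [← Real.exp_log (norm_pos_iff.mpr hξ0), ← Real.exp_add, Real.exp_le_exp, hz]
    have hre : |z.re| / 2 ≤ X ^ 4 := by
      have := abs_re_le_norm z
      linarith
    have hlog : Real.log (2 * X ^ 4 + 2) ≤ 4 * X ^ 2 := by
      have h1 : 2 * X ^ 4 + 2 ≤ (2 * X ^ 2) ^ 2 := by nlinarith [hXpow 4]
      refine (Real.log_le_log (by positivity) h1).trans ?_
      rw [Real.log_pow]
      have := Real.log_le_sub_one_of_pos (show 0 < 2 * X ^ 2 by positivity)
      push_cast
      linarith
    have hlog0 : 0 ≤ Real.log (2 * X ^ 4 + 2) := Real.log_nonneg (by nlinarith [hXpow 4])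
    have h1 : |z.re| / 2 * Real.log (2 * X ^ 4 + 2) ≤ X ^ 4 * (4 * X ^ 2) := by gcongr
    have h46 : X ^ 4 ≤ X ^ 6 := pow_le_pow_right₀ hX1 (by norm_num)
    have h2 : C₂ * (2 * X ^ 4 + 1) ≤ 3 * C₂ * X ^ 6 := by
      have : 2 * X ^ 4 + 1 ≤ 3 * X ^ 6 := by linarith [hXpow 4]
      calc C₂ * (2 * X ^ 4 + 1) ≤ C₂ * (3 * X ^ 6) := by gcongr
        _ = _ := by ring
    have h3 : -Real.log ‖centredXi 0‖ ≤ |Real.log ‖centredXi 0‖| * X ^ 6 := by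
      have := neg_abs_le (Real.log ‖centredXi 0‖)
      nlinarith [hXpow 6, abs_nonneg (Real.log ‖centredXi 0‖)]
    rw [hB]
    nlinarith
  -- the logarithmic form of the factorization, at points at height `T` in the strip
  have hfac : ∀ x : ℝ, |x| ≤ 1 → centredXi (x + T * I) ≠ 0 ∧
      |Real.log ‖centredXi (x + T * I)‖ - (Real.log ‖centredXi 0‖ +
        ∑ ρ ∈ S, (Real.log ‖(x + T * I : ℂ) - ρ‖ - Real.log ‖ρ‖))| ≤ 32 * B := by
    intro x hx
    set z : ℂ := x + T * I with hz
    have hzre : z.re = x := by simp [hz]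
    have hzim : z.im = T := by simp [hz]
    have hzn : ‖z‖ ≤ 2 * X := by
      refine (norm_le_abs_re_add_abs_im z).trans ?_
      rw [hzre, hzim]
      linarith
    have hzR : ‖z‖ < X ^ 4 / 2 := by linarith
    have hz0 : centredXi z ≠ 0 := by
      intro h
      refine hTbad z (mem_centredXiZeros.mpr ⟨h, by linarith⟩) ?_
      rw [hzim, sub_self]
    refine ⟨hz0, ?_⟩
    obtain ⟨H, hH1, hH2⟩ := sq_eq_prod_mul_exp_of_even differentiable_centredXi centredXi_neg hξ0
      (fun ρ hρ ↦ deriv_centredXi_ne_zero hsimple hρ) (R := X ^ 4) (M := B * X ^ 6)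
      (by positivity) (by positivity) hbound (S := S) (fun ρ ↦ mem_centredXiZeros) hzR
    have hρ0 : ∀ ρ ∈ S, ρ ≠ 0 := fun ρ hρ e ↦ hξ0 (e ▸ (mem_centredXiZeros.mp hρ).1)
    have hzρ : ∀ ρ ∈ S, z - ρ ≠ 0 := fun ρ hρ e ↦ hTbad ρ hρ (by
      have := congrArg Complex.im e
      simpa [hzim] using this)
    have hfactor : ∀ ρ ∈ S, Real.log ‖1 - z / ρ‖ = Real.log ‖z - ρ‖ - Real.log ‖ρ‖ := by
      intro ρ hρ
      rw [← Real.log_div (norm_ne_zero_iff.mpr (hzρ ρ hρ)) (norm_ne_zero_iff.mpr (hρ0 ρ hρ)),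
        ← norm_div, ← norm_neg]
      congr 2
      have := hρ0 ρ hρ
      field_simp
      ring
    have hfne : ∀ ρ ∈ S, ‖1 - z / ρ‖ ≠ 0 := by
      intro ρ hρ
      rw [norm_ne_zero_iff]
      intro h
      have := hρ0 ρ hρ
      field_simp at h
      exact hzρ ρ hρ (by linear_combination -h)
    have h1 := congrArg (fun u ↦ Real.log ‖u‖) hH1
    simp only [norm_mul, norm_pow, norm_exp, norm_prod] at h1
    rw [Real.log_mul, Real.log_mul, Real.log_pow, Real.log_pow, Real.log_pow, Real.log_exp,
      Real.log_prod hfne, Finset.sum_congr rfl hfactor] at h1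
    · push_cast at h1
      have h2 : ‖H‖ ≤ 64 * B := by
        refine hH2.trans ?_
        have h3 : ‖z‖ / X ^ 4 ≤ 2 / X ^ 3 := by
          rw [div_le_div_iff₀ (by positivity) (by positivity)]
          nlinarith [hXpow 3]
        calc 16 * (B * X ^ 6) * (‖z‖ / X ^ 4) ^ 2 ≤ 16 * (B * X ^ 6) * (2 / X ^ 3) ^ 2 := by gcongr
          _ = 64 * B := by field_simp; norm_num
      have h4 := (abs_re_le_norm H).trans h2
      have h5 := abs_le.mp h4
      rw [abs_le]
      constructor <;> linarith [h5.1, h5.2]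
    · exact pow_ne_zero 2 (norm_ne_zero_iff.mpr hξ0)
    · exact pow_ne_zero 2 (Finset.prod_ne_zero_iff.mpr hfne)
    · exact mul_ne_zero (pow_ne_zero 2 (norm_ne_zero_iff.mpr hξ0))
        (pow_ne_zero 2 (Finset.prod_ne_zero_iff.mpr hfne))
    · exact (Real.exp_pos _).ne'
  intro x hx
  obtain ⟨hz0, hz1⟩ := hfac x hx
  obtain ⟨hw0, hw1⟩ := hfac (11 / 20 : ℝ) (by rw [abs_of_pos] <;> norm_num)
  refine ⟨hz0, ?_⟩
  set z : ℂ := x + T * I with hz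
  set w : ℂ := (11 / 20 : ℝ) + T * I with hw
  have hdiff : ∑ ρ ∈ S, (Real.log ‖w - ρ‖ - Real.log ‖ρ‖) -
      ∑ ρ ∈ S, (Real.log ‖z - ρ‖ - Real.log ‖ρ‖) ≤ 0.92 * Real.log X + C₁ := by
    rw [← Finset.sum_sub_distrib]
    refine le_trans (Finset.sum_le_sum fun ρ hρ ↦ ?_) hsum
    have := log_norm_sub_le_logDistRatio (x := x) (hTbad ρ hρ) (11 / 20)
    linarith
  have hlogX : 0 ≤ Real.log X := Real.log_nonneg hX1
  have hlog : Real.log ‖centredXi w‖ ≤ (C₁ + 64 * B) + Real.log X + Real.log ‖centredXi z‖ := by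
    have h1 := abs_le.mp hz1
    have h2 := abs_le.mp hw1
    linarith [h1.1, h2.2]
  calc ‖centredXi w‖ = Real.exp (Real.log ‖centredXi w‖) :=
        (Real.exp_log (norm_pos_iff.mpr hw0)).symm
    _ ≤ Real.exp ((C₁ + 64 * B) + Real.log X + Real.log ‖centredXi z‖) := Real.exp_le_exp.mpr hlog
    _ = _ := by
      rw [Real.exp_add, Real.exp_add, Real.exp_log (by linarith),
        Real.exp_log (norm_pos_iff.mpr hz0)]
end

/-! ### Upper bounds for `1 / ζ` -/

section
open Complex Filter Topology MeasureTheory Set Metric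

lemma hasSum_moebius_mul_cpow {s : ℂ} (hs : 1 < s.re) :
    HasSum (fun n : ℕ ↦ (ArithmeticFunction.moebius n : ℂ) * (n : ℂ) ^ (-s)) (riemannZeta s)⁻¹ := by
  have h1 := (ArithmeticFunction.LSeriesSummable_moebius_iff.mpr hs).LSeriesHasSum
  have h2 := ArithmeticFunction.LSeries_zeta_mul_Lseries_moebius hs
  rw [ArithmeticFunction.LSeries_zeta_eq_riemannZeta hs] at h2
  have h3 : LSeries (fun n ↦ (ArithmeticFunction.moebius n : ℂ)) s = (riemannZeta s)⁻¹ :=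
    eq_inv_of_mul_eq_one_right h2
  rw [h3] at h1
  refine h1.congr_fun fun n ↦ ?_
  rcases eq_or_ne n 0 with rfl | hn
  · simp
  · rw [LSeries.term_of_ne_zero hn, cpow_neg, div_eq_mul_inv]

lemma norm_moebius_mul_cpow_le (s : ℂ) (n : ℕ) :
    ‖(ArithmeticFunction.moebius n : ℂ) * (n : ℂ) ^ (-s)‖ ≤ 1 / (n : ℝ) ^ s.re := by
  rcases eq_or_ne n 0 with rfl | hn
  · simp; positivity
  · rw [norm_mul, norm_natCast_cpow_of_pos (Nat.pos_of_ne_zero hn), neg_re,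
      Real.rpow_neg (Nat.cast_nonneg n), one_div]
    have : ‖((ArithmeticFunction.moebius n : ℤ) : ℂ)‖ ≤ 1 := by
      rw [norm_intCast]
      exact_mod_cast ArithmeticFunction.abs_moebius_le_one
    calc _ ≤ 1 * ((n : ℝ) ^ s.re)⁻¹ := by gcongr
      _ = _ := one_mul _

/-- `1 / ζ` is bounded on every vertical line to the right of `Re s = 1`. -/
lemma norm_inv_riemannZeta_le {s : ℂ} (hs : 1 < s.re) :
    ‖(riemannZeta s)⁻¹‖ ≤ ∑' n : ℕ, 1 / (n : ℝ) ^ s.re := by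
  rw [← (hasSum_moebius_mul_cpow hs).tsum_eq]
  exact tsum_of_norm_bounded (Real.summable_one_div_nat_rpow.mpr hs).hasSum
    (norm_moebius_mul_cpow_le s)

/-- Among the values with given real part `σ` the ratio `Γ (s) / Γ (s + d)` is largest in modulus
at `s = σ`, being a Beta integral up to the factor `Γ (d)`. -/
lemma norm_Gamma_mul_Gamma_re_le {s : ℂ} {d : ℝ} (hs : 0 < s.re) (hd : 0 ≤ d) :
    ‖Gamma s‖ * Real.Gamma (s.re + d) ≤ Real.Gamma s.re * ‖Gamma (s + d)‖ := by
  rcases hd.eq_or_lt with rfl | hd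
  · simp [mul_comm]
  have hdC : 0 < (d : ℂ).re := by simpa using hd
  have hsR : 0 < (s.re : ℂ).re := by simpa using hs
  have h1 := Gamma_mul_Gamma_eq_betaIntegral hs hdC
  have h2 := Gamma_mul_Gamma_eq_betaIntegral hsR hdC
  have h3 : ‖betaIntegral s d‖ ≤ ‖betaIntegral s.re d‖ := by
    have hR : ∀ x ∈ Ioc (0 : ℝ) 1, (x : ℂ) ^ ((s.re : ℂ) - 1) * (1 - (x : ℂ)) ^ ((d : ℂ) - 1) =
        ((x ^ (s.re - 1) * (1 - x) ^ (d - 1) : ℝ) : ℂ) := by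
      intro x hx
      have hx1 : 0 ≤ 1 - x := by linarith [hx.2]
      push_cast [ofReal_cpow hx.1.le, ofReal_cpow hx1]
      rfl
    have hint := betaIntegral_convergent hsR hdC
    have h4 : ‖betaIntegral s.re d‖ = ∫ x in (0 : ℝ)..1, x ^ (s.re - 1) * (1 - x) ^ (d - 1) := by
      have : betaIntegral s.re d =
          ((∫ x in (0 : ℝ)..1, x ^ (s.re - 1) * (1 - x) ^ (d - 1) : ℝ) : ℂ) := by
        rw [betaIntegral, ← intervalIntegral.integral_ofReal]
        refine intervalIntegral.integral_congr_ae (Eventually.of_forall fun x hx ↦ ?_)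
        rw [uIoc_of_le zero_le_one] at hx
        exact hR x hx
      rw [this, norm_real, Real.norm_of_nonneg]
      refine intervalIntegral.integral_nonneg zero_le_one fun x hx ↦ ?_
      have : 0 ≤ 1 - x := by linarith [hx.2]
      have := hx.1
      positivity
    rw [h4, betaIntegral]
    refine intervalIntegral.norm_integral_le_of_norm_le zero_le_one ?_ ?_
    · have hnull : volume ({1} : Set ℝ) = 0 := by simp
      filter_upwards [compl_mem_ae_iff.mpr hnull] with x hx1 hx
      have hx1' : 0 < 1 - x := by
        have : x ≠ 1 := hx1
        have := lt_of_le_of_ne hx.2 this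
        linarith
      rw [norm_mul, norm_cpow_eq_rpow_re_of_pos hx.1]
      rw [show (1 : ℂ) - x = ((1 - x : ℝ) : ℂ) by push_cast; rfl,
        norm_cpow_eq_rpow_re_of_pos hx1']
      simp
    · have hn := hint.norm
      refine hn.congr ?_
      intro x hx
      rw [uIoc_of_le zero_le_one] at hx
      have hx1 : 0 ≤ 1 - x := by linarith [hx.2]
      have hx0 := hx.1.le
      dsimp only
      rw [hR x hx, norm_real, Real.norm_of_nonneg (by positivity)]
  have hG : 0 < ‖Gamma (d : ℂ)‖ := norm_pos_iff.mpr (Gamma_ne_zero_of_re_pos hdC)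
  have h5 : ‖Gamma s‖ * ‖Gamma (d : ℂ)‖ = ‖Gamma (s + d)‖ * ‖betaIntegral s d‖ := by
    rw [← norm_mul, h1, norm_mul]
  have hre : ∀ x : ℝ, 0 < x → ‖Gamma (x : ℂ)‖ = Real.Gamma x := fun x hx ↦ by
    rw [Gamma_ofReal, norm_real, Real.norm_of_nonneg (Real.Gamma_nonneg_of_nonneg hx.le)]
  have h6 : Real.Gamma s.re * ‖Gamma (d : ℂ)‖ =
      Real.Gamma (s.re + d) * ‖betaIntegral s.re d‖ := by
    rw [← hre _ hs, ← hre _ (add_pos hs hd), ← norm_mul, h2, norm_mul]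
    push_cast
    rfl
  have hGsd : 0 ≤ Real.Gamma (s.re + d) := Real.Gamma_nonneg_of_nonneg (by positivity)
  refine le_of_mul_le_mul_right ?_ hG
  calc ‖Gamma s‖ * Real.Gamma (s.re + d) * ‖Gamma (d : ℂ)‖
      = (‖Gamma s‖ * ‖Gamma (d : ℂ)‖) * Real.Gamma (s.re + d) := by ring
    _ = ‖Gamma (s + d)‖ * ‖betaIntegral s d‖ * Real.Gamma (s.re + d) := by rw [h5]
    _ ≤ ‖Gamma (s + d)‖ * ‖betaIntegral s.re d‖ * Real.Gamma (s.re + d) := by gcongr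
    _ = (Real.Gamma (s.re + d) * ‖betaIntegral s.re d‖) * ‖Gamma (s + d)‖ := by ring
    _ = _ := by rw [← h6]; ring

/-- In the strip `-1 / 2 ≤ Re s ≤ 21 / 20`, away from the real axis, the archimedean Euler factor
is dominated by its value on the right edge at the same height. -/
lemma exists_norm_Gammaℝ_le : ∃ C : ℝ, 0 < C ∧ ∀ σ T : ℝ, -1 / 2 ≤ σ → σ ≤ 21 / 20 → 1 ≤ |T| →
    ‖Gammaℝ (σ + T * I)‖ ≤ C * ‖Gammaℝ ((21 / 20 : ℝ) + T * I)‖ := by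
  obtain ⟨K, hK⟩ : ∃ K, ∀ x ∈ Icc (3 / 4 : ℝ) (61 / 40), Real.Gamma x ≤ K := by
    have hc : ContinuousOn Real.Gamma (Icc (3 / 4 : ℝ) (61 / 40)) := fun x hx ↦
      (Real.differentiableAt_Gamma fun m h ↦ by
        linarith [hx.1, h, m.cast_nonneg (α := ℝ)]).continuousAt.continuousWithinAt
    obtain ⟨K, hK⟩ := isCompact_Icc.bddAbove_image hc
    exact ⟨K, fun x hx ↦ hK ⟨x, hx, rfl⟩⟩
  set g := Real.Gamma (61 / 40) with hg
  have hg0 : 0 < g := Real.Gamma_pos_of_pos (by norm_num)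
  have hK0 : 0 < K :=
    (Real.Gamma_pos_of_pos (by norm_num)).trans_le (hK 1 ⟨by norm_num, by norm_num⟩)
  refine ⟨Real.pi * (K / g * 3), by positivity, fun σ T hσ1 hσ2 hT ↦ ?_⟩
  set s : ℂ := σ + T * I with hs
  set c : ℂ := (21 / 20 : ℝ) + T * I with hc
  have hsre : s.re = σ := by simp [hs]
  have hcre : c.re = 21 / 20 := by simp [hc]
  have hs0 : s ≠ 0 := fun h ↦ by
    have := congrArg Complex.im h
    simp [hs] at this
    rw [this] at hT
    norm_num at hT
  have hc0 : c ≠ 0 := fun h ↦ by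
    rw [h] at hcre
    norm_num at hcre
  have hsT : |T| ≤ ‖s‖ := by
    have := abs_im_le_norm s
    simpa [hs] using this
  have hcT : ‖c‖ ≤ 3 * |T| := by
    refine (norm_le_abs_re_add_abs_im c).trans ?_
    have : c.im = T := by simp [hc]
    rw [hcre, this, abs_of_pos (by norm_num)]
    linarith
  have h1 : ‖Gamma (s / 2 + 1)‖ * g ≤ K * ‖Gamma (c / 2 + 1)‖ := by
    have hre : (s / 2 + 1).re = σ / 2 + 1 := by simp [hsre]
    have h := norm_Gamma_mul_Gamma_re_le (s := s / 2 + 1) (d := (21 / 20 - σ) / 2)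
      (by rw [hre]; linarith) (by linarith)
    have e1 : s / 2 + 1 + (((21 / 20 - σ) / 2 : ℝ) : ℂ) = c / 2 + 1 := by
      rw [hs, hc]; push_cast; ring
    rw [e1, hre, show σ / 2 + 1 + (21 / 20 - σ) / 2 = 61 / 40 by ring] at h
    refine h.trans ?_
    gcongr
    exact hK _ ⟨by linarith, by linarith⟩
  rw [Gamma_add_one _ (div_ne_zero hs0 two_ne_zero), Gamma_add_one _ (div_ne_zero hc0 two_ne_zero),
    norm_mul, norm_mul, norm_div, norm_div] at h1
  have h2 : ‖Gamma (s / 2)‖ ≤ K / g * 3 * ‖Gamma (c / 2)‖ := by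
    have hn : (0 : ℝ) ≤ ‖Gamma (c / 2)‖ := norm_nonneg _
    have hn' : (0 : ℝ) ≤ ‖Gamma (s / 2)‖ := norm_nonneg _
    have h3 : |T| * (‖Gamma (s / 2)‖ * g) ≤ |T| * (3 * K * ‖Gamma (c / 2)‖) := by
      simp only [norm_ofNat] at h1
      calc |T| * (‖Gamma (s / 2)‖ * g) ≤ ‖s‖ * (‖Gamma (s / 2)‖ * g) := by gcongr
        _ = 2 * (‖s‖ / 2 * ‖Gamma (s / 2)‖ * g) := by ring
        _ ≤ 2 * (K * (‖c‖ / 2 * ‖Gamma (c / 2)‖)) := by gcongr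
        _ = ‖c‖ * (K * ‖Gamma (c / 2)‖) := by ring
        _ ≤ 3 * |T| * (K * ‖Gamma (c / 2)‖) := by gcongr
        _ = _ := by ring
    have h4 := le_of_mul_le_mul_left h3 (by linarith)
    rw [div_mul_eq_mul_div, div_mul_eq_mul_div, le_div_iff₀ hg0]
    linarith
  have hpi : ∀ u : ℂ, ‖(Real.pi : ℂ) ^ (-u / 2)‖ = Real.pi ^ (-u.re / 2) := by
    intro u
    rw [norm_cpow_eq_rpow_re_of_pos Real.pi_pos]
    simp
  rw [Gammaℝ_def, Gammaℝ_def, norm_mul, norm_mul, hpi, hpi, hsre, hcre]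
  have h5 : Real.pi ^ (-σ / 2) ≤ Real.pi * Real.pi ^ (-(21 / 20) / 2 : ℝ) := by
    nth_rewrite 2 [← Real.rpow_one Real.pi]
    rw [← Real.rpow_add Real.pi_pos]
    exact Real.rpow_le_rpow_of_exponent_le (by linarith [Real.pi_gt_three]) (by linarith)
  calc Real.pi ^ (-σ / 2) * ‖Gamma (s / 2)‖
      ≤ (Real.pi * Real.pi ^ (-(21 / 20) / 2 : ℝ)) * (K / g * 3 * ‖Gamma (c / 2)‖) := by gcongr
    _ = _ := by ring

/-- Unconditionally on the location of the zeros, `1 / ζ` is `O(T)` on some horizontal segments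
`-1 / 2 ≤ Re s ≤ 21 / 20`, `Im s = ± T` with arbitrarily large `T`. -/
theorem exists_height_norm_inv_riemannZeta_le
    (hsimple : ∀ ρ ∈ nontrivialZetaZeros, deriv riemannZeta ρ ≠ 0) :
    ∃ C : ℝ, 0 < C ∧ ∀ X : ℝ, ∃ T : ℝ, X ≤ T ∧ 1 ≤ T ∧ ∀ σ t : ℝ, -1 / 2 ≤ σ → σ ≤ 21 / 20 →
      |t| = T → riemannZeta (σ + t * I) ≠ 0 ∧ ‖(riemannZeta (σ + t * I))⁻¹‖ ≤ C * T := by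
  obtain ⟨C₁, X₀, hC₁, hX₀, hξ⟩ := exists_height_norm_centredXi_le hsimple
  obtain ⟨C₂, hC₂, hΓ⟩ := exists_norm_Gammaℝ_le
  set Z := ∑' n : ℕ, 1 / (n : ℝ) ^ (21 / 20 : ℝ) with hZ
  have hZ0 : 0 ≤ Z := tsum_nonneg fun n ↦ by positivity
  refine ⟨20 * C₁ * C₂ * 7 * (Z + 1), by positivity, fun X ↦ ?_⟩
  obtain ⟨T, hT1, hT2, hT⟩ := hξ (max X₀ (20 * max X 1)) (le_max_left _ _)
  set Y := max X₀ (20 * max X 1) with hY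
  have hYX : max X 1 ≤ |T| := by
    have : 20 * max X 1 ≤ Y := le_max_right _ _
    linarith
  have hTX : X ≤ |T| := (le_max_left _ _).trans hYX
  have hT1' : 1 ≤ |T| := (le_max_right _ _).trans hYX
  have hY0 : 0 < Y := by linarith
  have key : ∀ σ : ℝ, -1 / 2 ≤ σ → σ ≤ 21 / 20 → riemannZeta (σ + T * I) ≠ 0 ∧
      ‖(riemannZeta (σ + T * I))⁻¹‖ ≤ 20 * C₁ * C₂ * 7 * (Z + 1) * |T| := by
    intro σ hσ1 hσ2
    obtain ⟨h1, h2⟩ := hT (σ - 1 / 2) (abs_le.mpr ⟨by linarith, by linarith⟩)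
    set s : ℂ := σ + T * I with hs
    set c : ℂ := (21 / 20 : ℝ) + T * I with hc
    have hTne : T ≠ 0 := fun h ↦ by rw [h] at hT1'; norm_num at hT1'
    have him : s.im = T := by simp [hs]
    have hcim : c.im = T := by simp [hc]
    have hsre : s.re = σ := by simp [hs]
    have hcre : c.re = 21 / 20 := by simp [hc]
    have hs0 : s ≠ 0 := fun h ↦ hTne (by rw [← him, h]; rfl)
    have hs1 : s ≠ 1 := fun h ↦ hTne (by rw [← him, h]; rfl)
    have hc0 : c ≠ 0 := fun h ↦ hTne (by rw [← hcim, h]; rfl)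
    have hc1 : c ≠ 1 := fun h ↦ hTne (by rw [← hcim, h]; rfl)
    have hGne : ∀ u : ℂ, u.im = T → Gammaℝ u ≠ 0 := by
      intro u hu h
      obtain ⟨n, hn⟩ := Gammaℝ_eq_zero_iff.mp h
      apply hTne
      rw [← hu, hn]
      simp
    have hGs := hGne s him
    have hGc := hGne c hcim
    have es : ((σ - 1 / 2 : ℝ) : ℂ) + T * I = s - 1 / 2 := by rw [hs]; push_cast; ring
    have ec : ((11 / 20 : ℝ) : ℂ) + T * I = c - 1 / 2 := by rw [hc]; push_cast; ring
    rw [es] at h1 h2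
    rw [ec, centredXi_eq_mul_riemannZeta hc0 hc1 hGc,
      centredXi_eq_mul_riemannZeta hs0 hs1 hGs] at h2
    rw [centredXi_eq_mul_riemannZeta hs0 hs1 hGs] at h1
    -- `ζ = ξ / (s (s - 1) Γ_ℝ)`, and these factors at `s` are at most a constant times those at `c`
    have hζ : riemannZeta s ≠ 0 := right_ne_zero_of_mul h1
    refine ⟨hζ, ?_⟩
    have hζc : ‖(riemannZeta c)⁻¹‖ ≤ Z := by
      have := norm_inv_riemannZeta_le (s := c) (by rw [hcre]; norm_num)
      rwa [hcre] at this
    have hζc0 : riemannZeta c ≠ 0 :=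
      riemannZeta_ne_zero_of_one_le_re (by rw [hcre]; norm_num)
    have hG := hΓ σ T hσ1 hσ2 hT1'
    have hnorm : ‖s * (s - 1)‖ ≤ 7 * ‖c * (c - 1)‖ := by
      have e1 : ‖s‖ ≤ 2.05 * |T| := by
        refine (norm_le_abs_re_add_abs_im s).trans ?_
        have : |σ| ≤ 21 / 20 := abs_le.mpr ⟨by linarith, hσ2⟩
        rw [hsre, him]; linarith
      have e2 : ‖s - 1‖ ≤ 2.5 * |T| := by
        refine (norm_le_abs_re_add_abs_im _).trans ?_
        have : |σ - 1| ≤ 1.5 := abs_le.mpr ⟨by linarith, by linarith⟩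
        simp only [sub_re, sub_im, one_re, one_im, hsre, him, sub_zero]
        linarith
      have e3 : |T| ≤ ‖c‖ := by simpa [hcim] using abs_im_le_norm c
      have e4 : |T| ≤ ‖c - 1‖ := by simpa [hcim] using abs_im_le_norm (c - 1)
      rw [norm_mul, norm_mul]
      calc ‖s‖ * ‖s - 1‖ ≤ (2.05 * |T|) * (2.5 * |T|) := by gcongr
        _ ≤ 7 * (|T| * |T|) := by nlinarith [mul_self_nonneg |T|]
        _ ≤ 7 * (‖c‖ * ‖c - 1‖) := by gcongr
    simp only [norm_mul _ (riemannZeta _), norm_mul _ (Gammaℝ _)] at h2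
    set P := ‖c * (c - 1)‖ * ‖Gammaℝ c‖ with hP
    have hP0 : 0 < P := mul_pos (norm_pos_iff.mpr (mul_ne_zero hc0 (sub_ne_zero.mpr hc1)))
      (norm_pos_iff.mpr hGc)
    have h3 : P * ‖riemannZeta c‖ ≤ P * (C₁ * Y * 7 * C₂ * ‖riemannZeta s‖) := by
      calc P * ‖riemannZeta c‖ ≤ C₁ * Y * (‖s * (s - 1)‖ * ‖Gammaℝ s‖ * ‖riemannZeta s‖) := h2
        _ ≤ C₁ * Y * ((7 * ‖c * (c - 1)‖) * (C₂ * ‖Gammaℝ c‖) * ‖riemannZeta s‖) := by gcongr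
        _ = _ := by rw [hP]; ring
    have h4 := le_of_mul_le_mul_left h3 hP0
    rw [norm_inv] at hζc ⊢
    have hcpos : 0 < ‖riemannZeta c‖ := norm_pos_iff.mpr hζc0
    have hspos : 0 < ‖riemannZeta s‖ := norm_pos_iff.mpr hζ
    have hY20 : Y ≤ 20 * |T| := by linarith
    rw [inv_le_iff_one_le_mul₀ hspos]
    rw [inv_le_iff_one_le_mul₀ hcpos] at hζc
    calc 1 ≤ Z * ‖riemannZeta c‖ := hζc
      _ ≤ (Z + 1) * (C₁ * (20 * |T|) * 7 * C₂ * ‖riemannZeta s‖) := by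
          gcongr
          · linarith
          · refine h4.trans ?_
            gcongr
      _ = _ := by ring
  refine ⟨|T|, hTX, hT1', fun σ t hσ1 hσ2 ht ↦ ?_⟩
  obtain ⟨h1, h2⟩ := key σ hσ1 hσ2
  rcases abs_eq_abs.mp ht with rfl | rfl
  · exact ⟨h1, h2⟩
  · have e : (σ : ℂ) + ((-T : ℝ) : ℂ) * I = (starRingEnd ℂ) (σ + T * I) := by
      simp
    rw [e, riemannZeta_conj]
    refine ⟨(map_ne_zero _).mpr h1, ?_⟩
    rw [← map_inv₀, Complex.norm_conj]
    exact h2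
end

/-! ### The residue theorem on rectangles -/

section
open Complex Filter Topology MeasureTheory Set

/-- The integral of `f` along the boundary of the rectangle `[a, b] × [c, d]`, anticlockwise. -/
noncomputable def rectIntegral (f : ℂ → ℂ) (a b c d : ℝ) : ℂ :=
  (∫ x in a..b, f (x + c * I)) - (∫ x in a..b, f (x + d * I)) +
    I * (∫ y in c..d, f (b + y * I)) - I * (∫ y in c..d, f (a + y * I))

lemma rectIntegral_eq_zero {f : ℂ → ℂ} {a b c d : ℝ} (hab : a ≤ b) (hcd : c ≤ d)
    (hf : DifferentiableOn ℂ f (Icc a b ×ℂ Icc c d)) : rectIntegral f a b c d = 0 := by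
  have h := integral_boundary_rect_eq_zero_of_differentiableOn f (a + c * I) (b + d * I)
    (by simpa [uIcc_of_le hab, uIcc_of_le hcd] using hf)
  simpa [rectIntegral] using h

lemma Complex.log_neg_of_im_pos {w : ℂ} (hw : 0 < w.im) : log (-w) = log w - Real.pi * I := by
  rw [log, log, norm_neg, arg_neg_eq_arg_sub_pi_of_im_pos hw]
  push_cast
  ring

lemma Complex.log_neg_of_im_neg {w : ℂ} (hw : w.im < 0) : log (-w) = log w + Real.pi * I := by
  rw [log, log, norm_neg, arg_neg_eq_arg_add_pi_of_im_neg hw]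
  push_cast
  ring

lemma rectIntegral_inv_sub {a b c d : ℝ} {p : ℂ} (h1 : a < p.re) (h2 : p.re < b) (h3 : c < p.im)
    (h4 : p.im < d) : rectIntegral (fun s ↦ (s - p)⁻¹) a b c d = 2 * Real.pi * I := by
  have hor : ∀ y : ℝ, y ≠ p.im → ∫ x in a..b, ((x + y * I : ℂ) - p)⁻¹ =
      log ((b + y * I : ℂ) - p) - log ((a + y * I : ℂ) - p) := by
    intro y hy
    have hmem : ∀ x : ℝ, (x + y * I : ℂ) - p ∈ slitPlane := fun x ↦ by
      rw [mem_slitPlane_iff]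
      right
      simpa [sub_eq_zero] using hy
    have hd : ∀ x : ℝ, HasDerivAt (fun x : ℝ ↦ log ((x + y * I : ℂ) - p))
        (((x + y * I : ℂ) - p)⁻¹) x := by
      intro x
      have e : HasDerivAt (fun x : ℝ ↦ (x + y * I : ℂ) - p) 1 x :=
        ((hasDerivAt_id x).ofReal_comp.add_const _).sub_const _
      simpa using e.clog_real (hmem x)
    refine intervalIntegral.integral_eq_sub_of_hasDerivAt (fun x _ ↦ hd x) ?_
    refine Continuous.intervalIntegrable ?_ _ _
    exact Continuous.inv₀ (by fun_prop) fun x ↦ slitPlane_ne_zero (hmem x)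
  have hr : I * ∫ y in c..d, ((b + y * I : ℂ) - p)⁻¹ =
      log ((b + d * I : ℂ) - p) - log ((b + c * I : ℂ) - p) := by
    have hmem : ∀ y : ℝ, (b + y * I : ℂ) - p ∈ slitPlane := fun y ↦ by
      rw [mem_slitPlane_iff]
      left
      simpa using h2
    have hd : ∀ y : ℝ, HasDerivAt (fun y : ℝ ↦ log ((b + y * I : ℂ) - p))
        (I * ((b + y * I : ℂ) - p)⁻¹) y := by
      intro y
      have e : HasDerivAt (fun y : ℝ ↦ (b + y * I : ℂ) - p) I y := by
        simpa using (((hasDerivAt_id y).ofReal_comp.mul_const I).const_add (b : ℂ)).sub_const p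
      simpa [div_eq_mul_inv] using e.clog_real (hmem y)
    rw [← intervalIntegral.integral_const_mul]
    refine intervalIntegral.integral_eq_sub_of_hasDerivAt (fun y _ ↦ hd y) ?_
    refine Continuous.intervalIntegrable ?_ _ _
    exact continuous_const.mul
      (Continuous.inv₀ (by fun_prop) fun y ↦ slitPlane_ne_zero (hmem y))
  have hl : I * ∫ y in c..d, ((a + y * I : ℂ) - p)⁻¹ =
      log (-((a + d * I : ℂ) - p)) - log (-((a + c * I : ℂ) - p)) := by
    have hmem : ∀ y : ℝ, -((a + y * I : ℂ) - p) ∈ slitPlane := fun y ↦ by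
      rw [mem_slitPlane_iff]
      left
      simpa using h1
    have hd : ∀ y : ℝ, HasDerivAt (fun y : ℝ ↦ log (-((a + y * I : ℂ) - p)))
        (I * ((a + y * I : ℂ) - p)⁻¹) y := by
      intro y
      have e : HasDerivAt (fun y : ℝ ↦ (a + y * I : ℂ) - p) I y := by
        simpa using (((hasDerivAt_id y).ofReal_comp.mul_const I).const_add (a : ℂ)).sub_const p
      have h := e.fun_neg.clog_real (hmem y)
      rw [neg_div_neg_eq, div_eq_mul_inv] at h
      exact h
    rw [← intervalIntegral.integral_const_mul]
    refine intervalIntegral.integral_eq_sub_of_hasDerivAt (fun y _ ↦ hd y) ?_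
    refine Continuous.intervalIntegrable ?_ _ _
    refine continuous_const.mul (Continuous.inv₀ (by fun_prop) fun y ↦ ?_)
    exact fun h ↦ slitPlane_ne_zero (hmem y) (by rw [h, neg_zero])
  rw [rectIntegral, hor c h3.ne, hor d h4.ne', hr, hl, log_neg_of_im_pos (by simpa using h4),
    log_neg_of_im_neg (by simpa using h3)]
  ring

/-- The residue theorem for a rectangle and finitely many simple poles in its interior. -/
theorem rectIntegral_eq_sum_residues {a b c d : ℝ} (hab : a ≤ b) (hcd : c ≤ d) (S : Finset ℂ)
    {F : ℂ → ℂ} {r : ℂ → ℂ}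
    (hS : ∀ p ∈ S, a < p.re ∧ p.re < b ∧ c < p.im ∧ p.im < d)
    (hF : DifferentiableOn ℂ F ((Icc a b ×ℂ Icc c d) \ S))
    (hr : ∀ p ∈ S, HasAtMostSimplePoleWithResidue F p (r p)) :
    rectIntegral F a b c d = 2 * Real.pi * I * ∑ p ∈ S, r p := by
  induction S using Finset.induction_on generalizing F with
  | empty => simpa using rectIntegral_eq_zero hab hcd (by simpa using hF)
  | insert p S hpS ih =>
    obtain ⟨hp1, hp2, hp3, hp4⟩ := hS p (Finset.mem_insert_self _ _)
    obtain ⟨g, hg, hFg⟩ := hr p (Finset.mem_insert_self _ _)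
    set F₀ : ℂ → ℂ := fun s ↦ F s - r p * (s - p)⁻¹ with hF₀
    set F₁ : ℂ → ℂ := Function.update F₀ p (g p) with hF₁
    have hF₁ne : ∀ s, s ≠ p → F₁ s = F₀ s := fun s hs ↦ Function.update_of_ne hs _ _
    have hF₁g : F₁ =ᶠ[𝓝 p] g := by
      rw [eventually_nhdsWithin_iff] at hFg
      filter_upwards [hFg] with s hs
      by_cases hsp : s = p
      · rw [hsp, hF₁, Function.update_self]
      · rw [hF₁ne s hsp, hF₀]
        simp only [hs hsp]
        rw [div_eq_mul_inv]
        ring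
    have ih' := ih (F := F₁) (fun q hq ↦ hS q (Finset.mem_insert_of_mem hq)) ?_ ?_
    · have hsides : rectIntegral F₁ a b c d = rectIntegral F₀ a b c d := by
        have e1 : ∀ x : ℝ, F₁ (x + c * I) = F₀ (x + c * I) := fun x ↦ hF₁ne _ fun h ↦ by
          rw [← h] at hp3; simp at hp3
        have e2 : ∀ x : ℝ, F₁ (x + d * I) = F₀ (x + d * I) := fun x ↦ hF₁ne _ fun h ↦ by
          rw [← h] at hp4; simp at hp4
        have e3 : ∀ y : ℝ, F₁ (b + y * I) = F₀ (b + y * I) := fun x ↦ hF₁ne _ fun h ↦ by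
          rw [← h] at hp2; simp at hp2
        have e4 : ∀ y : ℝ, F₁ (a + y * I) = F₀ (a + y * I) := fun x ↦ hF₁ne _ fun h ↦ by
          rw [← h] at hp1; simp at hp1
        simp only [rectIntegral, e1, e2, e3, e4]
      have hcont : ∀ (γ : ℝ → ℂ) (u v : ℝ), u ≤ v → Continuous γ →
          (∀ x ∈ Icc u v, γ x ∈ (Icc a b ×ℂ Icc c d) \ (insert p S : Finset ℂ)) →
          IntervalIntegrable (fun x ↦ F (γ x)) volume u v ∧
          IntervalIntegrable (fun x ↦ r p * (γ x - p)⁻¹) volume u v := by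
        intro γ u v huv hγ hmem
        constructor
        · refine ContinuousOn.intervalIntegrable ?_
          rw [uIcc_of_le huv]
          exact hF.continuousOn.comp hγ.continuousOn hmem
        · refine ContinuousOn.intervalIntegrable ?_
          rw [uIcc_of_le huv]
          refine continuousOn_const.mul (ContinuousOn.inv₀ (by fun_prop) fun x hx h ↦ ?_)
          apply (hmem x hx).2
          rw [sub_eq_zero.mp h]
          simp
      have hne : ∀ s : ℂ, (s.re ≤ a ∨ b ≤ s.re ∨ s.im ≤ c ∨ d ≤ s.im) →
          s ∉ ((insert p S : Finset ℂ) : Set ℂ) := by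
        intro s hs hmem
        have := hS s hmem
        rcases hs with h | h | h | h <;> linarith [this.1, this.2.1, this.2.2.1, this.2.2.2]
      have i1 := hcont (fun x ↦ x + c * I) a b hab (by fun_prop) fun x hx ↦
        ⟨by rw [mem_reProdIm]; simp [hx.1, hx.2, hcd], hne _ (by simp)⟩
      have i2 := hcont (fun x ↦ x + d * I) a b hab (by fun_prop) fun x hx ↦
        ⟨by rw [mem_reProdIm]; simp [hx.1, hx.2, hcd], hne _ (by simp)⟩
      have i3 := hcont (fun y ↦ b + y * I) c d hcd (by fun_prop) fun x hx ↦
        ⟨by rw [mem_reProdIm]; simp [hx.1, hx.2, hab], hne _ (by simp)⟩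
      have i4 := hcont (fun y ↦ a + y * I) c d hcd (by fun_prop) fun x hx ↦
        ⟨by rw [mem_reProdIm]; simp [hx.1, hx.2, hab], hne _ (by simp)⟩
      have hlin : rectIntegral F₀ a b c d = rectIntegral F a b c d -
          r p * rectIntegral (fun s ↦ (s - p)⁻¹) a b c d := by
        simp only [rectIntegral, hF₀]
        rw [intervalIntegral.integral_sub i1.1 i1.2, intervalIntegral.integral_sub i2.1 i2.2,
          intervalIntegral.integral_sub i3.1 i3.2, intervalIntegral.integral_sub i4.1 i4.2]
        simp only [intervalIntegral.integral_const_mul]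
        ring
      rw [hsides, hlin, rectIntegral_inv_sub hp1 hp2 hp3 hp4] at ih'
      rw [Finset.sum_insert hpS]
      linear_combination ih'
    · intro s hs
      by_cases hsp : s = p
      · rw [hsp]
        exact (hg.differentiableAt.congr_of_eventuallyEq hF₁g).differentiableWithinAt
      · have hs' : s ∈ (Icc a b ×ℂ Icc c d) \ ((insert p S : Finset ℂ) : Set ℂ) :=
          ⟨hs.1, by simpa [hsp] using hs.2⟩
        have h1 := hF s hs'
        have h2 : DifferentiableWithinAt ℂ F ((Icc a b ×ℂ Icc c d) \ S) s := by
          refine h1.mono_of_mem_nhdsWithin ?_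
          have : ({p}ᶜ : Set ℂ) ∈ 𝓝 s := isOpen_compl_singleton.mem_nhds hsp
          filter_upwards [self_mem_nhdsWithin, mem_nhdsWithin_of_mem_nhds this] with w hw1 hw2
          exact ⟨hw1.1, by simpa [show w ≠ p from hw2] using hw1.2⟩
        have h3 : DifferentiableWithinAt ℂ F₀ ((Icc a b ×ℂ Icc c d) \ S) s := by
          refine h2.sub (DifferentiableAt.differentiableWithinAt ?_)
          exact (differentiableAt_const _).mul
            (DifferentiableAt.inv (by fun_prop) (sub_ne_zero.mpr hsp))
        refine h3.congr_of_eventuallyEq ?_ (hF₁ne s hsp)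
        filter_upwards [mem_nhdsWithin_of_mem_nhds (isOpen_compl_singleton.mem_nhds hsp)] with w hw
        exact hF₁ne w hw
    · intro q hq
      have hqp : q ≠ p := fun e ↦ hpS (e ▸ hq)
      obtain ⟨k, hk, hFk⟩ := hr q (Finset.mem_insert_of_mem hq)
      refine ⟨fun s ↦ k s - r p * (s - p)⁻¹, ?_, ?_⟩
      · refine hk.sub (analyticAt_const.mul (AnalyticAt.inv ?_ (sub_ne_zero.mpr hqp)))
        exact analyticAt_id.sub analyticAt_const
      · filter_upwards [hFk, mem_nhdsWithin_of_mem_nhds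
          (isOpen_compl_singleton.mem_nhds hqp)] with s hs hsp
        rw [hF₁ne s hsp, hF₀]
        simp only [hs]
        ring
end

/-! ### Mellin transforms of `sin²` and the functional equation -/

section
open Complex Filter Topology MeasureTheory Set

lemma Complex.norm_one_sub_exp_neg_le {w : ℂ} (hw : 0 ≤ w.re) :
    ‖1 - exp (-w)‖ ≤ min 2 ‖w‖ := by
  have hn : ∀ v : ℂ, v.re ≤ 0 → ‖exp v‖ ≤ 1 := fun v hv ↦ by
    rw [norm_exp]
    exact Real.exp_le_one_iff.2 hv
  refine le_min ?_ ?_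
  · have h1 := hn (-w) (by simpa using hw)
    have h2 := norm_sub_le (1 : ℂ) (exp (-w))
    rw [norm_one] at h2
    linarith
  · have h := (convex_halfSpace_re_le 0).norm_image_sub_le_of_norm_hasDerivWithin_le
      (f := exp) (f' := exp) (C := 1) (x := -w) (y := 0)
      (fun v _ ↦ (Complex.hasDerivAt_exp v).hasDerivWithinAt) (fun v hv ↦ hn v hv)
      (show (-w).re ≤ 0 by simpa using hw) (show (0 : ℂ).re ≤ 0 from le_rfl)
    simpa using h

/-- A function that is `O(x)` at `0` and bounded is integrable against `x ^ (σ - 1)` for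
`-1 < σ < 0`. -/
lemma integrableOn_min_mul_rpow {σ : ℝ} (h1 : -1 < σ) (h2 : σ < 0) {c : ℝ} (hc : 0 ≤ c) :
    IntegrableOn (fun x : ℝ ↦ min 2 (c * x) * x ^ (σ - 1)) (Ioi 0) := by
  have hmeas : Measurable fun x : ℝ ↦ min 2 (c * x) * x ^ (σ - 1) := by fun_prop
  have hnorm : ∀ x : ℝ, 0 < x →
      ‖min 2 (c * x) * x ^ (σ - 1)‖ = min 2 (c * x) * x ^ (σ - 1) := fun x hx ↦
    Real.norm_of_nonneg (by positivity)
  rw [← Ioc_union_Ioi_eq_Ioi (zero_le_one' ℝ)]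
  refine IntegrableOn.union ?_ ?_
  · have h : IntegrableOn (fun x : ℝ ↦ c * x ^ σ) (Ioc 0 1) :=
      ((intervalIntegrable_iff_integrableOn_Ioc_of_le zero_le_one).1
        (intervalIntegral.intervalIntegrable_rpow' h1)).const_mul _
    refine h.mono' hmeas.aestronglyMeasurable ?_
    filter_upwards [ae_restrict_mem measurableSet_Ioc] with x hx
    have hx0 := hx.1
    rw [hnorm x hx0, Real.rpow_sub_one hx0.ne']
    calc min 2 (c * x) * (x ^ σ / x) ≤ c * x * (x ^ σ / x) := by
          gcongr
          exact min_le_right _ _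
      _ = c * x ^ σ := by field_simp
  · have h : IntegrableOn (fun x : ℝ ↦ 2 * x ^ (σ - 1)) (Ioi 1) :=
      (integrableOn_Ioi_rpow_of_lt (by linarith) one_pos).const_mul _
    refine h.mono' hmeas.aestronglyMeasurable ?_
    filter_upwards [ae_restrict_mem measurableSet_Ioi] with x hx
    have hx0 : 0 < x := one_pos.trans hx
    rw [hnorm x hx0]
    gcongr
    exact min_le_left _ _

lemma mellinConvergent_of_norm_le_min {f : ℝ → ℂ} (hf : Continuous f) {c : ℝ} (hc : 0 ≤ c)
    (hfc : ∀ x, 0 < x → ‖f x‖ ≤ min 2 (c * x)) {s : ℂ} (h1 : -1 < s.re) (h2 : s.re < 0) :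
    MellinConvergent f s := by
  refine (integrableOn_min_mul_rpow h1 h2 hc).mono' ?_ ?_
  · refine ContinuousOn.aestronglyMeasurable ?_ measurableSet_Ioi
    refine ContinuousOn.smul (f := fun x : ℝ ↦ (x : ℂ) ^ (s - 1)) (fun x hx ↦ ?_) hf.continuousOn
    exact (continuousAt_ofReal_cpow_const _ _ (Or.inr (ne_of_gt hx))).continuousWithinAt
  · filter_upwards [ae_restrict_mem measurableSet_Ioi] with x hx
    rw [norm_smul, norm_cpow_eq_rpow_re_of_pos hx, mul_comm, sub_re, one_re]
    gcongr
    · exact Real.rpow_nonneg (le_of_lt hx) _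
    · exact hfc x hx

lemma norm_one_sub_exp_neg_mul_le {z : ℂ} (hz : 0 ≤ z.re) {x : ℝ} (hx : 0 < x) :
    ‖1 - exp (-(z * x))‖ ≤ min 2 (‖z‖ * x) := by
  have h := norm_one_sub_exp_neg_le (w := z * x) (by simpa using mul_nonneg hz hx.le)
  rwa [norm_mul, norm_real, Real.norm_of_nonneg hx.le] at h

lemma mellinConvergent_one_sub_exp_neg_mul {z s : ℂ} (hz : 0 ≤ z.re) (h1 : -1 < s.re)
    (h2 : s.re < 0) : MellinConvergent (fun x : ℝ ↦ 1 - exp (-(z * x))) s :=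
  mellinConvergent_of_norm_le_min (by fun_prop) (norm_nonneg z)
    (fun _ hx ↦ norm_one_sub_exp_neg_mul_le hz hx) h1 h2

lemma hasDerivAt_mellin_one_sub_exp_neg_mul {z s : ℂ} (hz : 0 < z.re) (h1 : -1 < s.re)
    (h2 : s.re < 0) :
    HasDerivAt (fun w : ℂ ↦ mellin (fun x : ℝ ↦ 1 - exp (-(w * x))) s)
      (∫ x in Ioi (0 : ℝ), (x : ℂ) ^ s * exp (-(z * x))) z := by
  have hball : ∀ w ∈ Metric.ball z (z.re / 2), z.re / 2 < w.re := fun w hw ↦ by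
    have h := (abs_re_le_norm (w - z)).trans_lt (mem_ball_iff_norm.1 hw)
    rw [sub_re, abs_lt] at h
    linarith [h.1]
  have hcpow : ∀ a : ℂ, ContinuousOn (fun x : ℝ ↦ (x : ℂ) ^ a) (Ioi 0) := fun a x hx ↦
    (continuousAt_ofReal_cpow_const _ _ (Or.inr (ne_of_gt hx))).continuousWithinAt
  have key := hasDerivAt_integral_of_dominated_loc_of_deriv_le (μ := volume.restrict (Ioi 0))
    (F := fun (w : ℂ) (x : ℝ) ↦ (x : ℂ) ^ (s - 1) • (1 - exp (-(w * x))))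
    (F' := fun (w : ℂ) (x : ℝ) ↦ (x : ℂ) ^ s * exp (-(w * x)))
    (bound := fun x ↦ x ^ s.re * Real.exp (-(z.re / 2) * x ^ (1 : ℝ)))
    (x₀ := z) (s := Metric.ball z (z.re / 2)) (Metric.ball_mem_nhds _ (by linarith))
    (Eventually.of_forall fun w ↦ ?_) (mellinConvergent_one_sub_exp_neg_mul hz.le h1 h2) ?_ ?_
    (integrableOn_rpow_mul_exp_neg_mul_rpow h1 one_pos (by linarith)) ?_
  · exact key.2
  · exact ((hcpow _).smul (by fun_prop)).aestronglyMeasurable measurableSet_Ioi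
  · exact ((hcpow _).mul (by fun_prop)).aestronglyMeasurable measurableSet_Ioi
  · filter_upwards [ae_restrict_mem measurableSet_Ioi] with x hx w hw
    have hx' : (0 : ℝ) < x := hx
    rw [norm_mul, norm_cpow_eq_rpow_re_of_pos hx, norm_exp, Real.rpow_one]
    gcongr
    have := hball w hw
    simp
    nlinarith
  · filter_upwards [ae_restrict_mem measurableSet_Ioi] with x hx w hw
    have hx' : (x : ℂ) ≠ 0 := ofReal_ne_zero.2 (ne_of_gt hx)
    have e : HasDerivAt (fun w : ℂ ↦ 1 - exp (-(w * x))) (x * exp (-(w * x))) w := by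
      have e1 : HasDerivAt (fun w : ℂ ↦ -(w * x)) (-x : ℂ) w := by
        simpa using ((hasDerivAt_id w).mul_const (x : ℂ)).fun_neg
      refine (e1.cexp.const_sub 1).congr_deriv ?_
      ring
    refine (e.const_smul ((x : ℂ) ^ (s - 1))).congr_deriv ?_
    rw [cpow_sub _ _ hx', cpow_one, smul_eq_mul]
    field_simp

/-- The Mellin transform of `1 - e ^ (-z x)` for `Re z > 0`. Scaling gives `M(r) = r ^ (-s) M(1)`
for real `r`; comparing derivatives at `1` evaluates `M(1)`, and the rest is analytic
continuation in `z`. -/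
lemma mellin_one_sub_exp_neg_mul {z s : ℂ} (hz : 0 < z.re) (h1 : -1 < s.re) (h2 : s.re < 0) :
    mellin (fun x : ℝ ↦ 1 - exp (-(z * x))) s = -Gamma s * z ^ (-s) := by
  set M : ℂ → ℂ := fun w ↦ mellin (fun x : ℝ ↦ 1 - exp (-(w * x))) s with hM
  have hs0 : s ≠ 0 := fun h ↦ by simp [h] at h2
  have hscale : ∀ r : ℝ, 0 < r → M r = (r : ℂ) ^ (-s) * M 1 := fun r hr ↦ by
    have h := mellin_comp_mul_left (fun x : ℝ ↦ 1 - exp (-(x : ℂ))) s hr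
    simpa [hM] using h
  have hone : M 1 = -Gamma s := by
    have hd : HasDerivAt (fun r : ℝ ↦ M r) (∫ x in Ioi (0 : ℝ), (x : ℂ) ^ s * exp (-x)) 1 := by
      have := (hasDerivAt_mellin_one_sub_exp_neg_mul (z := ((1 : ℝ) : ℂ)) (by simp) h1
        h2).comp_ofReal
      simpa using this
    have hd' : HasDerivAt (fun r : ℝ ↦ M r) (-s * M 1) 1 := by
      have e : HasDerivAt (fun r : ℝ ↦ (r : ℂ) ^ (-s) * M 1) (-s * M 1) 1 := by
        have e1 := ((hasDerivAt_id ((1 : ℝ) : ℂ)).cpow_const (c := -s) (by simp)).comp_ofReal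
        simpa using e1.mul_const (M 1)
      refine e.congr_of_eventuallyEq ?_
      filter_upwards [lt_mem_nhds one_pos] with r hr using hscale r hr
    have h := hd.unique hd'
    have hG : ∫ x in Ioi (0 : ℝ), (x : ℂ) ^ s * exp (-x) = Gamma (s + 1) := by
      rw [Gamma_eq_integral (by simpa using by linarith), GammaIntegral]
      refine setIntegral_congr_fun measurableSet_Ioi fun x _ ↦ ?_
      simp [mul_comm]
    rw [hG, Gamma_add_one s hs0] at h
    have := mul_left_cancel₀ hs0 (h.trans (by ring : -s * M 1 = s * (-M 1)))
    rw [this, neg_neg]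
  have hU : IsOpen {w : ℂ | 0 < w.re} := isOpen_lt continuous_const continuous_re
  have hA1 : AnalyticOnNhd ℂ M {w : ℂ | 0 < w.re} := DifferentiableOn.analyticOnNhd
    (fun w hw ↦ (hasDerivAt_mellin_one_sub_exp_neg_mul hw h1
      h2).differentiableAt.differentiableWithinAt) hU
  have hA2 : AnalyticOnNhd ℂ (fun w : ℂ ↦ -Gamma s * w ^ (-s)) {w : ℂ | 0 < w.re} :=
    DifferentiableOn.analyticOnNhd (fun w hw ↦ ((differentiableAt_id.cpow_const
      (Or.inl hw)).const_mul _).differentiableWithinAt) hU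
  refine hA1.eqOn_of_preconnected_of_frequently_eq hA2 (convex_halfSpace_re_gt 0).isPreconnected
    (z₀ := 1) (by simp) ?_ hz
  have ht : Tendsto (fun r : ℝ ↦ (r : ℂ)) (𝓝[>] 1) (𝓝[≠] 1) := by
    refine tendsto_nhdsWithin_iff.2 ⟨?_, ?_⟩
    · exact (continuous_ofReal.tendsto' 1 1 (by simp)).mono_left nhdsWithin_le_nhds
    · filter_upwards [self_mem_nhdsWithin] with r hr
      simpa using ne_of_gt hr
  refine ht.frequently (Eventually.frequently ?_)
  filter_upwards [self_mem_nhdsWithin] with r hr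
  rw [hscale r (one_pos.trans hr), hone, mul_comm]

lemma mellin_one_sub_exp_neg_mul_of_mem_slitPlane {z s : ℂ} (hz : 0 ≤ z.re) (hz' : z ∈ slitPlane)
    (h1 : -1 < s.re) (h2 : s.re < 0) :
    mellin (fun x : ℝ ↦ 1 - exp (-(z * x))) s = -Gamma s * z ^ (-s) := by
  have hz1 : Tendsto (fun ε : ℝ ↦ z + ε) (𝓝[>] 0) (𝓝 z) :=
    ((continuous_const.add continuous_ofReal).tendsto' 0 z (by simp)).mono_left
      nhdsWithin_le_nhds
  have hL : Tendsto (fun ε : ℝ ↦ mellin (fun x : ℝ ↦ 1 - exp (-((z + ε) * x))) s) (𝓝[>] 0)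
      (𝓝 (mellin (fun x : ℝ ↦ 1 - exp (-(z * x))) s)) := by
    refine tendsto_integral_filter_of_dominated_convergence
      (fun x ↦ min 2 ((‖z‖ + 1) * x) * x ^ (s.re - 1)) ?_ ?_
      (integrableOn_min_mul_rpow h1 h2 (by positivity)) ?_
    · filter_upwards [self_mem_nhdsWithin] with ε hε
      have hε : (0 : ℝ) < ε := hε
      exact (mellinConvergent_one_sub_exp_neg_mul (z := z + ε) (by simpa using by linarith) h1
        h2).aestronglyMeasurable
    · filter_upwards [Ioo_mem_nhdsGT (one_pos (α := ℝ))] with ε hε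
      filter_upwards [ae_restrict_mem measurableSet_Ioi] with x hx
      have hx' : (0 : ℝ) < x := hx
      rw [norm_smul, norm_cpow_eq_rpow_re_of_pos hx, mul_comm, sub_re, one_re]
      gcongr
      refine (norm_one_sub_exp_neg_mul_le (z := z + ε) (by simpa using by linarith [hε.1])
        hx').trans ?_
      gcongr
      refine (norm_add_le _ _).trans ?_
      rw [norm_real, Real.norm_of_nonneg hε.1.le]
      linarith [hε.2]
    · refine ae_of_all _ fun x ↦ Tendsto.const_smul ?_ _
      exact tendsto_const_nhds.sub
        ((Complex.continuous_exp.tendsto _).comp (hz1.mul_const (x : ℂ)).neg)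
  have hR : Tendsto (fun ε : ℝ ↦ -Gamma s * (z + ε) ^ (-s)) (𝓝[>] 0)
      (𝓝 (-Gamma s * z ^ (-s))) :=
    Tendsto.const_mul _ (((continuousAt_id.cpow continuousAt_const hz').tendsto).comp hz1)
  refine tendsto_nhds_unique (hL.congr' ?_) hR
  filter_upwards [self_mem_nhdsWithin] with ε hε
  have hε : (0 : ℝ) < ε := hε
  exact mellin_one_sub_exp_neg_mul (z := z + ε) (by simpa using by linarith) h1 h2

/-- The Mellin transform of `1 - cos x` is `-Γ(s) cos (π s / 2)`. -/
lemma mellin_one_sub_cos {s : ℂ} (h1 : -1 < s.re) (h2 : s.re < 0) :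
    mellin (fun x : ℝ ↦ 1 - Complex.cos x) s = -Gamma s * Complex.cos (Real.pi * s / 2) := by
  have e1 : MellinConvergent (fun x : ℝ ↦ 1 - exp (-(I * x))) s :=
    mellinConvergent_one_sub_exp_neg_mul (by simp) h1 h2
  have e2 : MellinConvergent (fun x : ℝ ↦ 1 - exp (-(-I * x))) s :=
    mellinConvergent_one_sub_exp_neg_mul (by simp) h1 h2
  have hadd := (hasMellin_add e1 e2).2
  rw [mellin_one_sub_exp_neg_mul_of_mem_slitPlane (by simp) (by simp [mem_slitPlane_iff]) h1 h2,
    mellin_one_sub_exp_neg_mul_of_mem_slitPlane (by simp) (by simp [mem_slitPlane_iff]) h1 h2]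
    at hadd
  have hc : (fun x : ℝ ↦ 1 - Complex.cos x) =
      fun x : ℝ ↦ ((1 - exp (-(I * x))) + (1 - exp (-(-I * x)))) / 2 := by
    funext x
    rw [Complex.cos, show -(I * (x : ℂ)) = -x * I by ring, show -(-I * (x : ℂ)) = x * I by ring]
    ring
  rw [hc, mellin_div_const, hadd, cpow_def_of_ne_zero I_ne_zero,
    cpow_def_of_ne_zero (neg_ne_zero.2 I_ne_zero), log_I, log_neg_I, Complex.cos,
    show Real.pi / 2 * I * -s = -(Real.pi * s / 2) * I by ring,
    show -(Real.pi / 2) * I * -s = Real.pi * s / 2 * I by ring]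
  ring

lemma mellin_sin_sq {s : ℂ} (h1 : -1 < s.re) (h2 : s.re < 0) :
    mellin (fun x : ℝ ↦ ((Real.sin x ^ 2 : ℝ) : ℂ)) s =
      -(2 : ℂ) ^ (-s) * Gamma s * Complex.cos (Real.pi * s / 2) / 2 := by
  have h : (fun x : ℝ ↦ ((Real.sin x ^ 2 : ℝ) : ℂ)) =
      fun x : ℝ ↦ (1 - Complex.cos ((2 * x : ℝ) : ℂ)) / 2 := by
    funext x
    push_cast
    rw [Complex.cos_two_mul, Complex.sin_sq]
    ring
  rw [h, mellin_div_const, mellin_comp_mul_left (fun x : ℝ ↦ 1 - Complex.cos x) s two_pos,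
    mellin_one_sub_cos h1 h2, smul_eq_mul, ofReal_ofNat]
  ring

lemma integral_cpow_neg_mul_sin_sq {n : ℕ} (hn : n ≠ 0) {s : ℂ} (h1 : -1 < s.re)
    (h2 : s.re < 0) :
    ∫ t in Ioi (0 : ℝ), (t : ℂ) ^ (-s) * ((Real.sin (Real.pi / (n * t)) ^ 2 / t : ℝ) : ℂ) =
      -(n : ℂ) ^ s * ((2 * Real.pi : ℂ) ^ (-s) * Gamma s * Complex.cos (Real.pi * s / 2)) / 2 := by
  have hn0 : (0 : ℝ) < n := by positivity
  have hpi : 0 < Real.pi / n := div_pos Real.pi_pos hn0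
  set f : ℝ → ℂ := fun x ↦ ((Real.sin x ^ 2 : ℝ) : ℂ) with hf
  have h : ∫ t in Ioi (0 : ℝ), (t : ℂ) ^ (-s) * ((Real.sin (Real.pi / (n * t)) ^ 2 / t : ℝ) : ℂ) =
      mellin (fun t : ℝ ↦ (fun u ↦ f (Real.pi / n * u)) t⁻¹) (-s) := by
    refine setIntegral_congr_fun measurableSet_Ioi fun t ht ↦ ?_
    have ht0 : (t : ℂ) ≠ 0 := ofReal_ne_zero.2 (ne_of_gt ht)
    simp only [hf, smul_eq_mul]
    rw [cpow_sub _ _ ht0, cpow_one, div_mul_eq_div_div Real.pi, ← div_eq_mul_inv]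
    push_cast
    field_simp
  rw [h, mellin_comp_inv (fun u ↦ f (Real.pi / n * u)), neg_neg,
    mellin_comp_mul_left _ _ hpi, mellin_sin_sq h1 h2, smul_eq_mul]
  have e : ((Real.pi / n : ℝ) : ℂ) ^ (-s) * (2 : ℂ) ^ (-s) =
      (n : ℂ) ^ s * (2 * Real.pi : ℂ) ^ (-s) := by
    have e1 : ((n : ℝ) : ℂ) ^ (-s) * ((Real.pi / n : ℝ) : ℂ) ^ (-s) = (Real.pi : ℂ) ^ (-s) := by
      rw [← mul_cpow_ofReal_nonneg hn0.le hpi.le, ← ofReal_mul, mul_div_cancel₀ _ hn0.ne']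
    have e2 : (2 * Real.pi : ℂ) ^ (-s) = (2 : ℂ) ^ (-s) * (Real.pi : ℂ) ^ (-s) := by
      have := mul_cpow_ofReal_nonneg zero_le_two Real.pi_pos.le (-s)
      simpa using this
    have e3 : (n : ℂ) ^ s * (n : ℂ) ^ (-s) = 1 := by
      rw [← cpow_add _ _ (Nat.cast_ne_zero.2 hn), add_neg_cancel, cpow_zero]
    rw [e2, ← e1, ofReal_natCast]
    linear_combination (-(2 : ℂ) ^ (-s) * ((Real.pi / n : ℝ) : ℂ) ^ (-s)) * e3
  linear_combination (-Gamma s * Complex.cos (Real.pi * s / 2) / 2) * e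

/-- The functional equation and the Dirichlet series of `1 / ζ(1 - s)` express `1 / ζ(s)`, to the
left of the critical strip, by Mellin transforms of `sin² (π / (n t))`. -/
lemma hasSum_moebius_div_mul_integral_sin_sq {s : ℂ} (h1 : -1 < s.re) (h2 : s.re < 0) :
    HasSum (fun n : ℕ ↦ (ArithmeticFunction.moebius n : ℂ) / n *
      ∫ t in Ioi (0 : ℝ), (t : ℂ) ^ (-s) * ((Real.sin (Real.pi / (n * t)) ^ 2 / t : ℝ) : ℂ))
      (-(riemannZeta s)⁻¹ / 4) := by
  have hs : ∀ n : ℕ, s ≠ -n := fun n h ↦ by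
    rw [h] at h1 h2
    simp only [neg_re, natCast_re, neg_lt_neg_iff] at h1 h2
    have a1 : n < 1 := by exact_mod_cast h1
    have a2 : (0 : ℝ) < n := by linarith
    have a3 : 0 < n := by exact_mod_cast a2
    omega
  have hs1 : s ≠ 1 := fun h ↦ by
    rw [h, one_re] at h2
    linarith
  have h1s : 1 < (1 - s).re := by
    rw [sub_re, one_re]
    linarith
  have hz := riemannZeta_ne_zero_of_one_lt_re h1s
  have hfe := riemannZeta_one_sub hs hs1
  set G : ℂ := (2 * Real.pi : ℂ) ^ (-s) * Gamma s * Complex.cos (Real.pi * s / 2) with hG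
  have hfe' : riemannZeta (1 - s) = 2 * G * riemannZeta s := by
    rw [hfe, hG]
    ring
  have hz0 : riemannZeta s ≠ 0 := fun h ↦ hz (by rw [hfe', h, mul_zero])
  have hval : -(riemannZeta s)⁻¹ / 4 = -G / 2 * (riemannZeta (1 - s))⁻¹ := by
    have hG0 : G ≠ 0 := fun h ↦ hz (by rw [hfe', h]; ring)
    rw [hfe']
    field_simp
    norm_num
  rw [hval]
  convert! (hasSum_moebius_mul_cpow h1s).mul_left (-G / 2) using 2 with n
  rcases eq_or_ne n 0 with rfl | hn
  · simp
  have hn0 : (n : ℂ) ≠ 0 := Nat.cast_ne_zero.2 hn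
  rw [integral_cpow_neg_mul_sin_sq hn h1 h2, ← hG, neg_sub, cpow_sub _ _ hn0, cpow_one]
  field_simp

lemma integrableOn_rpow_mul_sin_sq {n : ℕ} (hn : n ≠ 0) {a : ℝ} (h0 : 0 < a) (h1 : a < 1) :
    IntegrableOn (fun t : ℝ ↦ t ^ a * (Real.sin (Real.pi / (n * t)) ^ 2 / t)) (Ioi 0) := by
  have hmeas : Measurable fun t : ℝ ↦ t ^ a * (Real.sin (Real.pi / (n * t)) ^ 2 / t) := by
    fun_prop
  have hnorm : ∀ t : ℝ, 0 < t → ‖t ^ a * (Real.sin (Real.pi / (n * t)) ^ 2 / t)‖ =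
      Real.sin (Real.pi / (n * t)) ^ 2 * t ^ (a - 1) := fun t ht ↦ by
    rw [Real.norm_of_nonneg (by positivity), Real.rpow_sub_one ht.ne']
    ring
  rw [← Ioc_union_Ioi_eq_Ioi (zero_le_one' ℝ)]
  refine IntegrableOn.union ?_ ?_
  · have h : IntegrableOn (fun t : ℝ ↦ t ^ (a - 1)) (Ioc 0 1) :=
      (intervalIntegrable_iff_integrableOn_Ioc_of_le zero_le_one).1
        (intervalIntegral.intervalIntegrable_rpow' (by linarith))
    refine h.mono' hmeas.aestronglyMeasurable ?_
    filter_upwards [ae_restrict_mem measurableSet_Ioc] with t ht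
    rw [hnorm t ht.1]
    exact mul_le_of_le_one_left (Real.rpow_nonneg ht.1.le _) (Real.sin_sq_le_one _)
  · have h : IntegrableOn (fun t : ℝ ↦ Real.pi ^ 2 * t ^ (a - 3)) (Ioi 1) :=
      (integrableOn_Ioi_rpow_of_lt (by linarith) one_pos).const_mul _
    refine h.mono' hmeas.aestronglyMeasurable ?_
    filter_upwards [ae_restrict_mem measurableSet_Ioi] with t ht
    have ht0 : 0 < t := one_pos.trans ht
    have hn1 : (1 : ℝ) ≤ n := by exact_mod_cast Nat.one_le_iff_ne_zero.2 hn
    rw [hnorm t ht0, show a - 1 = a - 3 + (2 : ℕ) by push_cast; ring,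
      Real.rpow_add_natCast ht0.ne']
    have hsin : Real.sin (Real.pi / (n * t)) ^ 2 ≤ (Real.pi / t) ^ 2 := by
      rw [← sq_abs]
      have h3 : |Real.sin (Real.pi / (n * t))| ≤ |Real.pi / (n * t)| := Real.abs_sin_le_abs
      refine pow_le_pow_left₀ (abs_nonneg _) (h3.trans ?_) 2
      rw [abs_of_nonneg (by positivity)]
      gcongr
      nlinarith
    calc Real.sin (Real.pi / (n * t)) ^ 2 * (t ^ (a - 3) * t ^ 2)
        ≤ (Real.pi / t) ^ 2 * (t ^ (a - 3) * t ^ 2) := by gcongr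
      _ = Real.pi ^ 2 * t ^ (a - 3) := by field_simp

/-- The `n`-dependence of the sine integrals comes from the substitution `t ↦ n t`. -/
lemma integral_rpow_mul_sin_sq (n : ℕ) (hn : n ≠ 0) (a : ℝ) :
    ∫ t in Ioi (0 : ℝ), t ^ a * (Real.sin (Real.pi / (n * t)) ^ 2 / t) =
      (n : ℝ) ^ (-a) * ∫ t in Ioi (0 : ℝ), t ^ a * (Real.sin (Real.pi / t) ^ 2 / t) := by
  have hn0 : (0 : ℝ) < n := by positivity
  have h := integral_comp_mul_left_Ioi (fun t : ℝ ↦ t ^ a * (Real.sin (Real.pi / t) ^ 2 / t)) 0 hn0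
  rw [mul_zero, smul_eq_mul] at h
  have h2 : ∫ t in Ioi (0 : ℝ), (n * t) ^ a * (Real.sin (Real.pi / (n * t)) ^ 2 / (n * t)) =
      (n : ℝ) ^ a * (n : ℝ)⁻¹ *
        ∫ t in Ioi (0 : ℝ), t ^ a * (Real.sin (Real.pi / (n * t)) ^ 2 / t) := by
    rw [← integral_const_mul]
    refine setIntegral_congr_fun measurableSet_Ioi fun t ht ↦ ?_
    have ht : (0 : ℝ) < t := ht
    rw [Real.mul_rpow hn0.le ht.le]
    field_simp
  rw [h2] at h
  have h3 : (n : ℝ) ^ (-a) * (n : ℝ) ^ a = 1 := by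
    rw [← Real.rpow_add hn0, neg_add_cancel, Real.rpow_zero]
  have h4 : (n : ℝ) ^ a * ∫ t in Ioi (0 : ℝ), t ^ a * (Real.sin (Real.pi / (n * t)) ^ 2 / t) =
      ∫ t in Ioi (0 : ℝ), t ^ a * (Real.sin (Real.pi / t) ^ 2 / t) := by
    refine mul_left_cancel₀ (inv_ne_zero hn0.ne') ?_
    rw [← h]
    ring
  rw [← h4, ← mul_assoc, h3, one_mul]
end

/-! ### Shifting the line of an inverse Mellin transform -/

section
open Complex Filter Topology MeasureTheory Set

lemma tendsto_rectIntegral {f : ℂ → ℂ} {a b : ℝ} (hab : a ≤ b) {T ε : ℕ → ℝ}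
    (hT : Tendsto T atTop atTop) (hε : Tendsto ε atTop (𝓝 0))
    (ha : Integrable fun y : ℝ ↦ f (a + y * I)) (hb : Integrable fun y : ℝ ↦ f (b + y * I))
    (hf : ∀ᶠ N in atTop, ∀ x y : ℝ, a ≤ x → x ≤ b → |y| = T N → ‖f (x + y * I)‖ ≤ ε N) :
    Tendsto (fun N ↦ rectIntegral f a b (-T N) (T N)) atTop
      (𝓝 (I * (∫ y : ℝ, f (b + y * I)) - I * ∫ y : ℝ, f (a + y * I))) := by
  have hT' : Tendsto (fun N ↦ -T N) atTop atBot := tendsto_neg_atTop_atBot.comp hT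
  have hor : ∀ τ : ℕ → ℝ, (∀ᶠ N in atTop, |τ N| = T N) →
      Tendsto (fun N ↦ ∫ x in a..b, f (x + τ N * I)) atTop (𝓝 0) := fun τ hτ ↦ by
    refine squeeze_zero_norm' (a := fun N ↦ ε N * |b - a|) ?_ (by simpa using hε.mul_const |b - a|)
    filter_upwards [hf, hτ] with N hN hτN
    refine intervalIntegral.norm_integral_le_of_norm_le_const fun x hx ↦ ?_
    rw [uIoc_of_le hab] at hx
    exact hN x (τ N) hx.1.le hx.2 hτN
  have hpos : ∀ᶠ N in atTop, 0 ≤ T N := hT.eventually_ge_atTop 0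
  have h1 := hor (fun N ↦ -T N) (hpos.mono fun N hN ↦ by rw [abs_neg, abs_of_nonneg hN])
  have h2 := hor T (hpos.mono fun N hN ↦ abs_of_nonneg hN)
  have h3 := ((h1.sub h2).add ((intervalIntegral_tendsto_integral hb hT' hT).const_mul I)).sub
    ((intervalIntegral_tendsto_integral ha hT' hT).const_mul I)
  simpa [rectIntegral] using h3

lemma AnalyticAt.dslope_self {g : ℂ → ℂ} {c : ℂ} (hg : AnalyticAt ℂ g c) :
    AnalyticAt ℂ (dslope g c) c := by
  obtain ⟨p, hp⟩ := hg
  exact ⟨_, hp.has_fpower_series_dslope_fslope⟩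

namespace HasAtMostSimplePoleWithResidue

lemma congr {F G : ℂ → ℂ} {c k : ℂ} (hF : HasAtMostSimplePoleWithResidue F c k)
    (h : ∀ᶠ s in 𝓝[≠] c, G s = F s) : HasAtMostSimplePoleWithResidue G c k := by
  obtain ⟨g, hg, hFg⟩ := hF
  exact ⟨g, hg, by filter_upwards [h, hFg] with s h1 h2 using h1.trans h2⟩

lemma of_analyticAt {g : ℂ → ℂ} {c : ℂ} (hg : AnalyticAt ℂ g c) :
    HasAtMostSimplePoleWithResidue g c 0 :=
  ⟨g, hg, Eventually.of_forall fun s ↦ by simp⟩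

lemma mul_analyticAt {F g : ℂ → ℂ} {c k : ℂ} (hF : HasAtMostSimplePoleWithResidue F c k)
    (hg : AnalyticAt ℂ g c) : HasAtMostSimplePoleWithResidue (fun s ↦ F s * g s) c (k * g c) := by
  obtain ⟨h, hh, hFh⟩ := hF
  refine ⟨fun s ↦ k * dslope g c s + h s * g s, ?_, ?_⟩
  · exact (analyticAt_const.mul (AnalyticAt.dslope_self hg)).add (hh.mul hg)
  · filter_upwards [hFh, self_mem_nhdsWithin] with s hs hsc
    rw [hs, dslope_of_ne _ hsc, slope_def_field]
    have : s - c ≠ 0 := sub_ne_zero.2 hsc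
    field_simp
    ring

/-- At a simple zero `c` of `g` the reciprocal of `g` has a simple pole with residue `1 / g' c`. -/
lemma inv_of_simple_zero {g : ℂ → ℂ} {c : ℂ} (hg : AnalyticAt ℂ g c) (h0 : g c = 0)
    (h1 : deriv g c ≠ 0) :
    HasAtMostSimplePoleWithResidue (fun s ↦ (g s)⁻¹) c (deriv g c)⁻¹ := by
  have hd := AnalyticAt.dslope_self hg
  have hpole : HasAtMostSimplePoleWithResidue (fun s ↦ 1 / (s - c)) c 1 :=
    ⟨0, analyticAt_const, Eventually.of_forall fun s ↦ by simp⟩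
  have h := hpole.mul_analyticAt (hd.inv (by rwa [dslope_same]))
  rw [one_mul, Pi.inv_apply, dslope_same] at h
  refine h.congr ?_
  filter_upwards [self_mem_nhdsWithin] with s hs
  have e := sub_smul_dslope g c s
  rw [h0, sub_zero, smul_eq_mul] at e
  rw [← e, mul_inv, one_div, Pi.inv_apply]

end HasAtMostSimplePoleWithResidue

lemma isOpen_punctured_strip : IsOpen ({s : ℂ | -1 < s.re ∧ s.re < 2} \ {0}) :=
  ((isOpen_lt continuous_const continuous_re).inter
    (isOpen_lt continuous_re continuous_const)).sdiff isClosed_singleton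

section
variable {Φ : ℂ → ℂ} {k : ℂ} {δ : ℝ}

lemma continuous_vertical (hΦ : DifferentiableOn ℂ Φ ({s : ℂ | -1 < s.re ∧ s.re < 2} \ {0}))
    {a : ℝ} (h1 : -1 < a) (h2 : a < 2) (h0 : a ≠ 0) : Continuous fun y : ℝ ↦ Φ (a + y * I) := by
  refine hΦ.continuousOn.comp_continuous (by fun_prop) fun y ↦ ⟨by simpa using ⟨h1, h2⟩, ?_⟩
  intro h
  have := congrArg re (show (a + y * I : ℂ) = 0 from h)
  simp at this
  exact h0 this

lemma integrable_vertical (hΦ : DifferentiableOn ℂ Φ ({s : ℂ | -1 < s.re ∧ s.re < 2} \ {0}))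
    (hδ : 0 < δ) (hdec : DecaysInStrip Φ δ)
    {a : ℝ} (h1 : -1 < a) (h2 : a < 2) (h0 : a ≠ 0) : Integrable fun y : ℝ ↦ Φ (a + y * I) := by
  obtain ⟨C, T₀, hT₀, hC⟩ := hdec a a h1 le_rfl h2
  have hc := continuous_vertical hΦ h1 h2 h0
  have hpos : IntegrableOn (fun y : ℝ ↦ C * |y| ^ (-1 - δ)) (Ioi T₀) := by
    have h := (integrableOn_Ioi_rpow_of_lt (by linarith : -1 - δ < -1) hT₀).const_mul C
    refine IntegrableOn.congr_fun h (fun y hy ↦ ?_) measurableSet_Ioi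
    simp only [abs_of_pos (hT₀.trans hy)]
  refine LocallyIntegrable.integrable_of_isBigO_atBot_atTop (f := fun y : ℝ ↦ Φ (a + y * I))
    (g := fun y : ℝ ↦ C * |y| ^ (-1 - δ)) (g' := fun y : ℝ ↦ C * |y| ^ (-1 - δ))
    hc.locallyIntegrable ?_ ?_ ?_ ?_
  · refine Asymptotics.IsBigO.of_bound 1 ?_
    filter_upwards [eventually_le_atBot (-T₀)] with y hy
    rw [one_mul]
    exact (hC a y le_rfl le_rfl (by rw [abs_of_neg (by linarith)]; linarith)).trans
      (Real.le_norm_self _)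
  · refine ⟨Iio (-T₀), Iio_mem_atBot _, ?_⟩
    have h := hpos.comp_neg
    simpa using h
  · refine Asymptotics.IsBigO.of_bound 1 ?_
    filter_upwards [eventually_ge_atTop T₀] with y hy
    rw [one_mul]
    exact (hC a y le_rfl le_rfl (by rw [abs_of_pos (by linarith)]; linarith)).trans
      (Real.le_norm_self _)
  · exact ⟨Ioi T₀, Ioi_mem_atTop _, hpos⟩

lemma norm_cpow_neg_vertical {x : ℝ} (hx : 0 < x) (a y : ℝ) :
    ‖(x : ℂ) ^ (-(a + y * I : ℂ))‖ = x ^ (-a) := by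
  rw [norm_cpow_eq_rpow_re_of_pos hx]
  simp

lemma integrable_cpow_mul_vertical
    (hΦ : DifferentiableOn ℂ Φ ({s : ℂ | -1 < s.re ∧ s.re < 2} \ {0}))
    (hδ : 0 < δ) (hdec : DecaysInStrip Φ δ)
    {a : ℝ} (h1 : -1 < a) (h2 : a < 2) (h0 : a ≠ 0) {x : ℝ} (hx : 0 < x) :
    Integrable fun y : ℝ ↦ (x : ℂ) ^ (-(a + y * I : ℂ)) * Φ (a + y * I) := by
  refine (integrable_vertical hΦ hδ hdec h1 h2 h0).bdd_mul (c := x ^ (-a)) ?_ ?_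
  · have : Continuous fun y : ℝ ↦ (x : ℂ) ^ (-(a + y * I : ℂ)) :=
      Continuous.const_cpow (by fun_prop) (Or.inl (ofReal_ne_zero.2 hx.ne'))
    exact this.aestronglyMeasurable
  · exact ae_of_all _ fun y ↦ (norm_cpow_neg_vertical hx a y).le

lemma norm_mellinInv_le (Φ : ℂ → ℂ) (a : ℝ) {x : ℝ} (hx : 0 < x) :
    ‖mellinInv a Φ x‖ ≤ (1 / (2 * Real.pi) * ∫ y : ℝ, ‖Φ (a + y * I)‖) * x ^ (-a) := by
  rw [mellinInv, norm_smul, Real.norm_of_nonneg (by positivity), mul_assoc]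
  gcongr
  refine (norm_integral_le_integral_norm _).trans (le_of_eq ?_)
  rw [← integral_mul_const]
  congr 1 with y
  rw [norm_smul, norm_cpow_neg_vertical hx, mul_comm]

lemma rpow_neg_le_add {x : ℝ} (hx : 0 < x) {a b σ : ℝ} (h1 : a ≤ σ) (h2 : σ ≤ b) :
    x ^ (-σ) ≤ x ^ (-a) + x ^ (-b) := by
  have ha := Real.rpow_nonneg hx.le (-a)
  have hb := Real.rpow_nonneg hx.le (-b)
  rcases le_total 1 x with h | h
  · linarith [Real.rpow_le_rpow_of_exponent_le h (neg_le_neg h1)]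
  · linarith [Real.rpow_le_rpow_of_exponent_ge hx h (neg_le_neg h2)]

/-- Shifting the line of integration of an inverse Mellin transform; `S` is empty, or holds the
possible pole `0` when the shift crosses it. -/
lemma mellinInv_sub_mellinInv
    (hΦ : DifferentiableOn ℂ Φ ({s : ℂ | -1 < s.re ∧ s.re < 2} \ {0}))
    (hpole : HasAtMostSimplePoleWithResidue Φ 0 k) (hδ : 0 < δ) (hdec : DecaysInStrip Φ δ)
    {a b : ℝ} (h1 : -1 < a) (hab : a ≤ b) (h2 : b < 2) (ha0 : a ≠ 0) (hb0 : b ≠ 0)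
    (S : Finset ℂ) (hS0 : ∀ p ∈ S, p = 0 ∧ a < 0 ∧ 0 < b) (hS : a < 0 → 0 < b → 0 ∈ S)
    {x : ℝ} (hx : 0 < x) :
    mellinInv b Φ x - mellinInv a Φ x = ∑ _p ∈ S, k := by
  set f : ℂ → ℂ := fun s ↦ (x : ℂ) ^ (-s) * Φ s with hf
  have hx0 : (x : ℂ) ≠ 0 := ofReal_ne_zero.2 hx.ne'
  obtain ⟨C, T₀, hT₀, hC⟩ := hdec a b h1 hab h2
  have hcpow : Differentiable ℂ fun s : ℂ ↦ (x : ℂ) ^ (-s) :=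
    differentiable_neg.const_cpow (Or.inl hx0)
  have hlim := tendsto_rectIntegral (f := f) hab (T := fun N ↦ (N : ℝ))
    (ε := fun N ↦ (x ^ (-a) + x ^ (-b)) * (C * (N : ℝ) ^ (-(1 + δ))))
    tendsto_natCast_atTop_atTop (by
      have h := ((tendsto_rpow_neg_atTop (by linarith : 0 < 1 + δ)).comp
        tendsto_natCast_atTop_atTop).const_mul C |>.const_mul (x ^ (-a) + x ^ (-b))
      simpa using h)
    (integrable_cpow_mul_vertical hΦ hδ hdec h1 (by linarith) ha0 hx)
    (integrable_cpow_mul_vertical hΦ hδ hdec (by linarith) h2 hb0 hx) (by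
      filter_upwards [tendsto_natCast_atTop_atTop.eventually_ge_atTop T₀] with N hN σ t h3 h4 ht
      rw [hf, norm_mul, norm_cpow_neg_vertical hx, ← ht, neg_add']
      gcongr
      · exact rpow_neg_le_add hx h3 h4
      · exact hC σ t h3 h4 (by rwa [ht]))
  have hres : ∀ᶠ N : ℕ in atTop, rectIntegral f a b (-N) N = 2 * Real.pi * I * ∑ _p ∈ S, k := by
    filter_upwards [eventually_gt_atTop 0] with N hN
    have hN' : (0 : ℝ) < N := Nat.cast_pos.2 hN
    refine rectIntegral_eq_sum_residues hab (by linarith) S ?_ ?_ ?_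
    · intro p hp
      obtain ⟨rfl, h3, h4⟩ := hS0 p hp
      simpa using ⟨h3, h4, hN⟩
    · refine hcpow.differentiableOn.mul (hΦ.mono ?_)
      rintro s ⟨hs, hsS⟩
      rw [mem_reProdIm] at hs
      refine ⟨⟨by linarith [hs.1.1], by linarith [hs.1.2]⟩, ?_⟩
      rintro rfl
      refine hsS (hS (lt_of_le_of_ne ?_ ha0) (lt_of_le_of_ne ?_ hb0.symm))
      · simpa using hs.1.1
      · simpa using hs.1.2
    · intro p hp
      obtain ⟨rfl, -, -⟩ := hS0 p hp
      have h := hpole.mul_analyticAt (hcpow.analyticAt 0)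
      rw [neg_zero, cpow_zero, mul_one] at h
      exact h.congr (Eventually.of_forall fun s ↦ mul_comm _ _)
  have huniq := tendsto_nhds_unique (hlim.congr' hres) tendsto_const_nhds
  have hpi : (Real.pi : ℂ) ≠ 0 := ofReal_ne_zero.2 Real.pi_ne_zero
  have e : (∫ y : ℝ, f (b + y * I)) - (∫ y : ℝ, f (a + y * I)) = 2 * Real.pi * ∑ _p ∈ S, k := by
    refine mul_left_cancel₀ I_ne_zero ?_
    rw [mul_sub, huniq]
    ring
  simp only [mellinInv, ← smul_sub, smul_eq_mul]
  rw [e, real_smul]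
  push_cast
  field_simp

lemma mellinInv_eq_of_pos
    (hΦ : DifferentiableOn ℂ Φ ({s : ℂ | -1 < s.re ∧ s.re < 2} \ {0}))
    (hpole : HasAtMostSimplePoleWithResidue Φ 0 k) (hδ : 0 < δ) (hdec : DecaysInStrip Φ δ)
    {a b : ℝ} (ha0 : 0 < a) (ha2 : a < 2) (hb0 : 0 < b) (hb2 : b < 2) {x : ℝ} (hx : 0 < x) :
    mellinInv a Φ x = mellinInv b Φ x := by
  have key : ∀ a b : ℝ, 0 < a → a ≤ b → b < 2 → mellinInv a Φ x = mellinInv b Φ x :=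
    fun a b h1 h2 h3 ↦ by
      have h := mellinInv_sub_mellinInv hΦ hpole hδ hdec (by linarith) h2 h3 h1.ne'
        (h1.trans_le h2).ne' ∅ (by simp) (fun h _ ↦ absurd h h1.not_gt) hx
      rw [Finset.sum_empty, sub_eq_zero] at h
      exact h.symm
  rcases le_total a b with h | h
  · exact key a b ha0 h hb2
  · exact (key b a hb0 h ha2).symm

lemma mellinInv_sub_eq_of_neg
    (hΦ : DifferentiableOn ℂ Φ ({s : ℂ | -1 < s.re ∧ s.re < 2} \ {0}))
    (hpole : HasAtMostSimplePoleWithResidue Φ 0 k) (hδ : 0 < δ) (hdec : DecaysInStrip Φ δ)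
    {a b : ℝ} (ha1 : -1 < a) (ha0 : a < 0) (hb0 : 0 < b) (hb2 : b < 2) {x : ℝ} (hx : 0 < x) :
    mellinInv b Φ x - k = mellinInv a Φ x := by
  have h := mellinInv_sub_mellinInv hΦ hpole hδ hdec ha1 (by linarith) hb2 ha0.ne hb0.ne' {0}
    (by simpa using ⟨ha0, hb0⟩) (by simp) hx
  rw [Finset.sum_singleton] at h
  rw [← h, sub_sub_cancel]

end
end

/-! ### Mellin inversion -/

section
open Complex Filter Topology MeasureTheory Set
open scoped FourierTransform

lemma integrable_exp_neg_mul_abs {η : ℝ} (hη : 0 < η) :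
    Integrable fun u : ℝ ↦ Real.exp (-(η * |u|)) := by
  rw [← integrableOn_univ, ← Iic_union_Ioi (a := (0 : ℝ))]
  refine IntegrableOn.union ?_ ?_
  · refine IntegrableOn.congr_fun (integrableOn_exp_mul_Iic hη 0) (fun u hu ↦ ?_) measurableSet_Iic
    simp only [abs_of_nonpos (show u ≤ 0 from hu), mul_neg, neg_neg]
  · refine IntegrableOn.congr_fun (exp_neg_integrableOn_Ioi 0 hη) (fun u hu ↦ ?_) measurableSet_Ioi
    simp only [abs_of_pos (show 0 < u from hu), neg_mul]

lemma continuous_fourierInv {F : ℝ → ℂ} (hF : Integrable F) : Continuous (𝓕⁻ F) := by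
  have h : Continuous (𝓕 F) := VectorFourier.fourierIntegral_continuous
    Real.continuous_fourierChar (innerSL ℝ).continuous₂ hF
  have e : 𝓕⁻ F = fun u ↦ 𝓕 F (-u) := funext fun u ↦ Real.fourierInv_eq_fourier_neg F u
  rw [e]
  exact h.comp continuous_neg

variable {Φ : ℂ → ℂ} {k : ℂ} {δ : ℝ}

lemma integrable_vertical_two_pi_mul
    (hΦ : DifferentiableOn ℂ Φ ({s : ℂ | -1 < s.re ∧ s.re < 2} \ {0}))
    (hδ : 0 < δ) (hdec : DecaysInStrip Φ δ)
    {a : ℝ} (h1 : -1 < a) (h2 : a < 2) (h0 : a ≠ 0) :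
    Integrable fun y : ℝ ↦ Φ (a + 2 * Real.pi * y * I) := by
  have h := (integrable_vertical hΦ hδ hdec h1 h2 h0).comp_mul_left' (R := 2 * Real.pi)
    (by positivity)
  simpa using h

lemma continuousOn_mellinInv
    (hΦ : DifferentiableOn ℂ Φ ({s : ℂ | -1 < s.re ∧ s.re < 2} \ {0}))
    (hδ : 0 < δ) (hdec : DecaysInStrip Φ δ)
    {a : ℝ} (h1 : -1 < a) (h2 : a < 2) (h0 : a ≠ 0) :
    ContinuousOn (mellinInv a Φ) (Ioi 0) := by
  have hc := continuous_fourierInv (integrable_vertical_two_pi_mul hΦ hδ hdec h1 h2 h0)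
  refine ContinuousOn.congr (f := fun x : ℝ ↦ (x : ℂ) ^ (-a : ℂ) •
    𝓕⁻ (fun y : ℝ ↦ Φ (a + 2 * Real.pi * y * I)) (-Real.log x)) ?_
    fun x hx ↦ mellinInv_eq_fourierInv a Φ hx
  refine ContinuousOn.smul (f := fun x : ℝ ↦ (x : ℂ) ^ (-a : ℂ)) (fun x hx ↦ ?_) ?_
  · exact (continuousAt_ofReal_cpow_const _ _ (Or.inr (ne_of_gt hx))).continuousWithinAt
  · exact hc.comp_continuousOn (Real.continuousOn_log.mono fun x hx ↦ ne_of_gt hx).neg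

lemma mellinConvergent_mellinInv
    (hΦ : DifferentiableOn ℂ Φ ({s : ℂ | -1 < s.re ∧ s.re < 2} \ {0}))
    (hpole : HasAtMostSimplePoleWithResidue Φ 0 k) (hδ : 0 < δ) (hdec : DecaysInStrip Φ δ)
    {σ : ℝ} (hσ0 : 0 < σ) (hσ2 : σ < 2) {s : ℂ} (hs0 : 0 < s.re) (hs2 : s.re < 2) :
    MellinConvergent (mellinInv σ Φ) s := by
  have hO : ∀ a : ℝ, 0 < a → a < 2 → ∀ l : Filter ℝ, (∀ᶠ x in l, 0 < x) →
      mellinInv σ Φ =O[l] fun x : ℝ ↦ x ^ (-a) := fun a ha0 ha2 l hl ↦ by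
    refine Asymptotics.IsBigO.of_bound (1 / (2 * Real.pi) * ∫ y : ℝ, ‖Φ (a + y * I)‖) ?_
    filter_upwards [hl] with x hx
    rw [mellinInv_eq_of_pos hΦ hpole hδ hdec hσ0 hσ2 ha0 ha2 hx,
      Real.norm_of_nonneg (Real.rpow_nonneg hx.le _)]
    exact norm_mellinInv_le Φ a hx
  exact mellinConvergent_of_isBigO_rpow (a := (s.re + 2) / 2) (b := s.re / 2)
    ((continuousOn_mellinInv hΦ hδ hdec (by linarith) hσ2 hσ0.ne').locallyIntegrableOn
      measurableSet_Ioi)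
    (hO _ (by linarith) (by linarith) _ (eventually_gt_atTop 0)) (by linarith)
    (hO _ (by linarith) (by linarith) _ self_mem_nhdsWithin) (by linarith)

/-- Mellin inversion: by Fourier inversion, since moving the line to either side of `Re s` shows
that the inverse Fourier transform of `y ↦ Φ (Re s + 2 π i y)` decays exponentially. -/
lemma mellin_mellinInv
    (hΦ : DifferentiableOn ℂ Φ ({s : ℂ | -1 < s.re ∧ s.re < 2} \ {0}))
    (hpole : HasAtMostSimplePoleWithResidue Φ 0 k) (hδ : 0 < δ) (hdec : DecaysInStrip Φ δ)
    {s : ℂ} (hs0 : 0 < s.re) (hs2 : s.re < 2) :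
    mellin (mellinInv s.re Φ) s = Φ s := by
  set a : ℝ := s.re with ha
  set F : ℝ → ℂ := fun y ↦ Φ (a + 2 * Real.pi * y * I) with hF
  have hFint : Integrable F :=
    integrable_vertical_two_pi_mul hΦ hδ hdec (by linarith) hs2 hs0.ne'
  have hFcont : Continuous F := by
    have h := (continuous_vertical hΦ (by linarith) hs2 hs0.ne').comp
      (continuous_const.mul continuous_id : Continuous fun y : ℝ ↦ 2 * Real.pi * y)
    simpa [Function.comp_def] using h
  have hinv : ∀ u : ℝ, Real.exp (-a * u) • mellinInv a Φ (Real.exp (-u)) = 𝓕⁻ F u := fun u ↦ by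
    rw [mellinInv_eq_fourierInv a Φ (Real.exp_pos _), Real.log_exp, neg_neg, ← ofReal_neg,
      ← ofReal_cpow (Real.exp_pos _).le, ← Real.exp_mul, neg_mul_neg, coe_smul, smul_smul,
      ← Real.exp_add, mul_comm u a, neg_mul, neg_add_cancel, Real.exp_zero, one_smul]
  obtain ⟨η, hη0, hη1, hη2⟩ : ∃ η : ℝ, 0 < η ∧ 0 < a - η ∧ a + η < 2 := by
    refine ⟨min a (2 - a) / 2, ?_, ?_, ?_⟩
    · have : 0 < min a (2 - a) := lt_min hs0 (by linarith)
      linarith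
    · linarith [min_le_left a (2 - a)]
    · linarith [min_le_right a (2 - a)]
  set B : ℝ → ℝ := fun b ↦ 1 / (2 * Real.pi) * ∫ y : ℝ, ‖Φ (b + y * I)‖ with hB
  have hB0 : ∀ b, 0 ≤ B b := fun b ↦
    mul_nonneg (by positivity) (integral_nonneg fun _ ↦ norm_nonneg _)
  have hbound : ∀ b : ℝ, 0 < b → b < 2 → ∀ u : ℝ, ‖𝓕⁻ F u‖ ≤ B b * Real.exp ((b - a) * u) :=
    fun b hb0 hb2 u ↦ by
      rw [← hinv, norm_smul, Real.norm_of_nonneg (Real.exp_pos _).le,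
        mellinInv_eq_of_pos hΦ hpole hδ hdec hs0 hs2 hb0 hb2 (Real.exp_pos _)]
      calc Real.exp (-a * u) * ‖mellinInv b Φ (Real.exp (-u))‖
          ≤ Real.exp (-a * u) * (B b * Real.exp (-u) ^ (-b)) := by
            gcongr
            exact norm_mellinInv_le Φ b (Real.exp_pos _)
        _ = B b * Real.exp ((b - a) * u) := by
            rw [← Real.exp_mul, mul_left_comm, ← Real.exp_add]
            ring_nf
  have hInt : Integrable (𝓕⁻ F) := by
    refine ((integrable_exp_neg_mul_abs hη0).const_mul (B (a - η) + B (a + η))).mono'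
      (continuous_fourierInv hFint).aestronglyMeasurable (ae_of_all _ fun u ↦ ?_)
    rcases le_total 0 u with hu | hu
    · refine (hbound (a - η) hη1 (by linarith) u).trans ?_
      rw [abs_of_nonneg hu, show (a - η - a) * u = -(η * u) by ring]
      gcongr
      linarith [hB0 (a + η)]
    · refine (hbound (a + η) (by linarith) hη2 u).trans ?_
      rw [abs_of_nonpos hu, show (a + η - a) * u = -(η * -u) by ring]
      gcongr
      linarith [hB0 (a - η)]
  have hInt' : Integrable (𝓕 F) := by
    have e : 𝓕 F = fun u ↦ 𝓕⁻ F (-u) := funext fun u ↦ by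
      rw [Real.fourierInv_eq_fourier_neg, neg_neg]
    rw [e]
    exact hInt.comp_neg
  rw [mellin_eq_fourier]
  simp only [← ha, hinv]
  have h := hFint.fourier_fourierInv_eq hInt' (v := s.im / (2 * Real.pi)) hFcont.continuousAt
  rw [show (fun u ↦ 𝓕⁻ F u) = 𝓕⁻ F from rfl, h]
  have hpi : (Real.pi : ℂ) ≠ 0 := ofReal_ne_zero.2 Real.pi_ne_zero
  have e : 2 * Real.pi * ((s.im / (2 * Real.pi) : ℝ) : ℂ) = s.im := by
    push_cast
    field_simp
  simp only [hF]
  rw [e, ha, re_add_im]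

end

/-! ### The integrals of `Φ / ζ` on both sides of the critical strip -/

section
open Complex Filter Topology MeasureTheory Set

lemma riemannZeta_ne_zero_of_re_nonpos {s : ℂ} (h1 : -1 < s.re) (h2 : s.re ≤ 0) :
    riemannZeta s ≠ 0 := by
  rcases eq_or_ne s 0 with rfl | hs0
  · rw [riemannZeta_zero]
    norm_num
  have hs : ∀ n : ℕ, s ≠ -n := fun n h ↦ by
    have h3 : (n : ℝ) < 1 := by
      rw [h] at h1
      simpa using h1
    have h4 : n < 1 := by exact_mod_cast h3
    exact hs0 (by rw [h, Nat.lt_one_iff.1 h4, Nat.cast_zero, neg_zero])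
  have hs1 : s ≠ 1 := fun h ↦ by
    rw [h, one_re] at h2
    linarith
  have hz : riemannZeta (1 - s) ≠ 0 := riemannZeta_ne_zero_of_one_le_re (by simpa using h2)
  exact fun h ↦ hz (by rw [riemannZeta_one_sub hs hs1, h, mul_zero])

lemma hasAtMostSimplePoleWithResidue_inv_riemannZeta_one :
    HasAtMostSimplePoleWithResidue (fun s ↦ (riemannZeta s)⁻¹) 1 0 := by
  have h : AnalyticAt ℂ (fun s ↦ (s - 1) * (riemannZeta₁ s)⁻¹) 1 :=
    (analyticAt_id.sub analyticAt_const).mul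
      ((differentiable_riemannZeta₁.analyticAt 1).inv (by rw [riemannZeta₁_one]; exact one_ne_zero))
  refine (HasAtMostSimplePoleWithResidue.of_analyticAt h).congr ?_
  filter_upwards [self_mem_nhdsWithin] with s hs
  rw [riemannZeta_eq_inv_sub_mul hs, mul_inv, inv_inv]

lemma analyticAt_riemannZeta {s : ℂ} (hs : s ≠ 1) : AnalyticAt ℂ riemannZeta s := by
  have h : DifferentiableOn ℂ riemannZeta {1}ᶜ := fun z hz ↦
    (differentiableAt_riemannZeta hz).differentiableWithinAt
  exact h.analyticAt (isOpen_compl_singleton.mem_nhds hs)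

lemma continuous_inv_riemannZeta_vertical {a : ℝ} (ha1 : a ≠ 1)
    (hz : ∀ y : ℝ, riemannZeta (a + y * I) ≠ 0) :
    Continuous fun y : ℝ ↦ (riemannZeta (a + y * I))⁻¹ := by
  refine Continuous.inv₀ (continuous_iff_continuousAt.2 fun y ↦ ?_) hz
  have h : (a + y * I : ℂ) ≠ 1 := fun h ↦ ha1 (by simpa using congrArg re h)
  exact ContinuousAt.comp (f := fun y : ℝ ↦ (a + y * I : ℂ))
    (differentiableAt_riemannZeta h).continuousAt (by fun_prop)

/-- Termwise integration of a uniformly summable series against an integrable function. -/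
lemma hasSum_integral_mul_of_summable {F W : ℝ → ℂ} {w : ℕ → ℝ → ℂ} {u : ℕ → ℝ}
    (hF : Integrable F) (hw : ∀ n, AEStronglyMeasurable (fun y ↦ F y * w n y))
    (hu : Summable u) (hwu : ∀ n y, ‖w n y‖ ≤ u n) (hW : ∀ y, HasSum (w · y) (W y)) :
    HasSum (fun n ↦ ∫ y, F y * w n y) (∫ y, F y * W y) := by
  refine hasSum_integral_of_dominated_convergence (fun n y ↦ ‖F y‖ * u n) hw
    (fun n ↦ ae_of_all _ fun y ↦ ?_) (ae_of_all _ fun y ↦ hu.mul_left _) ?_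
    (ae_of_all _ fun y ↦ (hW y).mul_left _)
  · rw [norm_mul]
    gcongr
    exact hwu n y
  · simp only [tsum_mul_left]
    exact hF.norm.mul_const _

variable {Φ : ℂ → ℂ} {k : ℂ} {δ : ℝ}

lemma integrable_mul_inv_riemannZeta_right
    (hΦ : DifferentiableOn ℂ Φ ({s : ℂ | -1 < s.re ∧ s.re < 2} \ {0}))
    (hδ : 0 < δ) (hdec : DecaysInStrip Φ δ) {c : ℝ} (h1 : 1 < c) (h2 : c < 2) :
    Integrable fun y : ℝ ↦ Φ (c + y * I) * (riemannZeta (c + y * I))⁻¹ := by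
  have hre : ∀ y : ℝ, 1 < (c + y * I : ℂ).re := fun y ↦ by simpa using h1
  refine (integrable_vertical hΦ hδ hdec (by linarith) h2 (by linarith)).mul_bdd
    (c := ∑' n : ℕ, 1 / (n : ℝ) ^ c)
    (continuous_inv_riemannZeta_vertical h1.ne' fun y ↦
      riemannZeta_ne_zero_of_one_lt_re (hre y)).aestronglyMeasurable
    (ae_of_all _ fun y ↦ ?_)
  have h := norm_inv_riemannZeta_le (hre y)
  simpa using h

/-- The integral of `Φ / ζ` to the right of the critical strip. -/
lemma hasSum_moebius_mul_mellinInv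
    (hΦ : DifferentiableOn ℂ Φ ({s : ℂ | -1 < s.re ∧ s.re < 2} \ {0}))
    (hδ : 0 < δ) (hdec : DecaysInStrip Φ δ) {c : ℝ} (h1 : 1 < c) (h2 : c < 2) :
    HasSum (fun n : ℕ ↦ (ArithmeticFunction.moebius n : ℂ) * mellinInv c Φ n)
      (1 / (2 * Real.pi) * ∫ y : ℝ, Φ (c + y * I) * (riemannZeta (c + y * I))⁻¹) := by
  have hre : ∀ y : ℝ, 1 < (c + y * I : ℂ).re := fun y ↦ by simpa using h1
  have hF := integrable_vertical hΦ hδ hdec (by linarith) h2 (by linarith : c ≠ 0)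
  have hcont : ∀ n : ℕ, Continuous fun y : ℝ ↦ (n : ℂ) ^ (-(c + y * I : ℂ)) := fun n ↦ by
    refine Continuous.const_cpow (by fun_prop) (Or.inr fun y h ↦ ?_)
    have := congrArg re h
    simp at this
    linarith
  have h := (hasSum_integral_mul_of_summable (u := fun n : ℕ ↦ 1 / (n : ℝ) ^ c)
    (w := fun n y ↦ (ArithmeticFunction.moebius n : ℂ) * (n : ℂ) ^ (-(c + y * I : ℂ)))
    hF (fun n ↦ hF.aestronglyMeasurable.mul
      (continuous_const.mul (hcont n)).aestronglyMeasurable)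
    (Real.summable_one_div_nat_rpow.2 h1)
    (fun n y ↦ by simpa using norm_moebius_mul_cpow_le (c + y * I) n)
    (fun y ↦ hasSum_moebius_mul_cpow (hre y))).mul_left (1 / (2 * Real.pi : ℂ))
  convert! h using 2 with n
  have e : ∀ y : ℝ, Φ (c + y * I) *
      ((ArithmeticFunction.moebius n : ℂ) * (n : ℂ) ^ (-(c + y * I : ℂ))) =
      (ArithmeticFunction.moebius n : ℂ) * ((n : ℂ) ^ (-(c + y * I : ℂ)) * Φ (c + y * I)) :=
    fun y ↦ by ring
  simp only [e, integral_const_mul, mellinInv, smul_eq_mul, real_smul, ofReal_natCast]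
  push_cast
  ring

lemma norm_integral_cpow_neg_mul_sin_sq_le {n : ℕ} (hn : n ≠ 0) (s : ℂ) :
    ‖∫ t in Ioi (0 : ℝ), (t : ℂ) ^ (-s) * ((Real.sin (Real.pi / (n * t)) ^ 2 / t : ℝ) : ℂ)‖ ≤
      (n : ℝ) ^ s.re * ∫ t in Ioi (0 : ℝ), t ^ (-s.re) * (Real.sin (Real.pi / t) ^ 2 / t) := by
  have h := integral_rpow_mul_sin_sq n hn (-s.re)
  rw [neg_neg] at h
  rw [← h]
  refine (norm_integral_le_integral_norm _).trans (le_of_eq ?_)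
  refine setIntegral_congr_fun measurableSet_Ioi fun t ht ↦ ?_
  have ht : (0 : ℝ) < t := ht
  rw [norm_mul, norm_cpow_eq_rpow_re_of_pos ht, norm_real, neg_re,
    Real.norm_of_nonneg (by positivity)]

lemma norm_moebius_div_mul_integral_sin_sq_le (n : ℕ) {s : ℂ} {a : ℝ} (hs : s.re = a) :
    ‖(ArithmeticFunction.moebius n : ℂ) / n *
      ∫ t in Ioi (0 : ℝ), (t : ℂ) ^ (-s) * ((Real.sin (Real.pi / (n * t)) ^ 2 / t : ℝ) : ℂ)‖ ≤
      1 / (n : ℝ) ^ (1 - a) *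
        ∫ t in Ioi (0 : ℝ), t ^ (-a) * (Real.sin (Real.pi / t) ^ 2 / t) := by
  have hK : 0 ≤ ∫ t in Ioi (0 : ℝ), t ^ (-a) * (Real.sin (Real.pi / t) ^ 2 / t) :=
    setIntegral_nonneg measurableSet_Ioi fun t (ht : 0 < t) ↦ by positivity
  rcases eq_or_ne n 0 with rfl | hn
  · simpa using mul_nonneg (inv_nonneg.2 (Real.rpow_nonneg le_rfl (1 - a))) hK
  have hn0 : (0 : ℝ) < n := by positivity
  have hmu : ‖(ArithmeticFunction.moebius n : ℂ)‖ ≤ 1 := by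
    rw [norm_intCast]
    exact_mod_cast ArithmeticFunction.abs_moebius_le_one
  rw [norm_mul, norm_div, norm_natCast]
  calc _ ≤ 1 / (n : ℝ) * ((n : ℝ) ^ a *
        ∫ t in Ioi (0 : ℝ), t ^ (-a) * (Real.sin (Real.pi / t) ^ 2 / t)) := by
        gcongr
        rw [← hs]
        exact norm_integral_cpow_neg_mul_sin_sq_le hn s
    _ = _ := by
        rw [Real.rpow_sub hn0, Real.rpow_one]
        field_simp

lemma exists_norm_inv_riemannZeta_le_left {a : ℝ} (h1 : -1 < a) (h2 : a < 0) :
    ∃ B : ℝ, ∀ y : ℝ, ‖(riemannZeta (a + y * I))⁻¹‖ ≤ B := by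
  have hu : Summable fun n : ℕ ↦ 1 / (n : ℝ) ^ (1 - a) *
      ∫ t in Ioi (0 : ℝ), t ^ (-a) * (Real.sin (Real.pi / t) ^ 2 / t) :=
    (Real.summable_one_div_nat_rpow.2 (by linarith)).mul_right _
  refine ⟨4 * ∑' n : ℕ, 1 / (n : ℝ) ^ (1 - a) *
      ∫ t in Ioi (0 : ℝ), t ^ (-a) * (Real.sin (Real.pi / t) ^ 2 / t), fun y ↦ ?_⟩
  have hs := hasSum_moebius_div_mul_integral_sin_sq (s := a + y * I) (by simpa using h1)
    (by simpa using h2)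
  have h := tsum_of_norm_bounded hu.hasSum fun n ↦
    norm_moebius_div_mul_integral_sin_sq_le n (s := a + y * I) (a := a) (by simp)
  rw [hs.tsum_eq, norm_div, norm_neg, norm_ofNat, div_le_iff₀' four_pos] at h
  exact h

lemma integrable_mul_inv_riemannZeta_left
    (hΦ : DifferentiableOn ℂ Φ ({s : ℂ | -1 < s.re ∧ s.re < 2} \ {0}))
    (hδ : 0 < δ) (hdec : DecaysInStrip Φ δ) {a : ℝ} (h1 : -1 < a) (h2 : a < 0) :
    Integrable fun y : ℝ ↦ Φ (a + y * I) * (riemannZeta (a + y * I))⁻¹ := by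
  obtain ⟨B, hB⟩ := exists_norm_inv_riemannZeta_le_left h1 h2
  exact (integrable_vertical hΦ hδ hdec h1 (by linarith) h2.ne).mul_bdd
    (c := B) (continuous_inv_riemannZeta_vertical (by linarith) fun y ↦
      riemannZeta_ne_zero_of_re_nonpos (by simpa using h1)
        (by simpa using h2.le)).aestronglyMeasurable (ae_of_all _ hB)

lemma integrable_vertical_mul_cpow_mul_sin_sq
    (hΦ : DifferentiableOn ℂ Φ ({s : ℂ | -1 < s.re ∧ s.re < 2} \ {0}))
    (hδ : 0 < δ) (hdec : DecaysInStrip Φ δ) {a : ℝ} (h1 : -1 < a) (h2 : a < 0) {n : ℕ}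
    (hn : n ≠ 0) :
    Integrable (fun p : ℝ × ℝ ↦ Φ (a + p.1 * I) * ((p.2 : ℂ) ^ (-(a + p.1 * I : ℂ)) *
      ((Real.sin (Real.pi / (n * p.2)) ^ 2 / p.2 : ℝ) : ℂ)))
      (volume.prod (volume.restrict (Ioi 0))) := by
  have hF := integrable_vertical hΦ hδ hdec h1 (by linarith) h2.ne
  have hcont := continuous_vertical hΦ h1 (by linarith) h2.ne
  have hK := integrableOn_rpow_mul_sin_sq hn (neg_pos.2 h2) (by linarith : -a < 1)
  refine (hF.norm.mul_prod hK).mono' ?_ ?_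
  · have hm1 : Measurable fun p : ℝ × ℝ ↦ Φ (a + p.1 * I) := hcont.measurable.comp measurable_fst
    have hm2 : Measurable fun p : ℝ × ℝ ↦ (p.2 : ℂ) ^ (-(a + p.1 * I : ℂ)) := by fun_prop
    have hm3 : Measurable fun p : ℝ × ℝ ↦
      ((Real.sin (Real.pi / (n * p.2)) ^ 2 / p.2 : ℝ) : ℂ) := by fun_prop
    exact (hm1.mul (hm2.mul hm3)).aestronglyMeasurable
  · have hmem : ∀ᵐ p : ℝ × ℝ ∂(volume.prod (volume.restrict (Ioi 0))), 0 < p.2 :=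
      Measure.quasiMeasurePreserving_snd.ae (ae_restrict_mem measurableSet_Ioi)
    filter_upwards [hmem] with p hp
    rw [norm_mul, norm_mul, norm_cpow_neg_vertical hp, norm_real,
      Real.norm_of_nonneg (by positivity)]

/-- The integral of `Φ / ζ` to the left of the critical strip. -/
lemma hasSum_moebius_div_mul_integral_mellinInv
    (hΦ : DifferentiableOn ℂ Φ ({s : ℂ | -1 < s.re ∧ s.re < 2} \ {0}))
    (hδ : 0 < δ) (hdec : DecaysInStrip Φ δ) {a : ℝ} (h1 : -1 < a) (h2 : a < 0) :
    HasSum (fun n : ℕ ↦ (ArithmeticFunction.moebius n : ℂ) / n *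
      ∫ t in Ioi (0 : ℝ), mellinInv a Φ t * ((Real.sin (Real.pi / (n * t)) ^ 2 / t : ℝ) : ℂ))
      (-(1 / (2 * Real.pi) * ∫ y : ℝ, Φ (a + y * I) * (riemannZeta (a + y * I))⁻¹) / 4) := by
  have hF := integrable_vertical hΦ hδ hdec h1 (by linarith) h2.ne
  have hP := fun n (hn : n ≠ 0) ↦
    integrable_vertical_mul_cpow_mul_sin_sq hΦ hδ hdec h1 h2 (n := n) hn
  have hpi : (Real.pi : ℂ) ≠ 0 := ofReal_ne_zero.2 Real.pi_ne_zero
  have h := (hasSum_integral_mul_of_summable (W := fun y ↦ -(riemannZeta (a + y * I))⁻¹ / 4)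
    (w := fun n y ↦ (ArithmeticFunction.moebius n : ℂ) / n * ∫ t in Ioi (0 : ℝ),
      (t : ℂ) ^ (-(a + y * I : ℂ)) * ((Real.sin (Real.pi / (n * t)) ^ 2 / t : ℝ) : ℂ))
    hF (fun n ↦ ?_)
    ((Real.summable_one_div_nat_rpow.2 (by linarith : 1 < 1 - a)).mul_right
      (∫ t in Ioi (0 : ℝ), t ^ (-a) * (Real.sin (Real.pi / t) ^ 2 / t)))
    (fun n y ↦ norm_moebius_div_mul_integral_sin_sq_le n (by simp))
    (fun y ↦ hasSum_moebius_div_mul_integral_sin_sq (by simpa using h1)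
      (by simpa using h2))).mul_left (1 / (2 * Real.pi : ℂ))
  · convert! h using 1
    · funext n
      rcases eq_or_ne n 0 with rfl | hn
      · simp
      have hswap := integral_integral_swap (f := fun y t : ℝ ↦ Φ (a + y * I) *
        ((t : ℂ) ^ (-(a + y * I : ℂ)) * ((Real.sin (Real.pi / (n * t)) ^ 2 / t : ℝ) : ℂ))) (hP n hn)
      have e1 : ∀ t ∈ Ioi (0 : ℝ), ∫ y : ℝ, Φ (a + y * I) * ((t : ℂ) ^ (-(a + y * I : ℂ)) *
          ((Real.sin (Real.pi / (n * t)) ^ 2 / t : ℝ) : ℂ)) =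
          2 * Real.pi * (mellinInv a Φ t * ((Real.sin (Real.pi / (n * t)) ^ 2 / t : ℝ) : ℂ)) :=
        fun t ht ↦ by
          simp only [← mul_assoc]
          rw [integral_mul_const]
          simp only [mul_comm (Φ _), mellinInv, smul_eq_mul, real_smul]
          generalize ∫ y : ℝ, (t : ℂ) ^ (-(a + y * I : ℂ)) * Φ (a + y * I) = J
          push_cast
          field_simp
      rw [setIntegral_congr_fun measurableSet_Ioi e1, integral_const_mul] at hswap
      simp only [integral_const_mul] at hswap
      have e2 : ∀ (y : ℝ) (m J : ℂ), Φ (a + y * I) * (m * J) = m * (Φ (a + y * I) * J) :=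
        fun y m J ↦ mul_left_comm _ _ _
      simp only [e2 _ ((ArithmeticFunction.moebius n : ℂ) / n), integral_const_mul]
      rw [hswap]
      field_simp
    · simp only [mul_div_assoc', mul_neg, integral_neg, integral_div, neg_div]
  · rcases eq_or_ne n 0 with rfl | hn
    · simpa using aestronglyMeasurable_const
    have e := ((hP n hn).integral_prod_left.const_mul
      ((ArithmeticFunction.moebius n : ℂ) / n)).aestronglyMeasurable
    simp only [integral_const_mul, ← mul_left_comm (Φ _)] at e
    exact e
end

/-! ### The sum over the zeros -/

section
open Complex Filter Topology MeasureTheory Set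

lemma mem_nontrivialZetaZerosBelow {T : ℝ} {ρ : ℂ} :
    ρ ∈ nontrivialZetaZerosBelow T ↔ ρ ∈ nontrivialZetaZeros ∧ |ρ.im| < T := by
  simp [nontrivialZetaZerosBelow]

variable {Φ : ℂ → ℂ} {k : ℂ} {δ : ℝ}

/-- The residue theorem for `Φ / ζ` on a rectangle whose horizontal sides avoid the zeros. -/
lemma rectIntegral_mul_inv_riemannZeta
    (hsimple : ∀ ρ ∈ nontrivialZetaZeros, deriv riemannZeta ρ ≠ 0)
    (hΦ : DifferentiableOn ℂ Φ ({s : ℂ | -1 < s.re ∧ s.re < 2} \ {0}))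
    (hpole : HasAtMostSimplePoleWithResidue Φ 0 k) {a c T : ℝ} (ha1 : -1 < a) (ha0 : a < 0)
    (hc1 : 1 < c) (hc2 : c < 2) (hT : 0 < T)
    (hz : ∀ x y : ℝ, a ≤ x → x ≤ c → |y| = T → riemannZeta (x + y * I) ≠ 0) :
    rectIntegral (fun s ↦ Φ s * (riemannZeta s)⁻¹) a c (-T) T =
      2 * Real.pi * I *
        (-2 * k + ∑ ρ ∈ nontrivialZetaZerosBelow T, Φ ρ * (deriv riemannZeta ρ)⁻¹) := by
  -- `Φ` contributes the pole at `0`, where `ζ 0 = -1 / 2`; at `1` the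
  -- pole of `ζ` leaves residue `0`
  set r : ℂ → ℂ := fun p ↦ if p = 0 then -2 * k else
    if p = 1 then 0 else Φ p * (deriv riemannZeta p)⁻¹ with hr
  have hne : ∀ ρ ∈ nontrivialZetaZerosBelow T, ρ ≠ 0 ∧ ρ ≠ 1 := fun ρ hρ ↦ by
    obtain ⟨⟨-, h1, h2⟩, -⟩ := mem_nontrivialZetaZerosBelow.1 hρ
    constructor
    · rintro rfl
      simp at h1
    · rintro rfl
      simp at h2
  have hanal : ∀ s : ℂ, -1 < s.re → s.re < 2 → s ≠ 0 → AnalyticAt ℂ Φ s := fun s h1 h2 h3 ↦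
    hΦ.analyticAt (isOpen_punctured_strip.mem_nhds ⟨⟨h1, h2⟩, h3⟩)
  have hsum : ∑ p ∈ insert 0 (insert 1 (nontrivialZetaZerosBelow T)), r p =
      -2 * k + ∑ ρ ∈ nontrivialZetaZerosBelow T, Φ ρ * (deriv riemannZeta ρ)⁻¹ := by
    rw [Finset.sum_insert, Finset.sum_insert]
    · have e0 : r 0 = -2 * k := if_pos rfl
      have e1 : r 1 = 0 := by simp [hr]
      rw [e0, e1, zero_add]
      congr 1
      refine Finset.sum_congr rfl fun ρ hρ ↦ ?_
      simp only [hr]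
      rw [if_neg (hne ρ hρ).1, if_neg (hne ρ hρ).2]
    · exact fun h ↦ (hne 1 h).2 rfl
    · rw [Finset.mem_insert, not_or]
      exact ⟨zero_ne_one, fun h ↦ (hne 0 h).1 rfl⟩
  rw [← hsum]
  refine rectIntegral_eq_sum_residues (by linarith) (by linarith) _ ?_ ?_ ?_
  · intro p hp
    rw [Finset.mem_insert, Finset.mem_insert] at hp
    rcases hp with rfl | rfl | hp
    · exact ⟨by simpa using ha0, by simpa using by linarith, by simpa using hT, by simpa using hT⟩
    · exact ⟨by simpa using by linarith, by simpa using hc1, by simpa using hT, by simpa using hT⟩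
    · obtain ⟨⟨-, h1, h2⟩, h3⟩ := mem_nontrivialZetaZerosBelow.1 hp
      obtain ⟨h4, h5⟩ := abs_lt.1 h3
      exact ⟨by linarith, by linarith, h4, h5⟩
  · rintro s ⟨hs, hsS⟩
    obtain ⟨⟨h1, h2⟩, h3, h4⟩ := mem_reProdIm.1 hs
    simp only [Finset.coe_insert, Set.mem_insert_iff, Finset.mem_coe, not_or] at hsS
    obtain ⟨hs0, hs1, hsz⟩ := hsS
    have hzs : riemannZeta s ≠ 0 := by
      rcases le_or_gt s.re 0 with h5 | h5
      · exact riemannZeta_ne_zero_of_re_nonpos (by linarith) h5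
      rcases le_or_gt 1 s.re with h6 | h6
      · exact riemannZeta_ne_zero_of_one_le_re h6
      intro h0
      rcases (abs_le.2 ⟨h3, h4⟩ : |s.im| ≤ T).lt_or_eq with h7 | h7
      · exact hsz (mem_nontrivialZetaZerosBelow.2 ⟨⟨h0, h5, h6⟩, h7⟩)
      · exact hz s.re s.im h1 h2 h7 (by rwa [re_add_im])
    exact ((hanal s (by linarith) (by linarith) hs0).differentiableAt.mul
      ((differentiableAt_riemannZeta hs1).inv hzs)).differentiableWithinAt
  · intro p hp
    rw [Finset.mem_insert, Finset.mem_insert] at hp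
    rcases hp with rfl | rfl | hp
    · have hz0 : riemannZeta 0 ≠ 0 := riemannZeta_ne_zero_of_re_nonpos (by simp) (by simp)
      have h := hpole.mul_analyticAt ((analyticAt_riemannZeta zero_ne_one).inv hz0)
      have e : r 0 = k * riemannZeta⁻¹ 0 := by
        simp only [hr, if_pos, Pi.inv_apply, riemannZeta_zero]
        ring
      rw [e]
      exact h
    · have h := hasAtMostSimplePoleWithResidue_inv_riemannZeta_one.mul_analyticAt
        (hanal 1 (by simp) (by simp) one_ne_zero)
      have e : r 1 = 0 * Φ 1 := by simp [hr]
      rw [e]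
      exact h.congr (Eventually.of_forall fun s ↦ mul_comm _ _)
    · obtain ⟨hρ, -⟩ := mem_nontrivialZetaZerosBelow.1 hp
      obtain ⟨hp0, hp1⟩ := hne p hp
      have h := (HasAtMostSimplePoleWithResidue.inv_of_simple_zero (analyticAt_riemannZeta hp1)
        hρ.1 (hsimple p hρ)).mul_analyticAt
          (hanal p (by linarith [hρ.2.1]) (by linarith [hρ.2.2]) hp0)
      have e : r p = (deriv riemannZeta p)⁻¹ * Φ p := by
        simp only [hr]
        rw [if_neg hp0, if_neg hp1, mul_comm]
      rw [e]
      exact h.congr (Eventually.of_forall fun s ↦ mul_comm _ _)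

/-- Along suitable heights the sum over the zeros converges to the difference of the integrals of
`Φ / ζ` along the two sides of the critical strip, corrected by the residue at `0`. -/
lemma exists_heights_tendsto_sum_zeros
    (hsimple : ∀ ρ ∈ nontrivialZetaZeros, deriv riemannZeta ρ ≠ 0)
    (hΦ : DifferentiableOn ℂ Φ ({s : ℂ | -1 < s.re ∧ s.re < 2} \ {0}))
    (hpole : HasAtMostSimplePoleWithResidue Φ 0 k) (hδ : 0 < δ) (hdec : DecaysInStrip Φ δ) :
    ∃ T : ℕ → ℝ, Tendsto T atTop atTop ∧
      Tendsto (fun N ↦ ∑ ρ ∈ nontrivialZetaZerosBelow (T N), Φ ρ * (deriv riemannZeta ρ)⁻¹) atTop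
        (𝓝 (2 * k +
          (1 / (2 * Real.pi) * ∫ y : ℝ, Φ ((21 / 20 : ℝ) + y * I) *
            (riemannZeta ((21 / 20 : ℝ) + y * I))⁻¹) -
          1 / (2 * Real.pi) * ∫ y : ℝ, Φ ((-1 / 2 : ℝ) + y * I) *
            (riemannZeta ((-1 / 2 : ℝ) + y * I))⁻¹)) := by
  obtain ⟨C, hC0, hC⟩ := exists_height_norm_inv_riemannZeta_le hsimple
  choose T hT hT1 hTζ using fun N : ℕ ↦ hC N
  have hTtop : Tendsto T atTop atTop := tendsto_atTop_mono hT tendsto_natCast_atTop_atTop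
  refine ⟨T, hTtop, ?_⟩
  obtain ⟨D, T₀, hT₀, hD⟩ := hdec (-1 / 2) (21 / 20) (by norm_num) (by norm_num) (by norm_num)
  set f : ℂ → ℂ := fun s ↦ Φ s * (riemannZeta s)⁻¹ with hf
  have hlim := tendsto_rectIntegral (f := f) (a := -1 / 2) (b := 21 / 20) (by norm_num) hTtop
    (ε := fun N ↦ D * C * T N ^ (-δ)) (by
      have h := ((tendsto_rpow_neg_atTop hδ).comp hTtop).const_mul (D * C)
      simpa using h)
    (integrable_mul_inv_riemannZeta_left hΦ hδ hdec (by norm_num) (by norm_num))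
    (integrable_mul_inv_riemannZeta_right hΦ hδ hdec (by norm_num) (by norm_num)) (by
      filter_upwards [hTtop.eventually_ge_atTop T₀] with N hN x y hx1 hx2 hy
      have hTpos : 0 < T N := one_pos.trans_le (hT1 N)
      have h1 := hD x y hx1 hx2 (by rwa [hy])
      have h2 := (hTζ N x y hx1 hx2 hy).2
      rw [hy] at h1
      calc ‖f (x + y * I)‖ ≤ D * T N ^ (-1 - δ) * (C * T N) := by
            rw [hf, norm_mul]
            gcongr
            exact (norm_nonneg _).trans h1
        _ = D * C * (T N ^ (-1 - δ) * T N) := by ring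
        _ = D * C * T N ^ (-δ) := by
            rw [← Real.rpow_add_one hTpos.ne']
            ring_nf)
  have hpi : (Real.pi : ℂ) ≠ 0 := ofReal_ne_zero.2 Real.pi_ne_zero
  have h := (hlim.const_mul (1 / (2 * Real.pi * I))).const_add (2 * k)
  refine (h.congr fun N ↦ ?_).trans_eq ?_
  · rw [rectIntegral_mul_inv_riemannZeta hsimple hΦ hpole (by norm_num) (by norm_num)
      (by norm_num) (by norm_num) (one_pos.trans_le (hT1 N))
      fun x y hx1 hx2 hy ↦ (hTζ N x y hx1 hx2 hy).1]
    field_simp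
    ring
  · congr 1
    simp only [hf]
    generalize ∫ y : ℝ, Φ ((21 / 20 : ℝ) + y * I) * (riemannZeta ((21 / 20 : ℝ) + y * I))⁻¹ = A
    generalize ∫ y : ℝ, Φ ((-1 / 2 : ℝ) + y * I) * (riemannZeta ((-1 / 2 : ℝ) + y * I))⁻¹ = B
    field_simp
    ring
end

theorem theorem2p9
    -- the non-trivial zeros of the zeta function are simple
    (hsimple : ∀ ρ ∈ nontrivialZetaZeros, deriv riemannZeta ρ ≠ 0)
    (Φ : ℂ → ℂ) (k : ℂ)
    (hΦ : DifferentiableOn ℂ Φ ({s : ℂ | -1 < s.re ∧ s.re < 2} \ {0}))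
    (hpole : HasAtMostSimplePoleWithResidue Φ 0 k)
    (hdecay : ∃ δ : ℝ, 0 < δ ∧ DecaysInStrip Φ δ)
    (σ : ℝ) (hσ0 : 0 < σ) (hσ2 : σ < 2)
    -- the inverse Mellin transform of `Φ`, taken along the line `Re s = σ`
    (φ : ℝ → ℂ) (hφ : ∀ x : ℝ, 0 < x → φ x = mellinInv σ Φ x) :
    ∃ T : ℕ → ℝ, Filter.Tendsto T Filter.atTop Filter.atTop ∧
      -- every integral and both series in the formula converge absolutely
      (∀ ρ ∈ nontrivialZetaZeros,
        MeasureTheory.IntegrableOn (fun x : ℝ => φ x * (x : ℂ) ^ (ρ - 1)) (Set.Ioi 0)) ∧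
      (∀ n : ℕ, 1 ≤ n → MeasureTheory.IntegrableOn
        (fun t : ℝ => (φ t - k) * ((Real.sin (Real.pi / (n * t)) ^ 2 / t : ℝ) : ℂ))
        (Set.Ioi 0)) ∧
      Summable (fun n : ℕ => (ArithmeticFunction.moebius n : ℂ) * φ n) ∧
      Summable (fun n : ℕ => (ArithmeticFunction.moebius n : ℂ) / n *
        ∫ t in Set.Ioi (0 : ℝ),
          (φ t - k) * ((Real.sin (Real.pi / (n * t)) ^ 2 / t : ℝ) : ℂ)) ∧
      -- the bracketed sum over the zeros converges, and the formula holds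
      -- (the terms `n = 0` vanish, as `μ 0 = 0`)
      ∃ L : ℂ,
        Filter.Tendsto
          (fun N : ℕ => ∑ ρ ∈ nontrivialZetaZerosBelow (T N),
            1 / deriv riemannZeta ρ * ∫ x in Set.Ioi (0 : ℝ), φ x * (x : ℂ) ^ (ρ - 1))
          Filter.atTop (nhds L) ∧
        ∑' n : ℕ, (ArithmeticFunction.moebius n : ℂ) * φ n =
          -2 * k + L -
            4 * ∑' n : ℕ, (ArithmeticFunction.moebius n : ℂ) / n *
              ∫ t in Set.Ioi (0 : ℝ),
                (φ t - k) * ((Real.sin (Real.pi / (n * t)) ^ 2 / t : ℝ) : ℂ) := by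
  obtain ⟨δ, hδ, hdec⟩ := hdecay
  obtain ⟨T, hT, hlim⟩ := exists_heights_tendsto_sum_zeros hsimple hΦ hpole hδ hdec
  have hφn : ∀ n : ℕ, (ArithmeticFunction.moebius n : ℂ) * φ n =
      (ArithmeticFunction.moebius n : ℂ) * mellinInv (21 / 20) Φ n := fun n ↦ by
    rcases Nat.eq_zero_or_pos n with rfl | hn
    · simp
    have hn' : (0 : ℝ) < n := Nat.cast_pos.2 hn
    rw [hφ n hn', mellinInv_eq_of_pos (b := 21 / 20) hΦ hpole hδ hdec hσ0 hσ2 (by norm_num)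
      (by norm_num) hn']
  have hφk : ∀ t : ℝ, 0 < t → φ t - k = mellinInv (-1 / 2) Φ t := fun t ht ↦ by
    rw [hφ t ht, mellinInv_sub_eq_of_neg (a := -1 / 2) hΦ hpole hδ hdec (by norm_num)
      (by norm_num) hσ0 hσ2 ht]
  have hφρ : ∀ ρ ∈ nontrivialZetaZeros, Set.EqOn (fun x : ℝ ↦ φ x * (x : ℂ) ^ (ρ - 1))
      (fun x : ℝ ↦ (x : ℂ) ^ (ρ - 1) • mellinInv ρ.re Φ x) (Set.Ioi 0) := fun ρ hρ x hx ↦ by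
    simp only [smul_eq_mul]
    rw [hφ x hx, mellinInv_eq_of_pos hΦ hpole hδ hdec hσ0 hσ2 hρ.2.1 (by linarith [hρ.2.2]) hx,
      mul_comm]
  have hint : ∀ n : ℕ, Set.EqOn
      (fun t : ℝ ↦ (φ t - k) * ((Real.sin (Real.pi / (n * t)) ^ 2 / t : ℝ) : ℂ))
      (fun t : ℝ ↦ mellinInv (-1 / 2) Φ t * ((Real.sin (Real.pi / (n * t)) ^ 2 / t : ℝ) : ℂ))
      (Set.Ioi 0) := fun n t ht ↦ by
    simp only
    rw [hφk t ht]
  have hright := hasSum_moebius_mul_mellinInv hΦ hδ hdec (c := 21 / 20) (by norm_num) (by norm_num)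
  have hleft := hasSum_moebius_div_mul_integral_mellinInv hΦ hδ hdec (a := -1 / 2) (by norm_num)
    (by norm_num)
  simp only [← hφn] at hright
  simp only [← MeasureTheory.setIntegral_congr_fun measurableSet_Ioi (hint _)] at hleft
  refine ⟨T, hT, fun ρ hρ ↦ ?_, fun n hn ↦ ?_, hright.summable, hleft.summable, _,
    hlim.congr fun N ↦ ?_, ?_⟩
  · refine MeasureTheory.IntegrableOn.congr_fun ?_ (hφρ ρ hρ).symm measurableSet_Ioi
    exact mellinConvergent_mellinInv hΦ hpole hδ hdec hρ.2.1 (by linarith [hρ.2.2]) hρ.2.1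
      (by linarith [hρ.2.2])
  · refine MeasureTheory.IntegrableOn.congr_fun ?_ (hint n).symm measurableSet_Ioi
    have h := (integrableOn_rpow_mul_sin_sq (a := 1 / 2) (Nat.one_le_iff_ne_zero.1 hn)
      (by norm_num) (by norm_num)).const_mul
        (1 / (2 * Real.pi) * ∫ y : ℝ, ‖Φ ((-1 / 2 : ℝ) + y * Complex.I)‖)
    refine h.mono' ?_ ?_
    · refine MeasureTheory.AEStronglyMeasurable.mul ?_ ?_
      · exact (continuousOn_mellinInv hΦ hδ hdec (by norm_num) (by norm_num)
          (by norm_num)).aestronglyMeasurable measurableSet_Ioi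
      · exact (by fun_prop : Measurable fun t : ℝ ↦
          ((Real.sin (Real.pi / (n * t)) ^ 2 / t : ℝ) : ℂ)).aestronglyMeasurable
    · filter_upwards [MeasureTheory.ae_restrict_mem measurableSet_Ioi] with t ht
      have ht' : (0 : ℝ) < t := ht
      rw [norm_mul, Complex.norm_real, Real.norm_of_nonneg (by positivity), ← mul_assoc]
      gcongr
      have hb := norm_mellinInv_le Φ (-1 / 2) ht'
      rwa [show -(-1 / 2 : ℝ) = 1 / 2 by norm_num] at hb
  · refine Finset.sum_congr rfl fun ρ hρ ↦ ?_
    have hρ' := (mem_nontrivialZetaZerosBelow.1 hρ).1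
    rw [MeasureTheory.setIntegral_congr_fun measurableSet_Ioi (hφρ ρ hρ'), ← mellin,
      mellin_mellinInv hΦ hpole hδ hdec hρ'.2.1 (by linarith [hρ'.2.2]), one_div, mul_comm]
  · rw [hright.tsum_eq, hleft.tsum_eq]
    ring
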